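/- Let $R$ be a commutative ring with unit and let $C$, $D$ be coassociative counital $R$-coalgebras that are flat as $R$-modules. Unadorned tensor products are over $R$; $\mathcal M^C$ and ${}^C\mathcal M$ denote the categories of right and of left $C$-comodules. For a right $C$-comodule $(M,\varrho_M)$ and a left $C$-comodule $(N,\varrho_N)$, the cotensor product is $M\,\square_C N=\ker(\varrho_M\otimes \mathrm{id}_N-\mathrm{id}_M\otimes\varrho_N : M\otimes N\to M\otimes C\otimes N)$. A $C$-$D$-bicomodule $X$ is a left $C$-comodule and right $D$-comodule with compatible coactions; by flatness, $N\,\square_C X$ is then a right $D$-subcomodule of $N\otimes X$ and $X\,\square_D P$ a left $C$-subcomodule of $X\otimes P$, for $N\in\mathcal M^C$, $P\in{}^D\mathcal M$. $X$ is called invertible if $-\,\square_C X:\mathcal M^C\to\mathcal M^D$ is an equivalence of categories. A right $D$-comodule $X$ is * quasi-finite if $-\otimes X: R\text{-Mod}\to\mathcal M^D$ has a left adjoint $h_D(X,-)$, whose unit is denoted by $\eta$; * faithfully coflat if $X\,\square_D-:{}^D\mathcal M\to R\text{-Mod}$ is exact and faithful; * an injector if $-\otimes X: R\text{-Mod}\to\mathcal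 M^D$ preserves injective objects. If $X$ is quasi-finite, its coendomorphism coalgebra is $e_D(X)=h_D(X,X)$, whose comultiplication $\Delta$ and counit $\varepsilon$ are the unique linear maps with $(\Delta\otimes \mathrm{id}_X)\eta_X=(\mathrm{id}\otimes\eta_X)\eta_X$ and $(\varepsilon\otimes\mathrm{id}_X)\eta_X(x)=1\otimes x$; the map $\eta_X:X\to e_D(X)\otimes X$ makes $X$ a left $e_D(X)$-comodule. For a $C$-$D$-bicomodule $X$ with $X_D$ quasi-finite, we write $e_D(X)\cong C$ if there is an isomorphism of coalgebras $\varphi:e_D(X)\to C$ that identifies this coaction with the given one, i.e. $(\varphi\otimes\mathrm{id}_X)\eta_X=\varrho_X^-:X\to C\otimes X$. For left comodules all notions are defined symmetrically; in particular $e_C(X)\cong D$ means that there is an isomorphism of coalgebras $\psi:e_C(X)\to D$ with $(\mathrm{id}_X\otimes\psi)\eta_X=\varrho_X^+:X\to X\otimes D$. For every $C$-$D$-bicomodule $X$ the following are equivalent: 1. $X$ is invertible. 2. $X\,\square_D-:{}^D\mathcal M\to{}^C\mathcal M$ is an equivalence of categories. 3. $X_D$ is quasi-finite, faithfully coflat and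 an injector, and $e_D(X)\cong C$. 4. ${}_CX$ is quasi-finite, faithfully coflat and an injector, and $e_C(X)\cong D$. In this case $C$ and $D$ are Morita-Takeuchi equivalent, i.e. the categories $\mathcal M^C$ and $\mathcal M^D$ are equivalent, and so are ${}^C\mathcal M$ and ${}^D\mathcal M$. -/

import Mathlib

open CategoryTheory TensorProduct

universe u

set_option linter.unusedSimpArgs false

/-- Right comodules over an `R`-coalgebra `C`. -/
structure RightComodule (R : Type u) [CommRing R] (C : Type u) [AddCommGroup C] [Module R C]
    [Coalgebra R C] where
  carrier : Type u
  [addCommGroup : AddCommGroup carrier]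
  [module : Module R carrier]
  /-- the coaction `ϱ : M → M ⊗ C` -/
  coact : carrier →ₗ[R] carrier ⊗[R] C
  coassoc : (TensorProduct.assoc R carrier C C).toLinearMap ∘ₗ coact.rTensor C ∘ₗ coact =
    (Coalgebra.comul (R := R) (A := C)).lTensor carrier ∘ₗ coact
  counit : (Coalgebra.counit (R := R) (A := C)).lTensor carrier ∘ₗ coact =
    (TensorProduct.mk R carrier R).flip 1

/-- Left comodules over an `R`-coalgebra `C`. -/
structure LeftComodule (R : Type u) [CommRing R] (C : Type u) [AddCommGroup C] [Module R C]
    [Coalgebra R C] where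
  carrier : Type u
  [addCommGroup : AddCommGroup carrier]
  [module : Module R carrier]
  /-- the coaction `ϱ : M → C ⊗ M` -/
  coact : carrier →ₗ[R] C ⊗[R] carrier
  coassoc : (TensorProduct.assoc R C C carrier).toLinearMap ∘ₗ
      (Coalgebra.comul (R := R) (A := C)).rTensor carrier ∘ₗ coact = coact.lTensor C ∘ₗ coact
  counit : (Coalgebra.counit (R := R) (A := C)).rTensor carrier ∘ₗ coact =
    TensorProduct.mk R R carrier 1

/-- `C`-`D`-bicomodules: a left `C`-comodule and a right `D`-comodule on the same module, the two
coactions being compatible. -/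
structure Bicomodule (R : Type u) [CommRing R] (C : Type u) [AddCommGroup C] [Module R C]
    [Coalgebra R C] (D : Type u) [AddCommGroup D] [Module R D] [Coalgebra R D] where
  carrier : Type u
  [addCommGroup : AddCommGroup carrier]
  [module : Module R carrier]
  /-- the left coaction `ϱ⁻ : X → C ⊗ X` -/
  lcoact : carrier →ₗ[R] C ⊗[R] carrier
  lcoassoc : (TensorProduct.assoc R C C carrier).toLinearMap ∘ₗ
      (Coalgebra.comul (R := R) (A := C)).rTensor carrier ∘ₗ lcoact = lcoact.lTensor C ∘ₗ lcoact
  lcounit : (Coalgebra.counit (R := R) (A := C)).rTensor carrier ∘ₗ lcoact =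
    TensorProduct.mk R R carrier 1
  /-- the right coaction `ϱ⁺ : X → X ⊗ D` -/
  rcoact : carrier →ₗ[R] carrier ⊗[R] D
  rcoassoc : (TensorProduct.assoc R carrier D D).toLinearMap ∘ₗ rcoact.rTensor D ∘ₗ rcoact =
    (Coalgebra.comul (R := R) (A := D)).lTensor carrier ∘ₗ rcoact
  rcounit : (Coalgebra.counit (R := R) (A := D)).lTensor carrier ∘ₗ rcoact =
    (TensorProduct.mk R carrier R).flip 1
  compat : (TensorProduct.assoc R C carrier D).toLinearMap ∘ₗ lcoact.rTensor D ∘ₗ rcoact =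
    rcoact.lTensor C ∘ₗ lcoact

attribute [instance] RightComodule.addCommGroup RightComodule.module
  LeftComodule.addCommGroup LeftComodule.module Bicomodule.addCommGroup Bicomodule.module

noncomputable section

namespace RightComodule

variable {R : Type u} [CommRing R] {C : Type u} [AddCommGroup C] [Module R C] [Coalgebra R C]

/-- Colinear maps between right comodules. -/
@[ext]
structure Hom (M N : RightComodule R C) where
  lin : M.carrier →ₗ[R] N.carrier
  comm : N.coact ∘ₗ lin = lin.rTensor C ∘ₗ M.coact

instance : Category (RightComodule R C) where
  Hom M N := Hom M N
  id M := ⟨LinearMap.id, by simp⟩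
  comp f g := ⟨g.lin ∘ₗ f.lin, by
    rw [← LinearMap.comp_assoc, g.comm, LinearMap.comp_assoc, f.comm, LinearMap.rTensor_comp,
      LinearMap.comp_assoc]⟩

@[ext]
theorem hom_ext {M N : RightComodule R C} {f g : M ⟶ N} (h : f.lin = g.lin) : f = g :=
  Hom.ext h

@[simp] theorem id_lin (M : RightComodule R C) : Hom.lin (𝟙 M) = LinearMap.id := rfl

@[simp] theorem comp_lin {M N P : RightComodule R C} (f : M ⟶ N) (g : N ⟶ P) :
    (f ≫ g).lin = g.lin ∘ₗ f.lin := rfl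

/-- The right comodule `W ⊗ M` with coaction `id ⊗ ϱ`, for an `R`-module `W`. -/
def tensor (W : Type u) [AddCommGroup W] [Module R W] (M : RightComodule R C) :
    RightComodule R C where
  carrier := W ⊗[R] M.carrier
  coact := (TensorProduct.assoc R W M.carrier C).symm.toLinearMap ∘ₗ M.coact.lTensor W
  coassoc := by
    refine ext' fun w m => ?_
    have h := LinearMap.congr_fun M.coassoc m
    simp only [LinearMap.comp_apply, LinearEquiv.coe_coe, LinearMap.lTensor_tmul] at h ⊢
    trans (TensorProduct.assoc R W M.carrier (C ⊗[R] C)).symm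
      (w ⊗ₜ (Coalgebra.comul (R := R) (A := C)).lTensor M.carrier (M.coact m))
    · rw [← h]
      generalize M.coact m = y
      induction y with
      | zero => simp
      | add a b ha hb => simp only [tmul_add, map_add, ha, hb]
      | tmul m' c =>
        simp only [TensorProduct.assoc_symm_tmul, LinearMap.rTensor_tmul, LinearMap.comp_apply,
          LinearMap.lTensor_tmul, LinearEquiv.coe_coe]
        generalize M.coact m' = z
        induction z <;> simp_all [tmul_add, add_tmul]
    · generalize M.coact m = y
      induction y <;> simp_all [tmul_add, add_tmul]
  counit := by
    refine ext' fun w m => ?_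
    have h := LinearMap.congr_fun M.counit m
    simp only [LinearMap.comp_apply, LinearEquiv.coe_coe, LinearMap.lTensor_tmul] at h ⊢
    trans (TensorProduct.assoc R W M.carrier R).symm
      (w ⊗ₜ (Coalgebra.counit (R := R) (A := C)).lTensor M.carrier (M.coact m))
    · generalize M.coact m = y
      induction y <;> simp_all [tmul_add, add_tmul]
    · rw [h]; simp

/-- The colinear map `f ⊗ id : V ⊗ M → W ⊗ M` of a linear map `f : V → W`. -/
def tensorMap {V W : Type u} [AddCommGroup V] [Module R V] [AddCommGroup W] [Module R W]
    (f : V →ₗ[R] W) (M : RightComodule R C) : tensor V M ⟶ tensor W M where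
  lin := f.rTensor M.carrier
  comm := by
    refine ext' fun w m => ?_
    change (TensorProduct.assoc R W M.carrier C).symm (f w ⊗ₜ M.coact m) =
      (f.rTensor M.carrier).rTensor C
        ((TensorProduct.assoc R V M.carrier C).symm (w ⊗ₜ M.coact m))
    generalize M.coact m = y
    induction y <;> simp_all [tmul_add, add_tmul]

/-- The functor `- ⊗ M` from `R`-modules to right `C`-comodules. -/
def tensorFunctor (M : RightComodule R C) : ModuleCat.{u} R ⥤ RightComodule R C where
  obj W := tensor W M
  map f := tensorMap f.hom M
  map_id W := hom_ext (LinearMap.rTensor_id M.carrier W)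
  map_comp f g := hom_ext (LinearMap.rTensor_comp M.carrier g.hom f.hom)

/-- The colinear map `id ⊗ f : W ⊗ M → W ⊗ N` of a colinear map `f : M → N`. -/
def tensorMapRight (W : Type u) [AddCommGroup W] [Module R W] {M N : RightComodule R C}
    (f : M ⟶ N) : tensor W M ⟶ tensor W N where
  lin := f.lin.lTensor W
  comm := by
    refine ext' fun w m => ?_
    have h : N.coact (f.lin m) = f.lin.rTensor C (M.coact m) := LinearMap.congr_fun f.comm m
    change (TensorProduct.assoc R W N.carrier C).symm (w ⊗ₜ N.coact (f.lin m)) =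
      (f.lin.lTensor W).rTensor C
        ((TensorProduct.assoc R W M.carrier C).symm (w ⊗ₜ M.coact m))
    rw [h]
    generalize M.coact m = y
    induction y <;> simp_all [tmul_add, add_tmul]

/-- The canonical map `V ⊗ (W ⊗ M) → (V ⊗ W) ⊗ M` is colinear. -/
def tensorAssoc (V W : Type u) [AddCommGroup V] [Module R V] [AddCommGroup W] [Module R W]
    (M : RightComodule R C) : tensor V (tensor W M) ⟶ tensor (V ⊗[R] W) M where
  lin := (TensorProduct.assoc R V W M.carrier).symm.toLinearMap
  comm := by
    have key : ((TensorProduct.assoc R (V ⊗[R] W) M.carrier C).symm.toLinearMap ∘ₗ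
        M.coact.lTensor (V ⊗[R] W)) ∘ₗ (TensorProduct.assoc R V W M.carrier).symm.toLinearMap =
        (TensorProduct.assoc R V W M.carrier).symm.toLinearMap.rTensor C ∘ₗ
          (TensorProduct.assoc R V (W ⊗[R] M.carrier) C).symm.toLinearMap ∘ₗ
            ((TensorProduct.assoc R W M.carrier C).symm.toLinearMap ∘ₗ
              M.coact.lTensor W).lTensor V := by
      refine ext' fun v x => ?_
      induction x with
      | zero => simp
      | add a b ha hb => rw [tmul_add, map_add, map_add, ha, hb]
      | tmul w m =>
        simp only [LinearMap.comp_apply, LinearEquiv.coe_coe, LinearMap.lTensor_tmul,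
          TensorProduct.assoc_symm_tmul]
        generalize M.coact m = y
        induction y <;> simp_all [tmul_add, add_tmul]
    exact key

/-- The canonical map `M → R ⊗ M` is colinear. -/
def tensorUnit (M : RightComodule R C) : M ⟶ tensor R M where
  lin := TensorProduct.mk R R M.carrier 1
  comm := by
    refine LinearMap.ext fun m => ?_
    change (TensorProduct.assoc R R M.carrier C).symm (1 ⊗ₜ M.coact m) =
      (TensorProduct.mk R R M.carrier 1).rTensor C (M.coact m)
    generalize M.coact m = y
    induction y <;> simp_all [tmul_add, add_tmul]

/-! ### Quasi-finite comodules, the cohom functor and the coendomorphism coalgebra -/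

/-- `M` is quasi-finite if `- ⊗ M : R-Mod ⥤ M^C` has a left adjoint. -/
abbrev QuasiFinite (M : RightComodule R C) : Prop := M.tensorFunctor.IsRightAdjoint

variable (M : RightComodule R C) [M.QuasiFinite]

/-- The cohom functor `h_C(M, -) : M^C ⥤ R-Mod`. -/
def cohom : RightComodule R C ⥤ ModuleCat.{u} R :=
  M.tensorFunctor.leftAdjoint

/-- The adjunction defining the cohom functor. -/
def cohomAdj : M.cohom ⊣ M.tensorFunctor :=
  Adjunction.ofIsRightAdjoint M.tensorFunctor

/-- The module `e_C(M) = h_C(M, M)` underlying the coendomorphism coalgebra. -/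
def Coend : Type u := M.cohom.obj M

instance : AddCommGroup M.Coend :=
  inferInstanceAs (AddCommGroup (M.cohom.obj M))

instance : Module R M.Coend :=
  inferInstanceAs (Module R (M.cohom.obj M))

/-- The unit of adjunction `η_M : M → e_C(M) ⊗ M`, as a morphism of comodules. -/
def coendUnitHom : M ⟶ tensor M.Coend M :=
  M.cohomAdj.unit.app M

/-- The unit of adjunction `η_M : M → e_C(M) ⊗ M`, as a linear map. -/
def coendUnit :
    M.carrier →ₗ[R] M.Coend ⊗[R] M.carrier :=
  M.coendUnitHom.lin

/-- The linear map `e_C(M) → W` corresponding to a colinear map `M → W ⊗ M`. -/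
def coendLift {W : Type u} [AddCommGroup W] [Module R W]
    (f : M ⟶ tensor W M) : M.Coend →ₗ[R] W :=
  ((M.cohomAdj.homEquiv M (ModuleCat.of R W)).symm f).hom

theorem coendLift_spec {W : Type u} [AddCommGroup W]
    [Module R W] (f : M ⟶ tensor W M) :
    (M.coendLift f).rTensor M.carrier ∘ₗ M.coendUnit = f.lin := by
  have h := (M.cohomAdj.homEquiv M (ModuleCat.of R W)).apply_symm_apply f
  rw [Adjunction.homEquiv_unit] at h
  exact congrArg Hom.lin h

theorem coend_ext {W : Type u} [AddCommGroup W]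
    [Module R W] {g g' : M.Coend →ₗ[R] W}
    (h : g.rTensor M.carrier ∘ₗ M.coendUnit = g'.rTensor M.carrier ∘ₗ M.coendUnit) : g = g' := by
  have h' : (ModuleCat.ofHom g : M.cohom.obj M ⟶ ModuleCat.of R W) = ModuleCat.ofHom g' := by
    apply (M.cohomAdj.homEquiv M (ModuleCat.of R W)).injective
    refine Eq.trans (Adjunction.homEquiv_unit ..) (Eq.trans ?_ (Adjunction.homEquiv_unit ..).symm)
    exact hom_ext h
  exact congrArg ModuleCat.Hom.hom h'

/-- The comultiplication corresponds to `(id ⊗ η) ∘ η : M → e ⊗ e ⊗ M`, the counit to the canonical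
map `M → R ⊗ M`. -/
instance : CoalgebraStruct R M.Coend where
  comul := M.coendLift
    (M.coendUnitHom ≫ tensorMapRight M.Coend M.coendUnitHom ≫ tensorAssoc M.Coend M.Coend M)
  counit := M.coendLift (tensorUnit M)

theorem coend_comul :
    (CoalgebraStruct.comul (R := R) (A := M.Coend)).rTensor M.carrier ∘ₗ M.coendUnit =
      (TensorProduct.assoc R M.Coend M.Coend M.carrier).symm.toLinearMap ∘ₗ
        M.coendUnit.lTensor M.Coend ∘ₗ M.coendUnit :=
  M.coendLift_spec _

theorem coend_counit :
    (CoalgebraStruct.counit (R := R) (A := M.Coend)).rTensor M.carrier ∘ₗ M.coendUnit =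
      TensorProduct.mk R R M.carrier 1 :=
  M.coendLift_spec _

/-- The coendomorphism coalgebra of a quasi-finite right comodule. -/
instance : Coalgebra R M.Coend where
  coassoc := by
    apply M.coend_ext
    set E := M.Coend
    set η : M.carrier →ₗ[R] E ⊗[R] M.carrier := M.coendUnit
    set Δ : E →ₗ[R] E ⊗[R] E := CoalgebraStruct.comul (R := R) (A := E)
    refine LinearMap.ext fun m => ?_
    have h (m : M.carrier) : Δ.rTensor M.carrier (η m) =
        (TensorProduct.assoc R E E M.carrier).symm (η.lTensor E (η m)) :=
      LinearMap.congr_fun M.coend_comul m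
    simp only [LinearMap.rTensor_comp, LinearMap.comp_apply, h]
    have h1 (x : E ⊗[R] M.carrier) : (Δ.lTensor E).rTensor M.carrier
        ((TensorProduct.assoc R E E M.carrier).symm (η.lTensor E x)) =
        (TensorProduct.assoc R E (E ⊗[R] E) M.carrier).symm
          ((TensorProduct.assoc R E E M.carrier).symm.toLinearMap.lTensor E
            ((η.lTensor E).lTensor E (η.lTensor E x))) := by
      induction x with
      | zero => simp
      | add a b ha hb => simp only [map_add, ha, hb]
      | tmul a m' =>
        trans (TensorProduct.assoc R E (E ⊗[R] E) M.carrier).symm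
          (a ⊗ₜ Δ.rTensor M.carrier (η m'))
        · simp only [LinearMap.lTensor_tmul]
          generalize η m' = z
          induction z <;> simp_all [tmul_add, add_tmul]
        · rw [h]; simp
    have h2 (x : E ⊗[R] M.carrier) : (Δ.rTensor E).rTensor M.carrier
        ((TensorProduct.assoc R E E M.carrier).symm (η.lTensor E x)) =
        (TensorProduct.assoc R (E ⊗[R] E) E M.carrier).symm
          (η.lTensor (E ⊗[R] E) (Δ.rTensor M.carrier x)) := by
      induction x with
      | zero => simp
      | add a b ha hb => simp only [map_add, ha, hb]
      | tmul a m' =>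
        simp only [LinearMap.lTensor_tmul, LinearMap.rTensor_tmul]
        generalize η m' = z
        induction z <;> simp_all [tmul_add, add_tmul]
    rw [h1, h2, h]
    generalize η.lTensor E (η m) = x
    induction x with
    | zero => simp
    | add a b ha hb => simp only [map_add, ha, hb]
    | tmul a x =>
      induction x with
      | zero => simp
      | add a b ha hb => simp only [tmul_add, map_add, ha, hb]
      | tmul b m' =>
        simp only [LinearMap.lTensor_tmul, TensorProduct.assoc_symm_tmul]
        generalize η m' = z
        induction z <;> simp_all [tmul_add, add_tmul]
  rTensor_counit_comp_comul := by
    apply M.coend_ext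
    set E := M.Coend
    set η : M.carrier →ₗ[R] E ⊗[R] M.carrier := M.coendUnit
    set Δ : E →ₗ[R] E ⊗[R] E := CoalgebraStruct.comul (R := R) (A := E)
    set ε : E →ₗ[R] R := CoalgebraStruct.counit (R := R) (A := E)
    refine LinearMap.ext fun m => ?_
    have h (m : M.carrier) : Δ.rTensor M.carrier (η m) =
        (TensorProduct.assoc R E E M.carrier).symm (η.lTensor E (η m)) :=
      LinearMap.congr_fun M.coend_comul m
    have he (m : M.carrier) : ε.rTensor M.carrier (η m) = 1 ⊗ₜ m :=
      LinearMap.congr_fun M.coend_counit m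
    simp only [LinearMap.rTensor_comp, LinearMap.comp_apply, h]
    trans (TensorProduct.assoc R R E M.carrier).symm (η.lTensor R (ε.rTensor M.carrier (η m)))
    · generalize η m = x
      induction x with
      | zero => simp
      | add a b ha hb => simp only [map_add, ha, hb]
      | tmul a m' =>
        simp only [LinearMap.lTensor_tmul, LinearMap.rTensor_tmul]
        generalize η m' = z
        induction z <;> simp_all [tmul_add, add_tmul]
    · rw [he, LinearMap.lTensor_tmul]
      generalize η m = z
      induction z <;> simp_all [tmul_add, add_tmul]
  lTensor_counit_comp_comul := by
    apply M.coend_ext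
    set E := M.Coend
    set η : M.carrier →ₗ[R] E ⊗[R] M.carrier := M.coendUnit
    set Δ : E →ₗ[R] E ⊗[R] E := CoalgebraStruct.comul (R := R) (A := E)
    set ε : E →ₗ[R] R := CoalgebraStruct.counit (R := R) (A := E)
    refine LinearMap.ext fun m => ?_
    have h (m : M.carrier) : Δ.rTensor M.carrier (η m) =
        (TensorProduct.assoc R E E M.carrier).symm (η.lTensor E (η m)) :=
      LinearMap.congr_fun M.coend_comul m
    have he (m : M.carrier) : ε.rTensor M.carrier (η m) = 1 ⊗ₜ m :=
      LinearMap.congr_fun M.coend_counit m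
    simp only [LinearMap.rTensor_comp, LinearMap.comp_apply, h]
    generalize η m = x
    induction x with
    | zero => simp
    | add a b ha hb => simp only [map_add, ha, hb]
    | tmul a m' =>
      trans (TensorProduct.assoc R E R M.carrier).symm (a ⊗ₜ ε.rTensor M.carrier (η m'))
      · simp only [LinearMap.lTensor_tmul]
        generalize η m' = z
        induction z <;> simp_all [tmul_add, add_tmul]
      · rw [he]; simp

end RightComodule

namespace LeftComodule

variable {R : Type u} [CommRing R] {C : Type u} [AddCommGroup C] [Module R C] [Coalgebra R C]

/-- Colinear maps between left comodules. -/
@[ext]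
structure Hom (M N : LeftComodule R C) where
  lin : M.carrier →ₗ[R] N.carrier
  comm : N.coact ∘ₗ lin = lin.lTensor C ∘ₗ M.coact

instance : Category (LeftComodule R C) where
  Hom M N := Hom M N
  id M := ⟨LinearMap.id, by simp⟩
  comp f g := ⟨g.lin ∘ₗ f.lin, by
    rw [← LinearMap.comp_assoc, g.comm, LinearMap.comp_assoc, f.comm, LinearMap.lTensor_comp,
      LinearMap.comp_assoc]⟩

@[ext]
theorem hom_ext {M N : LeftComodule R C} {f g : M ⟶ N} (h : f.lin = g.lin) : f = g :=
  Hom.ext h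

@[simp] theorem id_lin (M : LeftComodule R C) : Hom.lin (𝟙 M) = LinearMap.id := rfl

@[simp] theorem comp_lin {M N P : LeftComodule R C} (f : M ⟶ N) (g : N ⟶ P) :
    (f ≫ g).lin = g.lin ∘ₗ f.lin := rfl

/-- The left comodule `M ⊗ W` with coaction `ϱ ⊗ id`, for an `R`-module `W`. -/
def tensor (M : LeftComodule R C) (W : Type u) [AddCommGroup W] [Module R W] :
    LeftComodule R C where
  carrier := M.carrier ⊗[R] W
  coact := (TensorProduct.assoc R C M.carrier W).toLinearMap ∘ₗ M.coact.rTensor W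
  coassoc := by
    refine ext' fun m w => ?_
    have h := LinearMap.congr_fun M.coassoc m
    simp only [LinearMap.comp_apply, LinearEquiv.coe_coe, LinearMap.rTensor_tmul] at h ⊢
    trans (TensorProduct.assoc R C C (M.carrier ⊗[R] W))
      (TensorProduct.assoc R (C ⊗[R] C) M.carrier W
        ((Coalgebra.comul (R := R) (A := C)).rTensor M.carrier (M.coact m) ⊗ₜ w))
    · congr 1
      generalize M.coact m = y
      induction y <;> simp_all [tmul_add, add_tmul]
    · rw [← (TensorProduct.assoc R C C M.carrier).eq_symm_apply] at h
      rw [h]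
      generalize M.coact m = y
      induction y with
      | zero => simp
      | add a b ha hb => simp only [add_tmul, map_add, ha, hb]
      | tmul c m' =>
        simp only [TensorProduct.assoc_tmul, LinearMap.lTensor_tmul, LinearMap.comp_apply,
          LinearMap.rTensor_tmul, LinearEquiv.coe_coe]
        generalize M.coact m' = z
        induction z <;> simp_all [tmul_add, add_tmul]
  counit := by
    refine ext' fun m w => ?_
    have h := LinearMap.congr_fun M.counit m
    simp only [LinearMap.comp_apply, LinearEquiv.coe_coe, LinearMap.rTensor_tmul] at h ⊢
    trans (TensorProduct.assoc R R M.carrier W)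
      ((Coalgebra.counit (R := R) (A := C)).rTensor M.carrier (M.coact m) ⊗ₜ w)
    · generalize M.coact m = y
      induction y <;> simp_all [tmul_add, add_tmul]
    · rw [h]; simp

/-- The colinear map `id ⊗ f : M ⊗ V → M ⊗ W` of a linear map `f : V → W`. -/
def tensorMap (M : LeftComodule R C) {V W : Type u} [AddCommGroup V] [Module R V]
    [AddCommGroup W] [Module R W] (f : V →ₗ[R] W) : tensor M V ⟶ tensor M W where
  lin := f.lTensor M.carrier
  comm := by
    refine ext' fun m w => ?_
    change TensorProduct.assoc R C M.carrier W (M.coact m ⊗ₜ f w) =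
      (f.lTensor M.carrier).lTensor C
        (TensorProduct.assoc R C M.carrier V (M.coact m ⊗ₜ w))
    generalize M.coact m = y
    induction y <;> simp_all [tmul_add, add_tmul]

/-- The functor `M ⊗ -` from `R`-modules to left `C`-comodules. -/
def tensorFunctor (M : LeftComodule R C) : ModuleCat.{u} R ⥤ LeftComodule R C where
  obj W := tensor M W
  map f := tensorMap M f.hom
  map_id W := hom_ext (LinearMap.lTensor_id M.carrier W)
  map_comp f g := hom_ext (LinearMap.lTensor_comp M.carrier g.hom f.hom)

/-- The colinear map `f ⊗ id : M ⊗ W → N ⊗ W` of a colinear map `f : M → N`. -/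
def tensorMapLeft {M N : LeftComodule R C} (f : M ⟶ N) (W : Type u) [AddCommGroup W]
    [Module R W] : tensor M W ⟶ tensor N W where
  lin := f.lin.rTensor W
  comm := by
    refine ext' fun m w => ?_
    have h : N.coact (f.lin m) = f.lin.lTensor C (M.coact m) := LinearMap.congr_fun f.comm m
    change TensorProduct.assoc R C N.carrier W (N.coact (f.lin m) ⊗ₜ w) =
      (f.lin.rTensor W).lTensor C (TensorProduct.assoc R C M.carrier W (M.coact m ⊗ₜ w))
    rw [h]
    generalize M.coact m = y
    induction y <;> simp_all [tmul_add, add_tmul]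

/-- The canonical map `(M ⊗ V) ⊗ W → M ⊗ (V ⊗ W)` is colinear. -/
def tensorAssoc (M : LeftComodule R C) (V W : Type u) [AddCommGroup V] [Module R V]
    [AddCommGroup W] [Module R W] : tensor (tensor M V) W ⟶ tensor M (V ⊗[R] W) where
  lin := (TensorProduct.assoc R M.carrier V W).toLinearMap
  comm := by
    have key : ((TensorProduct.assoc R C M.carrier (V ⊗[R] W)).toLinearMap ∘ₗ
        M.coact.rTensor (V ⊗[R] W)) ∘ₗ (TensorProduct.assoc R M.carrier V W).toLinearMap =
        (TensorProduct.assoc R M.carrier V W).toLinearMap.lTensor C ∘ₗ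
          (TensorProduct.assoc R C (M.carrier ⊗[R] V) W).toLinearMap ∘ₗ
            ((TensorProduct.assoc R C M.carrier V).toLinearMap ∘ₗ
              M.coact.rTensor V).rTensor W := by
      refine ext' fun x w => ?_
      induction x with
      | zero => simp
      | add a b ha hb => rw [add_tmul, map_add, map_add, ha, hb]
      | tmul m v =>
        simp only [LinearMap.comp_apply, LinearEquiv.coe_coe, LinearMap.rTensor_tmul,
          TensorProduct.assoc_tmul]
        generalize M.coact m = y
        induction y <;> simp_all [tmul_add, add_tmul]
    exact key

/-- The canonical map `M → M ⊗ R` is colinear. -/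
def tensorUnit (M : LeftComodule R C) : M ⟶ tensor M R where
  lin := (TensorProduct.mk R M.carrier R).flip 1
  comm := by
    refine LinearMap.ext fun m => ?_
    change TensorProduct.assoc R C M.carrier R (M.coact m ⊗ₜ 1) =
      ((TensorProduct.mk R M.carrier R).flip 1).lTensor C (M.coact m)
    generalize M.coact m = y
    induction y <;> simp_all [tmul_add, add_tmul]

/-! ### Quasi-finite left comodules, the cohom functor and the coendomorphism coalgebra -/

/-- `M` is quasi-finite if `M ⊗ - : R-Mod ⥤ ^CM` has a left adjoint. -/
abbrev QuasiFinite (M : LeftComodule R C) : Prop := M.tensorFunctor.IsRightAdjoint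

variable (M : LeftComodule R C) [M.QuasiFinite]

/-- The cohom functor `h_C(M, -) : ^CM ⥤ R-Mod`. -/
def cohom : LeftComodule R C ⥤ ModuleCat.{u} R :=
  M.tensorFunctor.leftAdjoint

/-- The adjunction defining the cohom functor. -/
def cohomAdj : M.cohom ⊣ M.tensorFunctor :=
  Adjunction.ofIsRightAdjoint M.tensorFunctor

/-- The module `e_C(M) = h_C(M, M)` underlying the coendomorphism coalgebra. -/
def Coend : Type u := M.cohom.obj M

instance : AddCommGroup M.Coend :=
  inferInstanceAs (AddCommGroup (M.cohom.obj M))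

instance : Module R M.Coend :=
  inferInstanceAs (Module R (M.cohom.obj M))

/-- The unit of adjunction `η_M : M → M ⊗ e_C(M)`, as a morphism of comodules. -/
def coendUnitHom : M ⟶ tensor M M.Coend :=
  M.cohomAdj.unit.app M

/-- The unit of adjunction `η_M : M → M ⊗ e_C(M)`, as a linear map. -/
def coendUnit :
    M.carrier →ₗ[R] M.carrier ⊗[R] M.Coend :=
  M.coendUnitHom.lin

/-- The linear map `e_C(M) → W` corresponding to a colinear map `M → M ⊗ W`. -/
def coendLift {W : Type u} [AddCommGroup W] [Module R W]
    (f : M ⟶ tensor M W) : M.Coend →ₗ[R] W :=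
  ((M.cohomAdj.homEquiv M (ModuleCat.of R W)).symm f).hom

theorem coendLift_spec {W : Type u} [AddCommGroup W]
    [Module R W] (f : M ⟶ tensor M W) :
    (M.coendLift f).lTensor M.carrier ∘ₗ M.coendUnit = f.lin := by
  have h := (M.cohomAdj.homEquiv M (ModuleCat.of R W)).apply_symm_apply f
  rw [Adjunction.homEquiv_unit] at h
  exact congrArg Hom.lin h

theorem coend_ext {W : Type u} [AddCommGroup W]
    [Module R W] {g g' : M.Coend →ₗ[R] W}
    (h : g.lTensor M.carrier ∘ₗ M.coendUnit = g'.lTensor M.carrier ∘ₗ M.coendUnit) : g = g' := by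
  have h' : (ModuleCat.ofHom g : M.cohom.obj M ⟶ ModuleCat.of R W) = ModuleCat.ofHom g' := by
    apply (M.cohomAdj.homEquiv M (ModuleCat.of R W)).injective
    refine Eq.trans (Adjunction.homEquiv_unit ..) (Eq.trans ?_ (Adjunction.homEquiv_unit ..).symm)
    exact hom_ext h
  exact congrArg ModuleCat.Hom.hom h'

/-- The comultiplication corresponds to `(η ⊗ id) ∘ η : M → M ⊗ e ⊗ e`, the counit to the canonical
map `M → M ⊗ R`. -/
instance : CoalgebraStruct R M.Coend where
  comul := M.coendLift
    (M.coendUnitHom ≫ tensorMapLeft M.coendUnitHom M.Coend ≫ tensorAssoc M M.Coend M.Coend)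
  counit := M.coendLift (tensorUnit M)

theorem coend_comul :
    (CoalgebraStruct.comul (R := R) (A := M.Coend)).lTensor M.carrier ∘ₗ M.coendUnit =
      (TensorProduct.assoc R M.carrier M.Coend M.Coend).toLinearMap ∘ₗ
        M.coendUnit.rTensor M.Coend ∘ₗ M.coendUnit :=
  M.coendLift_spec _

theorem coend_counit :
    (CoalgebraStruct.counit (R := R) (A := M.Coend)).lTensor M.carrier ∘ₗ M.coendUnit =
      (TensorProduct.mk R M.carrier R).flip 1 :=
  M.coendLift_spec _

/-- The coendomorphism coalgebra of a quasi-finite left comodule. -/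
instance : Coalgebra R M.Coend where
  coassoc := by
    apply M.coend_ext
    set E := M.Coend
    set η : M.carrier →ₗ[R] M.carrier ⊗[R] E := M.coendUnit
    set Δ : E →ₗ[R] E ⊗[R] E := CoalgebraStruct.comul (R := R) (A := E)
    refine LinearMap.ext fun m => ?_
    have h (m : M.carrier) : Δ.lTensor M.carrier (η m) =
        TensorProduct.assoc R M.carrier E E (η.rTensor E (η m)) :=
      LinearMap.congr_fun M.coend_comul m
    simp only [LinearMap.lTensor_comp, LinearMap.comp_apply, h]
    have h1 (x : M.carrier ⊗[R] E) : (Δ.rTensor E).lTensor M.carrier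
        (TensorProduct.assoc R M.carrier E E (η.rTensor E x)) =
        TensorProduct.assoc R M.carrier (E ⊗[R] E) E
          ((TensorProduct.assoc R M.carrier E E).toLinearMap.rTensor E
            ((η.rTensor E).rTensor E (η.rTensor E x))) := by
      induction x with
      | zero => simp
      | add a b ha hb => simp only [map_add, ha, hb]
      | tmul m' a =>
        trans TensorProduct.assoc R M.carrier (E ⊗[R] E) E (Δ.lTensor M.carrier (η m') ⊗ₜ a)
        · simp only [LinearMap.rTensor_tmul]
          generalize η m' = z
          induction z <;> simp_all [tmul_add, add_tmul]
        · rw [h]; simp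
    have h2 (x : M.carrier ⊗[R] E) : (Δ.lTensor E).lTensor M.carrier
        (TensorProduct.assoc R M.carrier E E (η.rTensor E x)) =
        TensorProduct.assoc R M.carrier E (E ⊗[R] E)
          (η.rTensor (E ⊗[R] E) (Δ.lTensor M.carrier x)) := by
      induction x with
      | zero => simp
      | add a b ha hb => simp only [map_add, ha, hb]
      | tmul m' a =>
        simp only [LinearMap.lTensor_tmul, LinearMap.rTensor_tmul]
        generalize η m' = z
        induction z <;> simp_all [tmul_add, add_tmul]
    rw [h1, h2, h]
    generalize η.rTensor E (η m) = x
    induction x with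
    | zero => simp
    | add a b ha hb => simp only [map_add, ha, hb]
    | tmul x a =>
      induction x with
      | zero => simp
      | add a b ha hb => simp only [add_tmul, map_add, ha, hb]
      | tmul m' b =>
        simp only [LinearMap.rTensor_tmul, TensorProduct.assoc_tmul]
        generalize η m' = z
        induction z <;> simp_all [tmul_add, add_tmul]
  rTensor_counit_comp_comul := by
    apply M.coend_ext
    set E := M.Coend
    set η : M.carrier →ₗ[R] M.carrier ⊗[R] E := M.coendUnit
    set Δ : E →ₗ[R] E ⊗[R] E := CoalgebraStruct.comul (R := R) (A := E)
    set ε : E →ₗ[R] R := CoalgebraStruct.counit (R := R) (A := E)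
    refine LinearMap.ext fun m => ?_
    have h (m : M.carrier) : Δ.lTensor M.carrier (η m) =
        TensorProduct.assoc R M.carrier E E (η.rTensor E (η m)) :=
      LinearMap.congr_fun M.coend_comul m
    have he (m : M.carrier) : ε.lTensor M.carrier (η m) = m ⊗ₜ 1 :=
      LinearMap.congr_fun M.coend_counit m
    simp only [LinearMap.lTensor_comp, LinearMap.comp_apply, h]
    generalize η m = x
    induction x with
    | zero => simp
    | add a b ha hb => simp only [map_add, ha, hb]
    | tmul m' a =>
      trans TensorProduct.assoc R M.carrier R E (ε.lTensor M.carrier (η m') ⊗ₜ a)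
      · simp only [LinearMap.rTensor_tmul]
        generalize η m' = z
        induction z <;> simp_all [tmul_add, add_tmul]
      · rw [he]; simp
  lTensor_counit_comp_comul := by
    apply M.coend_ext
    set E := M.Coend
    set η : M.carrier →ₗ[R] M.carrier ⊗[R] E := M.coendUnit
    set Δ : E →ₗ[R] E ⊗[R] E := CoalgebraStruct.comul (R := R) (A := E)
    set ε : E →ₗ[R] R := CoalgebraStruct.counit (R := R) (A := E)
    refine LinearMap.ext fun m => ?_
    have h (m : M.carrier) : Δ.lTensor M.carrier (η m) =
        TensorProduct.assoc R M.carrier E E (η.rTensor E (η m)) :=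
      LinearMap.congr_fun M.coend_comul m
    have he (m : M.carrier) : ε.lTensor M.carrier (η m) = m ⊗ₜ 1 :=
      LinearMap.congr_fun M.coend_counit m
    simp only [LinearMap.lTensor_comp, LinearMap.comp_apply, h]
    trans TensorProduct.assoc R M.carrier E R (η.rTensor R (ε.lTensor M.carrier (η m)))
    · generalize η m = x
      induction x with
      | zero => simp
      | add a b ha hb => simp only [map_add, ha, hb]
      | tmul m' a =>
        simp only [LinearMap.lTensor_tmul, LinearMap.rTensor_tmul]
        generalize η m' = z
        induction z <;> simp_all [tmul_add, add_tmul]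
    · rw [he, LinearMap.rTensor_tmul]
      generalize η m = z
      induction z <;> simp_all [tmul_add, add_tmul]

end LeftComodule

/-! ### The cotensor product -/

section Cotensor

variable {R : Type u} [CommRing R] {C : Type u} [AddCommGroup C] [Module R C] [Coalgebra R C]

/-- The map `ϱ_M ⊗ id - id ⊗ ϱ_N : M ⊗ N → M ⊗ C ⊗ N`. -/
def cotensorDiff (M : RightComodule R C) (N : LeftComodule R C) :
    M.carrier ⊗[R] N.carrier →ₗ[R] M.carrier ⊗[R] (C ⊗[R] N.carrier) :=
  (TensorProduct.assoc R M.carrier C N.carrier).toLinearMap ∘ₗ M.coact.rTensor N.carrier -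
    N.coact.lTensor M.carrier

/-- The cotensor product `M □_C N` as a submodule of `M ⊗ N`. -/
def cotensor (M : RightComodule R C) (N : LeftComodule R C) :
    Submodule R (M.carrier ⊗[R] N.carrier) :=
  LinearMap.ker (cotensorDiff M N)

theorem cotensorDiff_lTensor (M : RightComodule R C) {N N' : LeftComodule R C} (f : N ⟶ N') :
    cotensorDiff M N' ∘ₗ f.lin.lTensor M.carrier =
      (f.lin.lTensor C).lTensor M.carrier ∘ₗ cotensorDiff M N := by
  refine ext' fun m n => ?_
  have h := LinearMap.congr_fun f.comm n
  simp only [cotensorDiff, LinearMap.comp_apply, LinearMap.sub_apply, LinearEquiv.coe_coe,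
    LinearMap.lTensor_tmul, LinearMap.rTensor_tmul, map_sub] at h ⊢
  rw [h]
  congr 1
  generalize M.coact m = y
  induction y <;> simp_all [tmul_add, add_tmul]

theorem cotensorDiff_rTensor {M M' : RightComodule R C} (f : M ⟶ M') (N : LeftComodule R C) :
    cotensorDiff M' N ∘ₗ f.lin.rTensor N.carrier =
      f.lin.rTensor (C ⊗[R] N.carrier) ∘ₗ cotensorDiff M N := by
  refine ext' fun m n => ?_
  have h := LinearMap.congr_fun f.comm m
  simp only [cotensorDiff, LinearMap.comp_apply, LinearMap.sub_apply, LinearEquiv.coe_coe,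
    LinearMap.lTensor_tmul, LinearMap.rTensor_tmul, map_sub] at h ⊢
  rw [h]
  congr 1
  generalize M.coact m = y
  induction y <;> simp_all [tmul_add, add_tmul]

/-- `id □ f : M □ N → M □ N'`, the restriction of `id ⊗ f`. -/
def cotensorMapRight (M : RightComodule R C) {N N' : LeftComodule R C} (f : N ⟶ N') :
    cotensor M N →ₗ[R] cotensor M N' :=
  (f.lin.lTensor M.carrier).restrict fun x hx => by
    have h := LinearMap.congr_fun (cotensorDiff_lTensor M f) x
    simp only [cotensor, LinearMap.mem_ker, LinearMap.comp_apply] at hx h ⊢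
    rw [h, hx, map_zero]

/-- `f □ id : M □ N → M' □ N`, the restriction of `f ⊗ id`. -/
def cotensorMapLeft {M M' : RightComodule R C} (f : M ⟶ M') (N : LeftComodule R C) :
    cotensor M N →ₗ[R] cotensor M' N :=
  (f.lin.rTensor N.carrier).restrict fun x hx => by
    have h := LinearMap.congr_fun (cotensorDiff_rTensor f N) x
    simp only [cotensor, LinearMap.mem_ker, LinearMap.comp_apply] at hx h ⊢
    rw [h, hx, map_zero]

theorem cotensorMapRight_id (M : RightComodule R C) (N : LeftComodule R C) :
    cotensorMapRight M (𝟙 N) = LinearMap.id :=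
  LinearMap.ext fun x =>
    Subtype.ext (LinearMap.congr_fun (LinearMap.lTensor_id M.carrier N.carrier) x.1)

theorem cotensorMapRight_comp (M : RightComodule R C) {N N' N'' : LeftComodule R C}
    (f : N ⟶ N') (g : N' ⟶ N'') :
    cotensorMapRight M (f ≫ g) = cotensorMapRight M g ∘ₗ cotensorMapRight M f :=
  LinearMap.ext fun x =>
    Subtype.ext (LinearMap.congr_fun (LinearMap.lTensor_comp M.carrier g.lin f.lin) x.1)

theorem cotensorMapLeft_id (M : RightComodule R C) (N : LeftComodule R C) :
    cotensorMapLeft (𝟙 M) N = LinearMap.id :=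
  LinearMap.ext fun x =>
    Subtype.ext (LinearMap.congr_fun (LinearMap.rTensor_id N.carrier M.carrier) x.1)

theorem cotensorMapLeft_comp {M M' M'' : RightComodule R C} (f : M ⟶ M') (g : M' ⟶ M'')
    (N : LeftComodule R C) :
    cotensorMapLeft (f ≫ g) N = cotensorMapLeft g N ∘ₗ cotensorMapLeft f N :=
  LinearMap.ext fun x =>
    Subtype.ext (LinearMap.congr_fun (LinearMap.rTensor_comp N.carrier g.lin f.lin) x.1)

/-- The functor `M □_C -` from left `C`-comodules to `R`-modules. -/
def RightComodule.cotensorFunctor (M : RightComodule R C) :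
    LeftComodule R C ⥤ ModuleCat.{u} R where
  obj N := ModuleCat.of R (cotensor M N)
  map f := ModuleCat.ofHom (cotensorMapRight M f)
  map_id N := by rw [cotensorMapRight_id]; rfl
  map_comp f g := by rw [cotensorMapRight_comp]; rfl

/-- The functor `- □_C N` from right `C`-comodules to `R`-modules. -/
def LeftComodule.cotensorFunctor (N : LeftComodule R C) :
    RightComodule R C ⥤ ModuleCat.{u} R where
  obj M := ModuleCat.of R (cotensor M N)
  map f := ModuleCat.ofHom (cotensorMapLeft f N)
  map_id M := by rw [cotensorMapLeft_id]; rfl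
  map_comp f g := by rw [cotensorMapLeft_comp]; rfl

end Cotensor

/-! ### Subcomodules -/

section Sub

variable {R : Type u} [CommRing R] {C : Type u} [AddCommGroup C] [Module R C] [Coalgebra R C]
  [Module.Flat R C]

/-- A submodule `S` of a right comodule `M` over a flat coalgebra with `ϱ(S) ⊆ S ⊗ C` (regarded as
a submodule of `M ⊗ C`) is a comodule, with the restricted coaction. -/
def RightComodule.sub (M : RightComodule R C) (S : Submodule R M.carrier)
    (hS : ∀ x ∈ S, M.coact x ∈ LinearMap.range (S.subtype.rTensor C)) : RightComodule R C :=
  have hinj : Function.Injective (S.subtype.rTensor C) :=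
    Module.Flat.rTensor_preserves_injective_linearMap _ S.injective_subtype
  have key (x : S) : S.subtype.rTensor C ((LinearEquiv.ofInjective _ hinj).symm
      (LinearMap.restrict M.coact hS x)) = M.coact x.1 :=
    congrArg Subtype.val ((LinearEquiv.ofInjective _ hinj).apply_symm_apply
      (LinearMap.restrict M.coact hS x))
  { carrier := S
    coact := (LinearEquiv.ofInjective _ hinj).symm.toLinearMap ∘ₗ LinearMap.restrict M.coact hS
    coassoc := by
      set r : S →ₗ[R] S ⊗[R] C :=
        (LinearEquiv.ofInjective _ hinj).symm.toLinearMap ∘ₗ LinearMap.restrict M.coact hS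
        with hr
      have key' : S.subtype.rTensor C ∘ₗ r = M.coact ∘ₗ S.subtype := LinearMap.ext key
      have hinj2 : Function.Injective (S.subtype.rTensor (C ⊗[R] C)) :=
        Module.Flat.rTensor_preserves_injective_linearMap _ S.injective_subtype
      refine LinearMap.ext fun x => hinj2 ?_
      have h := LinearMap.congr_fun M.coassoc x.1
      have hx : M.coact x.1 = S.subtype.rTensor C (r x) := (key x).symm
      simp only [LinearMap.comp_apply, LinearEquiv.coe_coe] at h ⊢
      rw [hx] at h
      generalize r x = y at h
      trans (TensorProduct.assoc R M.carrier C C) (M.coact.rTensor C (S.subtype.rTensor C y))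
      · rw [← LinearMap.comp_apply (M.coact.rTensor C), ← LinearMap.rTensor_comp, ← key']
        clear h
        induction y with
        | zero => simp
        | add a b ha hb => simp only [map_add, ha, hb]
        | tmul s c =>
          simp only [LinearMap.rTensor_tmul, LinearMap.comp_apply]
          generalize r s = z
          induction z <;> simp_all [tmul_add, add_tmul]
      · rw [h]
        clear h
        induction y <;> simp_all [tmul_add, add_tmul]
    counit := by
      set r : S →ₗ[R] S ⊗[R] C :=
        (LinearEquiv.ofInjective _ hinj).symm.toLinearMap ∘ₗ LinearMap.restrict M.coact hS
        with hr
      refine LinearMap.ext fun x => (TensorProduct.rid R S).injective (Subtype.ext ?_)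
      have h := congrArg (TensorProduct.rid R M.carrier) (LinearMap.congr_fun M.counit x.1)
      have hx : M.coact x.1 = S.subtype.rTensor C (r x) := (key x).symm
      simp only [LinearMap.comp_apply, LinearMap.flip_apply, TensorProduct.mk_apply,
        TensorProduct.rid_tmul, one_smul] at h ⊢
      rw [hx] at h
      refine Eq.trans ?_ h
      generalize r x = y
      clear h
      induction y with
      | zero => simp
      | add a b ha hb => simp only [map_add, Submodule.coe_add, ha, hb]
      | tmul s c => simp }

theorem RightComodule.sub_coact (M : RightComodule R C) (S : Submodule R M.carrier)
    (hS : ∀ x ∈ S, M.coact x ∈ LinearMap.range (S.subtype.rTensor C)) :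
    S.subtype.rTensor C ∘ₗ (M.sub S hS).coact = M.coact ∘ₗ S.subtype :=
  LinearMap.ext fun x => congrArg Subtype.val
    ((LinearEquiv.ofInjective (S.subtype.rTensor C)
      (Module.Flat.rTensor_preserves_injective_linearMap _ S.injective_subtype)).apply_symm_apply
      (LinearMap.restrict M.coact hS x))

/-- A submodule `S` of a left comodule `M` over a flat coalgebra with `ϱ(S) ⊆ C ⊗ S` (regarded as
a submodule of `C ⊗ M`) is a comodule, with the restricted coaction. -/
def LeftComodule.sub (M : LeftComodule R C) (S : Submodule R M.carrier)
    (hS : ∀ x ∈ S, M.coact x ∈ LinearMap.range (S.subtype.lTensor C)) : LeftComodule R C :=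
  have hinj : Function.Injective (S.subtype.lTensor C) :=
    Module.Flat.lTensor_preserves_injective_linearMap _ S.injective_subtype
  have key (x : S) : S.subtype.lTensor C ((LinearEquiv.ofInjective _ hinj).symm
      (LinearMap.restrict M.coact hS x)) = M.coact x.1 :=
    congrArg Subtype.val ((LinearEquiv.ofInjective _ hinj).apply_symm_apply
      (LinearMap.restrict M.coact hS x))
  { carrier := S
    coact := (LinearEquiv.ofInjective _ hinj).symm.toLinearMap ∘ₗ LinearMap.restrict M.coact hS
    coassoc := by
      set r : S →ₗ[R] C ⊗[R] S :=
        (LinearEquiv.ofInjective _ hinj).symm.toLinearMap ∘ₗ LinearMap.restrict M.coact hS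
        with hr
      have key' : S.subtype.lTensor C ∘ₗ r = M.coact ∘ₗ S.subtype := LinearMap.ext key
      have hinj2 : Function.Injective ((S.subtype.lTensor C).lTensor C) :=
        Module.Flat.lTensor_preserves_injective_linearMap _ hinj
      refine LinearMap.ext fun x => hinj2 ?_
      have h := LinearMap.congr_fun M.coassoc x.1
      have hx : M.coact x.1 = S.subtype.lTensor C (r x) := (key x).symm
      simp only [LinearMap.comp_apply, LinearEquiv.coe_coe] at h ⊢
      rw [hx] at h
      generalize r x = y at h
      trans M.coact.lTensor C (S.subtype.lTensor C y)
      · rw [← h]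
        clear h
        induction y with
        | zero => simp
        | add a b ha hb => simp only [map_add, ha, hb]
        | tmul c s =>
          simp only [LinearMap.rTensor_tmul, LinearMap.lTensor_tmul]
          generalize Coalgebra.comul (R := R) c = z
          induction z <;> simp_all [tmul_add, add_tmul]
      · rw [← LinearMap.comp_apply (M.coact.lTensor C), ← LinearMap.lTensor_comp, ← key',
          LinearMap.lTensor_comp, LinearMap.comp_apply]
    counit := by
      set r : S →ₗ[R] C ⊗[R] S :=
        (LinearEquiv.ofInjective _ hinj).symm.toLinearMap ∘ₗ LinearMap.restrict M.coact hS
        with hr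
      refine LinearMap.ext fun x => (TensorProduct.lid R S).injective (Subtype.ext ?_)
      have h := congrArg (TensorProduct.lid R M.carrier) (LinearMap.congr_fun M.counit x.1)
      have hx : M.coact x.1 = S.subtype.lTensor C (r x) := (key x).symm
      simp only [LinearMap.comp_apply, TensorProduct.mk_apply,
        TensorProduct.lid_tmul, one_smul] at h ⊢
      rw [hx] at h
      refine Eq.trans ?_ h
      generalize r x = y
      clear h
      induction y with
      | zero => simp
      | add a b ha hb => simp only [map_add, Submodule.coe_add, ha, hb]
      | tmul s c => simp }

theorem LeftComodule.sub_coact (M : LeftComodule R C) (S : Submodule R M.carrier)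
    (hS : ∀ x ∈ S, M.coact x ∈ LinearMap.range (S.subtype.lTensor C)) :
    S.subtype.lTensor C ∘ₗ (M.sub S hS).coact = M.coact ∘ₗ S.subtype :=
  LinearMap.ext fun x => congrArg Subtype.val
    ((LinearEquiv.ofInjective (S.subtype.lTensor C)
      (Module.Flat.lTensor_preserves_injective_linearMap _ S.injective_subtype)).apply_symm_apply
      (LinearMap.restrict M.coact hS x))

end Sub

theorem rTensor_square {R : Type u} [CommRing R] {D : Type u} [AddCommGroup D] [Module R D]
    {A B B' E : Type u} [AddCommGroup A] [Module R A] [AddCommGroup B]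
    [Module R B] [AddCommGroup B'] [Module R B'] [AddCommGroup E] [Module R E]
    (i : A →ₗ[R] B) (f : B →ₗ[R] E) (g : A →ₗ[R] B') (j : B' →ₗ[R] E) (h : f ∘ₗ i = j ∘ₗ g)
    (z : A ⊗[R] D) : f.rTensor D (i.rTensor D z) = j.rTensor D (g.rTensor D z) := by
  rw [← LinearMap.comp_apply, ← LinearMap.rTensor_comp, h, LinearMap.rTensor_comp,
    LinearMap.comp_apply]

theorem lTensor_square {R : Type u} [CommRing R] {C : Type u} [AddCommGroup C] [Module R C]
    {A B B' E : Type u} [AddCommGroup A] [Module R A] [AddCommGroup B]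
    [Module R B] [AddCommGroup B'] [Module R B'] [AddCommGroup E] [Module R E]
    (i : A →ₗ[R] B) (f : B →ₗ[R] E) (g : A →ₗ[R] B') (j : B' →ₗ[R] E) (h : f ∘ₗ i = j ∘ₗ g)
    (z : C ⊗[R] A) : f.lTensor C (i.lTensor C z) = j.lTensor C (g.lTensor C z) := by
  rw [← LinearMap.comp_apply, ← LinearMap.lTensor_comp, h, LinearMap.lTensor_comp,
    LinearMap.comp_apply]

/-! ### The cotensor functors of a bicomodule -/

namespace Bicomodule

variable {R : Type u} [CommRing R] {C : Type u} [AddCommGroup C] [Module R C] [Coalgebra R C]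
  {D : Type u} [AddCommGroup D] [Module R D] [Coalgebra R D]

/-- The underlying left `C`-comodule of a `C`-`D`-bicomodule. -/
def toLeft (X : Bicomodule R C D) : LeftComodule R C where
  carrier := X.carrier
  coact := X.lcoact
  coassoc := X.lcoassoc
  counit := X.lcounit

/-- The underlying right `D`-comodule of a `C`-`D`-bicomodule. -/
def toRight (X : Bicomodule R C D) : RightComodule R D where
  carrier := X.carrier
  coact := X.rcoact
  coassoc := X.rcoassoc
  counit := X.rcounit

theorem coact_mem_right [Module.Flat R D] (X : Bicomodule R C D) (N : RightComodule R C) :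
    ∀ x ∈ cotensor N X.toLeft, (RightComodule.tensor N.carrier X.toRight).coact x ∈
      LinearMap.range ((cotensor N X.toLeft).subtype.rTensor D) := by
  intro x hx
  have hex : Function.Exact (cotensor N X.toLeft).subtype (cotensorDiff N X.toLeft) :=
    LinearMap.exact_subtype_ker_map _
  refine (Module.Flat.rTensor_exact D hex _).1 ?_
  let r : N.carrier ⊗[R] X.carrier →ₗ[R] (N.carrier ⊗[R] X.carrier) ⊗[R] D :=
    (TensorProduct.assoc R N.carrier X.carrier D).symm.toLinearMap ∘ₗ X.rcoact.lTensor N.carrier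
  let d : N.carrier ⊗[R] X.carrier →ₗ[R] N.carrier ⊗[R] (C ⊗[R] X.carrier) :=
    (TensorProduct.assoc R N.carrier C X.carrier).toLinearMap ∘ₗ N.coact.rTensor X.carrier -
    X.lcoact.lTensor N.carrier
  let s : N.carrier ⊗[R] (C ⊗[R] X.carrier) →ₗ[R] (N.carrier ⊗[R] (C ⊗[R] X.carrier)) ⊗[R] D :=
    (TensorProduct.assoc R N.carrier (C ⊗[R] X.carrier) D).symm.toLinearMap ∘ₗ
      ((TensorProduct.assoc R C X.carrier D).symm.toLinearMap ∘ₗ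
        X.rcoact.lTensor C).lTensor N.carrier
  suffices h : d.rTensor D ∘ₗ r = s ∘ₗ d by
    have h' : d.rTensor D (r x) = s (d x) := LinearMap.congr_fun h x
    have hx' : d x = 0 := hx
    rw [hx', map_zero] at h'
    exact h'
  refine ext' fun n y => ?_
  have hc := LinearMap.congr_fun X.compat y
  simp only [d, r, s, LinearMap.rTensor_sub, LinearMap.comp_apply, LinearMap.sub_apply,
    LinearEquiv.coe_coe, LinearMap.lTensor_tmul, LinearMap.rTensor_tmul, map_sub] at hc ⊢
  rw [← hc, LinearEquiv.symm_apply_apply]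
  congr 1
  · have key (p : N.carrier ⊗[R] C) :
        (TensorProduct.assoc R N.carrier (C ⊗[R] X.carrier) D).symm
          (((TensorProduct.assoc R C X.carrier D).symm.toLinearMap ∘ₗ
            X.rcoact.lTensor C).lTensor N.carrier
              (TensorProduct.assoc R N.carrier C X.carrier (p ⊗ₜ y))) =
        (TensorProduct.assoc R N.carrier C X.carrier).toLinearMap.rTensor D
          ((TensorProduct.assoc R (N.carrier ⊗[R] C) X.carrier D).symm (p ⊗ₜ X.rcoact y)) := by
      induction p with
      | zero => simp
      | add a b ha hb => simp only [add_tmul, map_add, ha, hb]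
      | tmul a c =>
        simp only [TensorProduct.assoc_tmul, LinearMap.lTensor_tmul, LinearMap.comp_apply,
          LinearEquiv.coe_coe]
        generalize X.rcoact y = q
        induction q <;> simp_all [tmul_add, add_tmul]
    rw [key]
    generalize X.rcoact y = q
    induction q <;> simp_all [tmul_add, add_tmul]
  · generalize X.rcoact y = q
    induction q <;> simp_all [tmul_add, add_tmul]

theorem coact_mem_left [Module.Flat R C] (X : Bicomodule R C D) (N : LeftComodule R D) :
    ∀ x ∈ cotensor X.toRight N, (LeftComodule.tensor X.toLeft N.carrier).coact x ∈
      LinearMap.range ((cotensor X.toRight N).subtype.lTensor C) := by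
  intro x hx
  have hex : Function.Exact (cotensor X.toRight N).subtype (cotensorDiff X.toRight N) :=
    LinearMap.exact_subtype_ker_map _
  refine (Module.Flat.lTensor_exact C hex _).1 ?_
  let r : X.carrier ⊗[R] N.carrier →ₗ[R] C ⊗[R] (X.carrier ⊗[R] N.carrier) :=
    (TensorProduct.assoc R C X.carrier N.carrier).toLinearMap ∘ₗ X.lcoact.rTensor N.carrier
  let d : X.carrier ⊗[R] N.carrier →ₗ[R] X.carrier ⊗[R] (D ⊗[R] N.carrier) :=
    (TensorProduct.assoc R X.carrier D N.carrier).toLinearMap ∘ₗ X.rcoact.rTensor N.carrier -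
    N.coact.lTensor X.carrier
  let s : X.carrier ⊗[R] (D ⊗[R] N.carrier) →ₗ[R] C ⊗[R] (X.carrier ⊗[R] (D ⊗[R] N.carrier)) :=
    (TensorProduct.assoc R C X.carrier (D ⊗[R] N.carrier)).toLinearMap ∘ₗ
      X.lcoact.rTensor (D ⊗[R] N.carrier)
  suffices h : d.lTensor C ∘ₗ r = s ∘ₗ d by
    have h' : d.lTensor C (r x) = s (d x) := LinearMap.congr_fun h x
    have hx' : d x = 0 := hx
    rw [hx', map_zero] at h'
    exact h'
  refine ext' fun y n => ?_
  have hc := LinearMap.congr_fun X.compat y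
  simp only [d, r, s, LinearMap.lTensor_sub, LinearMap.comp_apply, LinearMap.sub_apply,
    LinearEquiv.coe_coe, LinearMap.lTensor_tmul, LinearMap.rTensor_tmul, map_sub] at hc ⊢
  congr 1
  · trans (TensorProduct.assoc R X.carrier D N.carrier).toLinearMap.lTensor C
      (TensorProduct.assoc R C (X.carrier ⊗[R] D) N.carrier
        (X.rcoact.lTensor C (X.lcoact y) ⊗ₜ n))
    · generalize X.lcoact y = q
      induction q <;> simp_all [tmul_add, add_tmul]
    · rw [← hc]
      generalize X.rcoact y = q
      induction q with
      | zero => simp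
      | add a b ha hb => simp only [add_tmul, map_add, ha, hb]
      | tmul a b =>
        simp only [LinearMap.rTensor_tmul, TensorProduct.assoc_tmul]
        generalize X.lcoact a = p
        induction p <;> simp_all [tmul_add, add_tmul]
  · generalize X.lcoact y = q
    induction q <;> simp_all [tmul_add, add_tmul]

/-- The right `D`-comodule `N □_C X`, a subcomodule of `N ⊗ X`. -/
def cotensorRightObj [Module.Flat R D] (X : Bicomodule R C D) (N : RightComodule R C) :
    RightComodule R D :=
  (RightComodule.tensor N.carrier X.toRight).sub (cotensor N X.toLeft) (X.coact_mem_right N)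

/-- The left `C`-comodule `X □_D N`, a subcomodule of `X ⊗ N`. -/
def cotensorLeftObj [Module.Flat R C] (X : Bicomodule R C D) (N : LeftComodule R D) :
    LeftComodule R C :=
  (LeftComodule.tensor X.toLeft N.carrier).sub (cotensor X.toRight N) (X.coact_mem_left N)

/-- The functor `- □_C X` from right `C`-comodules to right `D`-comodules. -/
def cotensorRight [Module.Flat R D] (X : Bicomodule R C D) :
    RightComodule R C ⥤ RightComodule R D where
  obj N := X.cotensorRightObj N
  map {N N'} f :=
    { lin := cotensorMapLeft f X.toLeft
      comm := by
        have hi := (RightComodule.tensor N.carrier X.toRight).sub_coact (cotensor N X.toLeft)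
          (X.coact_mem_right N)
        have hi' := (RightComodule.tensor N'.carrier X.toRight).sub_coact (cotensor N' X.toLeft)
          (X.coact_mem_right N')
        have hf := (RightComodule.tensorMap f.lin X.toRight).comm
        refine LinearMap.ext fun x => Module.Flat.rTensor_preserves_injective_linearMap
          (M := D) _ (cotensor N' X.toLeft).injective_subtype ?_
        have h1 := LinearMap.congr_fun hi' (cotensorMapLeft f X.toLeft x)
        have h2 := LinearMap.congr_fun hf x.1
        have h3 := congrArg ((RightComodule.tensorMap f.lin X.toRight).lin.rTensor D)
          (LinearMap.congr_fun hi x)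
        refine h1.trans (h2.trans (h3.symm.trans ?_))
        exact rTensor_square ((cotensor N X.toLeft).subtype)
          ((RightComodule.tensorMap f.lin X.toRight).lin) (cotensorMapLeft f X.toLeft)
          ((cotensor N' X.toLeft).subtype) rfl _ }
  map_id N := RightComodule.hom_ext (cotensorMapLeft_id N X.toLeft)
  map_comp f g := RightComodule.hom_ext (cotensorMapLeft_comp f g X.toLeft)

/-- The functor `X □_D -` from left `D`-comodules to left `C`-comodules. -/
def cotensorLeft [Module.Flat R C] (X : Bicomodule R C D) :
    LeftComodule R D ⥤ LeftComodule R C where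
  obj N := X.cotensorLeftObj N
  map {N N'} f :=
    { lin := cotensorMapRight X.toRight f
      comm := by
        have hi := (LeftComodule.tensor X.toLeft N.carrier).sub_coact (cotensor X.toRight N)
          (X.coact_mem_left N)
        have hi' := (LeftComodule.tensor X.toLeft N'.carrier).sub_coact (cotensor X.toRight N')
          (X.coact_mem_left N')
        have hf := (LeftComodule.tensorMap X.toLeft f.lin).comm
        refine LinearMap.ext fun x => Module.Flat.lTensor_preserves_injective_linearMap
          (M := C) _ (cotensor X.toRight N').injective_subtype ?_
        have h1 := LinearMap.congr_fun hi' (cotensorMapRight X.toRight f x)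
        have h2 := LinearMap.congr_fun hf x.1
        have h3 := congrArg ((LeftComodule.tensorMap X.toLeft f.lin).lin.lTensor C)
          (LinearMap.congr_fun hi x)
        refine h1.trans (h2.trans (h3.symm.trans ?_))
        exact lTensor_square ((cotensor X.toRight N).subtype)
          ((LeftComodule.tensorMap X.toLeft f.lin).lin) (cotensorMapRight X.toRight f)
          ((cotensor X.toRight N').subtype) rfl _ }
  map_id N := LeftComodule.hom_ext (cotensorMapRight_id X.toRight N)
  map_comp f g := LeftComodule.hom_ext (cotensorMapRight_comp X.toRight f g)

/-- `X` is invertible if `- □_C X : M^C ⥤ M^D` is an equivalence. -/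
def Invertible [Module.Flat R D] (X : Bicomodule R C D) : Prop := X.cotensorRight.IsEquivalence

/-- `e_D(X) ≅ C` for `X` quasi-finite as a right `D`-comodule: there is an isomorphism of coalgebras
that carries the canonical left coaction `η_X : X → e_D(X) ⊗ X` to the given one `X → C ⊗ X`. -/
def RightCoendIso (X : Bicomodule R C D) [X.toRight.QuasiFinite] : Prop :=
  ∃ φ : X.toRight.Coend ≃ₗc[R] C,
    (φ : X.toRight.Coend →ₗ[R] C).rTensor X.carrier ∘ₗ X.toRight.coendUnit = X.lcoact

/-- `e_C(X) ≅ D` for `X` quasi-finite as a left `C`-comodule: there is an isomorphism of coalgebras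
that carries the canonical right coaction `η_X : X → X ⊗ e_C(X)` to the given one `X → X ⊗ D`. -/
def LeftCoendIso (X : Bicomodule R C D) [X.toLeft.QuasiFinite] : Prop :=
  ∃ φ : X.toLeft.Coend ≃ₗc[R] D,
    (φ : X.toLeft.Coend →ₗ[R] D).lTensor X.carrier ∘ₗ X.toLeft.coendUnit = X.rcoact

end Bicomodule

/-! ### Coflat comodules and injectors -/

section Properties

variable {R : Type u} [CommRing R] {C : Type u} [AddCommGroup C] [Module R C] [Coalgebra R C]

/-- `M` is coflat if `M □_C -` is exact: it maps short exact sequences of left comodules to short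
exact sequences of modules. Over a flat coalgebra a sequence of comodules is exact if and only if
the underlying sequence of modules is. -/
def RightComodule.Coflat (M : RightComodule R C) : Prop :=
  ∀ ⦃N₁ N₂ N₃ : LeftComodule R C⦄ (f : N₁ ⟶ N₂) (g : N₂ ⟶ N₃),
    Function.Injective f.lin → Function.Exact f.lin g.lin → Function.Surjective g.lin →
    Function.Injective (cotensorMapRight M f) ∧
      Function.Exact (cotensorMapRight M f) (cotensorMapRight M g) ∧
      Function.Surjective (cotensorMapRight M g)

/-- `M` is faithfully coflat if `M □_C -` is exact and faithful. -/
def RightComodule.FaithfullyCoflat (M : RightComodule R C) : Prop :=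
  M.Coflat ∧ M.cotensorFunctor.Faithful

/-- `M` is an injector if `- ⊗ M : R-Mod ⥤ M^C` preserves injective objects. -/
def RightComodule.IsInjector (M : RightComodule R C) : Prop :=
  ∀ W : ModuleCat.{u} R, Injective W → Injective (M.tensorFunctor.obj W)

/-- `N` is coflat if `- □_C N` is exact: it maps short exact sequences of right comodules to short
exact sequences of modules. -/
def LeftComodule.Coflat (N : LeftComodule R C) : Prop :=
  ∀ ⦃M₁ M₂ M₃ : RightComodule R C⦄ (f : M₁ ⟶ M₂) (g : M₂ ⟶ M₃),
    Function.Injective f.lin → Function.Exact f.lin g.lin → Function.Surjective g.lin →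
    Function.Injective (cotensorMapLeft f N) ∧
      Function.Exact (cotensorMapLeft f N) (cotensorMapLeft g N) ∧
      Function.Surjective (cotensorMapLeft g N)

/-- `N` is faithfully coflat if `- □_C N` is exact and faithful. -/
def LeftComodule.FaithfullyCoflat (N : LeftComodule R C) : Prop :=
  N.Coflat ∧ N.cotensorFunctor.Faithful

/-- `N` is an injector if `N ⊗ - : R-Mod ⥤ ^CM` preserves injective objects. -/
def LeftComodule.IsInjector (N : LeftComodule R C) : Prop :=
  ∀ W : ModuleCat.{u} R, Injective W → Injective (N.tensorFunctor.obj W)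

end Properties

/-- Two coalgebras are Morita-Takeuchi equivalent if their categories of right comodules, and their
categories of left comodules, are equivalent. -/
def MoritaTakeuchiEquivalent (R : Type u) [CommRing R] (C : Type u) [AddCommGroup C] [Module R C]
    [Coalgebra R C] (D : Type u) [AddCommGroup D] [Module R D] [Coalgebra R D] : Prop :=
  Nonempty (RightComodule R C ≌ RightComodule R D) ∧
    Nonempty (LeftComodule R C ≌ LeftComodule R D)

end

noncomputable section

/-! ### Colinear maps of right comodules -/

namespace RightComodule

variable {R : Type u} [CommRing R] {C : Type u} [AddCommGroup C] [Module R C] [Coalgebra R C]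

/-! An arrow `η : M → H ⊗ X` is universal (`IsCohom`) if every colinear `M → V ⊗ X` is `η` followed
by `g ⊗ X` for a unique linear `g : H → V`; then `H` is `h_D(X, M)`. In this language, for
quasi-finite `X_D`, the condition `e_D(X) ≅ C` says exactly that the left coaction `X → C ⊗ X` is
universal. The equivalences are proved in the cycle 1 → 4 → 2 → 3 → 1.

For 3 → 1, the coaction of `C` on `X` makes every cohom `H` a right `C`-comodule, so `h_D(X, -)` is
the candidate inverse. The cohom functor of an injector is exact (`IsInjector.injective`,
`IsInjector.exact`). Applied to `0 → N □ X → N ⊗ X → N ⊗ C ⊗ X`, whose last two terms have cohoms `N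
⊗ C` and `N ⊗ C ⊗ C`, it shows that `N □ X → N ⊗ X` is universal, with cohom `N` (`isCohom_incl`);
hence `- □ X` is fully faithful. Essential surjectivity rests on injectivity of all universal arrows
(`injective_of_isCohom`). This reduces to the arrow `u : D → Y ⊗ X`, tensored with an arbitrary
module `W`: the kernel `K` of `u ⊗ W` is a left `D`-comodule with `X □ K = 0`, because on `X □ (D ⊗
W) ≅ X ⊗ W` the map `X ⊗ u ⊗ W` becomes a composite of injections, and faithfulness of `X □ -` gives
`K = 0`.

For 1 → 4, full faithfulness and `(V ⊗ C) □ X ≅ V ⊗ X` show again that the inclusions `N □ X → N ⊗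
X` are universal. Since equivalences preserve and reflect monomorphisms, which over flat coalgebras
are the injective maps, `X` is flat, and so is the comodule `Y` with `Y □ X ≅ D`. Universal
properties produce `c : C → X ⊗ Y` and `lam : Y → D ⊗ Y` satisfying with `u` the two triangle
identities (`InverseData`). They make `P → X ⊗ (Y □ P)` universal for every left `C`-comodule `P`
(`isCohom_arrow`). So `X` is quasi-finite on the left with cohom functor `Y □ -`; it is an injector
because `Y` is flat, and `e_C(X) = Y □ X ≅ D`.

The remaining implications are the same two statements for the bicomodule with sides interchanged,
over the co-opposite coalgebras. -/

theorem comm_apply {M N : RightComodule R C} (f : M ⟶ N) (m : M.carrier) :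
    N.coact (f.lin m) = f.lin.rTensor C (M.coact m) :=
  LinearMap.congr_fun f.comm m

instance (M N : RightComodule R C) : Zero (M ⟶ N) :=
  ⟨⟨0, by simp⟩⟩

@[simp] theorem zero_lin (M N : RightComodule R C) : (0 : M ⟶ N).lin = 0 := rfl

theorem comp_zero {M N : RightComodule R C} (f : M ⟶ N) (P : RightComodule R C) :
    f ≫ (0 : N ⟶ P) = 0 := rfl

theorem zero_comp {N P : RightComodule R C} (M : RightComodule R C) (f : N ⟶ P) :
    (0 : M ⟶ N) ≫ f = 0 :=
  hom_ext (by simp)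

theorem mono_of_injective {M N : RightComodule R C} (f : M ⟶ N)
    (hf : Function.Injective f.lin) : Mono f where
  right_cancellation _ _ hgh := hom_ext <| LinearMap.ext fun x =>
    hf (LinearMap.congr_fun (congrArg Hom.lin hgh) x)

theorem epi_of_surjective {M N : RightComodule R C} (f : M ⟶ N)
    (hf : Function.Surjective f.lin) : Epi f where
  left_cancellation _ _ hgh := hom_ext <| LinearMap.ext fun x => by
    obtain ⟨y, rfl⟩ := hf x
    exact LinearMap.congr_fun (congrArg Hom.lin hgh) y

/-- A bijective colinear map is an isomorphism. -/
def isoOfBijective {M N : RightComodule R C} (f : M ⟶ N) (hf : Function.Bijective f.lin) :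
    M ≅ N where
  hom := f
  inv :=
    { lin := (LinearEquiv.ofBijective f.lin hf).symm.toLinearMap
      comm := by
        set e := LinearEquiv.ofBijective f.lin hf
        refine LinearMap.ext fun x => ?_
        obtain ⟨y, rfl⟩ := e.surjective x
        change M.coact (e.symm (e y)) = e.symm.toLinearMap.rTensor C (N.coact (f.lin y))
        rw [comm_apply, LinearEquiv.symm_apply_apply, ← LinearMap.comp_apply,
          ← LinearMap.rTensor_comp]
        have : e.symm.toLinearMap ∘ₗ f.lin = LinearMap.id :=
          LinearMap.ext fun z => e.symm_apply_apply z
        rw [this, LinearMap.rTensor_id, LinearMap.id_apply] }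
  hom_inv_id := hom_ext <| LinearMap.ext fun z =>
    (LinearEquiv.ofBijective f.lin hf).symm_apply_apply z
  inv_hom_id := hom_ext <| LinearMap.ext fun z =>
    (LinearEquiv.ofBijective f.lin hf).apply_symm_apply z

theorem bijective_of_isIso {M N : RightComodule R C} (f : M ⟶ N) [IsIso f] :
    Function.Bijective f.lin := by
  refine Function.bijective_iff_has_inverse.2 ⟨(inv f).lin, fun x => ?_, fun x => ?_⟩
  · exact LinearMap.congr_fun (congrArg Hom.lin (IsIso.hom_inv_id f)) x
  · exact LinearMap.congr_fun (congrArg Hom.lin (IsIso.inv_hom_id f)) x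

theorem coact_injective (M : RightComodule R C) : Function.Injective M.coact := by
  intro x y h
  have hx := LinearMap.congr_fun M.counit x
  have hy := LinearMap.congr_fun M.counit y
  simp only [LinearMap.comp_apply, LinearMap.flip_apply, TensorProduct.mk_apply] at hx hy
  rw [h, hy] at hx
  simpa using congrArg (TensorProduct.rid R M.carrier) hx.symm

variable (R C) in
/-- The coalgebra as a right comodule over itself. -/
def self : RightComodule R C where
  carrier := C
  coact := Coalgebra.comul
  coassoc := Coalgebra.coassoc
  counit := Coalgebra.lTensor_counit_comp_comul

/-- The coaction `M → M ⊗ C` as a colinear map. -/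
def coactHom (M : RightComodule R C) : M ⟶ tensor M.carrier (self R C) where
  lin := M.coact
  comm := by
    refine LinearMap.ext fun m => ?_
    have h := LinearMap.congr_fun M.coassoc m
    simp only [LinearMap.comp_apply, LinearEquiv.coe_coe] at h
    exact ((TensorProduct.assoc R M.carrier C C).symm_apply_eq.2 h.symm)

/-! ### Tensor products with modules -/

section TensorLemmas

variable {U V W : Type u} [AddCommGroup U] [Module R U] [AddCommGroup V] [Module R V]
  [AddCommGroup W] [Module R W]

theorem tensorMap_comp (f : U →ₗ[R] V) (g : V →ₗ[R] W) (M : RightComodule R C) :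
    tensorMap (g ∘ₗ f) M = tensorMap f M ≫ tensorMap g M :=
  hom_ext (LinearMap.rTensor_comp M.carrier g f)

theorem tensorMap_id (M : RightComodule R C) :
    tensorMap (LinearMap.id : V →ₗ[R] V) M = 𝟙 _ :=
  hom_ext (LinearMap.rTensor_id M.carrier V)

theorem tensorMap_zero (M : RightComodule R C) : tensorMap (0 : V →ₗ[R] W) M = 0 :=
  hom_ext (LinearMap.rTensor_zero M.carrier)

theorem tensorMapRight_comp {M N P : RightComodule R C} (f : M ⟶ N) (g : N ⟶ P) :
    tensorMapRight W (f ≫ g) = tensorMapRight W f ≫ tensorMapRight W g :=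
  hom_ext (LinearMap.lTensor_comp W g.lin f.lin)

theorem tensorMap_tensorMapRight (f : V →ₗ[R] W) {M N : RightComodule R C} (g : M ⟶ N) :
    tensorMap f M ≫ tensorMapRight W g = tensorMapRight V g ≫ tensorMap f N :=
  hom_ext (ext' fun _ _ => rfl)

theorem tensorAssoc_naturality_left (f : U →ₗ[R] V) (M : RightComodule R C) :
    tensorMap f (tensor W M) ≫ tensorAssoc V W M =
      tensorAssoc U W M ≫ tensorMap (f.rTensor W) M :=
  hom_ext <| TensorProduct.ext (LinearMap.ext fun _ => ext' fun _ _ => rfl)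

theorem tensorAssoc_naturality_mid (f : U →ₗ[R] V) (M : RightComodule R C) :
    tensorMapRight W (tensorMap f M) ≫ tensorAssoc W V M =
      tensorAssoc W U M ≫ tensorMap (f.lTensor W) M :=
  hom_ext <| TensorProduct.ext (LinearMap.ext fun _ => ext' fun _ _ => rfl)

/-- The colinear map `W ⊗ M → (W ⊗ H) ⊗ X` obtained from `η : M → H ⊗ X`. -/
def extend {M X : RightComodule R C} (W : Type u) [AddCommGroup W] [Module R W]
    {H : Type u} [AddCommGroup H] [Module R H] (η : M ⟶ tensor H X) :
    tensor W M ⟶ tensor (W ⊗[R] H) X :=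
  tensorMapRight W η ≫ tensorAssoc W H X

theorem tensorMap_extend {M X : RightComodule R C} {H : Type u} [AddCommGroup H] [Module R H]
    (f : V →ₗ[R] W) (η : M ⟶ tensor H X) :
    tensorMap f M ≫ extend W η = extend V η ≫ tensorMap (f.rTensor H) X := by
  rw [extend, extend, ← Category.assoc, tensorMap_tensorMapRight, Category.assoc,
    tensorAssoc_naturality_left, Category.assoc]

theorem extend_comp_tensorMap {M X : RightComodule R C} (η : M ⟶ tensor U X) (f : U →ₗ[R] V) :
    extend W (η ≫ tensorMap f X) = extend W η ≫ tensorMap (f.lTensor W) X := by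
  rw [extend, extend, tensorMapRight_comp, Category.assoc, tensorAssoc_naturality_mid,
    Category.assoc]

theorem extend_comp {M N X : RightComodule R C} (f : M ⟶ N) (η : N ⟶ tensor V X) :
    extend W (f ≫ η) = tensorMapRight W f ≫ extend W η := by
  rw [extend, extend, tensorMapRight_comp, Category.assoc]

theorem extend_extend {M X : RightComodule R C} (η : M ⟶ tensor U X) :
    extend V (extend W η) ≫ tensorMap (TensorProduct.assoc R V W U).symm.toLinearMap X =
      tensorAssoc V W M ≫ extend (V ⊗[R] W) η := by
  refine hom_ext <| TensorProduct.ext (LinearMap.ext fun v => ext' fun w m => ?_)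
  change ((TensorProduct.assoc R V W U).symm.toLinearMap.rTensor X.carrier)
    ((TensorProduct.assoc R V (W ⊗[R] U) X.carrier).symm (v ⊗ₜ
      (TensorProduct.assoc R W U X.carrier).symm (w ⊗ₜ η.lin m))) =
    (TensorProduct.assoc R (V ⊗[R] W) U X.carrier).symm ((v ⊗ₜ w) ⊗ₜ η.lin m)
  generalize η.lin m = y
  induction y using TensorProduct.induction_on with
  | zero => simp
  | add a b ha hb => simp only [tmul_add, map_add, ha, hb]
  | tmul a b => simp

end TensorLemmas

/-! ### Universal arrows -/

/-- `η : M → H ⊗ X` is a universal arrow from `M` to the functor `- ⊗ X`. -/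
def IsCohom {X M : RightComodule R C} {H : Type u} [AddCommGroup H] [Module R H]
    (η : M ⟶ tensor H X) : Prop :=
  ∀ (V : Type u) [AddCommGroup V] [Module R V] (f : M ⟶ tensor V X),
    ∃! g : H →ₗ[R] V, η ≫ tensorMap g X = f

namespace IsCohom

variable {X M : RightComodule R C} {H : Type u} [AddCommGroup H] [Module R H]
  {η : M ⟶ tensor H X}

/-- The linear map induced by a universal arrow. -/
def desc (h : IsCohom η) {V : Type u} [AddCommGroup V] [Module R V] (f : M ⟶ tensor V X) :
    H →ₗ[R] V :=
  (h V f).choose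

theorem fac (h : IsCohom η) {V : Type u} [AddCommGroup V] [Module R V] (f : M ⟶ tensor V X) :
    η ≫ tensorMap (h.desc f) X = f :=
  (h V f).choose_spec.1

theorem ext (h : IsCohom η) {V : Type u} [AddCommGroup V] [Module R V] {g g' : H →ₗ[R] V}
    (hg : η ≫ tensorMap g X = η ≫ tensorMap g' X) : g = g' :=
  (h V (η ≫ tensorMap g' X)).unique hg rfl

theorem of_bijective (h : IsCohom η) {H' : Type u} [AddCommGroup H'] [Module R H']
    {η' : M ⟶ tensor H' X} {e : H →ₗ[R] H'} (he : Function.Bijective e)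
    (hη : η ≫ tensorMap e X = η') : IsCohom η' := by
  intro V _ _ f
  set e' := LinearEquiv.ofBijective e he
  have h1 : e'.symm.toLinearMap ∘ₗ e = LinearMap.id :=
    LinearMap.ext fun z => e'.symm_apply_apply z
  refine ⟨h.desc f ∘ₗ e'.symm.toLinearMap, ?_, fun g hg => ?_⟩
  · dsimp only
    rw [← hη, Category.assoc, ← tensorMap_comp, LinearMap.comp_assoc, h1, LinearMap.comp_id, h.fac]
  · have h2 : g ∘ₗ e = h.desc f := h.ext (by
      rw [h.fac, tensorMap_comp, ← Category.assoc, hη, hg])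
    rw [← h2]
    refine LinearMap.ext fun z => congrArg g (e'.apply_symm_apply z).symm

theorem bijective (h : IsCohom η) {H' : Type u} [AddCommGroup H'] [Module R H']
    {η' : M ⟶ tensor H' X} (h' : IsCohom η') {e : H →ₗ[R] H'}
    (hη : η ≫ tensorMap e X = η') : Function.Bijective e := by
  have h1 : h'.desc η ∘ₗ e = LinearMap.id := h.ext (by
    rw [tensorMap_comp, ← Category.assoc, hη, h'.fac, tensorMap_id, Category.comp_id])
  have h2 : e ∘ₗ h'.desc η = LinearMap.id := h'.ext (by
    rw [tensorMap_comp, ← Category.assoc, h'.fac, hη, tensorMap_id, Category.comp_id])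
  exact Function.bijective_iff_has_inverse.2
    ⟨h'.desc η, fun x => LinearMap.congr_fun h1 x, fun x => LinearMap.congr_fun h2 x⟩

theorem of_iso (h : IsCohom η) {M' : RightComodule R C} (i : M' ≅ M) :
    IsCohom (i.hom ≫ η) := by
  intro V _ _ f
  refine ⟨h.desc (i.inv ≫ f), ?_, fun g hg => h.ext ?_⟩
  · dsimp only
    rw [Category.assoc, h.fac, Iso.hom_inv_id_assoc]
  · rw [h.fac, ← hg, Category.assoc, Iso.inv_hom_id_assoc]

/-- The colinear map `M → W ⊗ M`, `m ↦ w ⊗ m`. -/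
def _root_.RightComodule.insert {W : Type u} [AddCommGroup W] [Module R W] (w : W)
    (M : RightComodule R C) : M ⟶ RightComodule.tensor W M where
  lin := TensorProduct.mk R W M.carrier w
  comm := by
    refine LinearMap.ext fun m => ?_
    change (TensorProduct.assoc R W M.carrier C).symm (w ⊗ₜ M.coact m) =
      (TensorProduct.mk R W M.carrier w).rTensor C (M.coact m)
    generalize M.coact m = y
    induction y <;> simp_all [tmul_add, add_tmul]

/-- A colinear map `W ⊗ M → V ⊗ X` is a family of colinear maps `M → V ⊗ X` depending linearly on
`w`. Each member factors uniquely through `H`, and uniqueness makes the factorizations linear in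
`w`, so they assemble to a map on `W ⊗ H`. Thus `h(X, W ⊗ M) = W ⊗ h(X, M)` for an arbitrary module
`W`. -/
theorem extend (h : IsCohom η) (W : Type u) [AddCommGroup W] [Module R W] :
    IsCohom (RightComodule.extend W η) := by
  have key {V : Type u} [AddCommGroup V] [Module R V] (g : W ⊗[R] H →ₗ[R] V) (w : W) :
      RightComodule.insert w M ≫ RightComodule.extend W η ≫ tensorMap g X =
        η ≫ tensorMap (g ∘ₗ TensorProduct.mk R W H w) X := by
    refine hom_ext (LinearMap.ext fun m => ?_)
    change g.rTensor X.carrier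
      ((TensorProduct.assoc R W H X.carrier).symm (w ⊗ₜ η.lin m)) =
      (g ∘ₗ TensorProduct.mk R W H w).rTensor X.carrier (η.lin m)
    generalize η.lin m = y
    induction y using TensorProduct.induction_on with
    | zero => simp
    | add a b ha hb => simp only [tmul_add, map_add, ha, hb]
    | tmul a b => simp
  intro V _ _ f
  let F : W ⊗[R] M.carrier →ₗ[R] V ⊗[R] X.carrier := f.lin
  -- Additivity and homogeneity in `w` are checked after `η`, where uniqueness applies.
  have add (w w' : W) : h.desc (RightComodule.insert (w + w') M ≫ f) =
      h.desc (RightComodule.insert w M ≫ f) + h.desc (RightComodule.insert w' M ≫ f) := by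
    refine h.ext ?_
    rw [h.fac]
    refine hom_ext (LinearMap.ext fun m => ?_)
    have h1 := LinearMap.congr_fun (congrArg Hom.lin (h.fac (RightComodule.insert w M ≫ f))) m
    have h2 := LinearMap.congr_fun (congrArg Hom.lin (h.fac (RightComodule.insert w' M ≫ f))) m
    change (LinearMap.rTensor X.carrier _ : _ →ₗ[R] V ⊗[R] X.carrier) (η.lin m) = F (w ⊗ₜ m) at h1
    change (LinearMap.rTensor X.carrier _ : _ →ₗ[R] V ⊗[R] X.carrier) (η.lin m) = F (w' ⊗ₜ m) at h2
    change F ((w + w') ⊗ₜ m) = (LinearMap.rTensor X.carrier _ : _ →ₗ[R] V ⊗[R] X.carrier) (η.lin m)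
    refine Eq.trans ?_ (LinearMap.congr_fun (LinearMap.rTensor_add X.carrier _ _) (η.lin m)).symm
    refine Eq.trans ?_ (congrArg₂ (· + ·) h1.symm h2.symm)
    rw [add_tmul, map_add]
  have smul (r : R) (w : W) : h.desc (RightComodule.insert (r • w) M ≫ f) =
      r • h.desc (RightComodule.insert w M ≫ f) := by
    refine h.ext ?_
    rw [h.fac]
    refine hom_ext (LinearMap.ext fun m => ?_)
    have h1 := LinearMap.congr_fun (congrArg Hom.lin (h.fac (RightComodule.insert w M ≫ f))) m
    change (LinearMap.rTensor X.carrier _ : _ →ₗ[R] V ⊗[R] X.carrier) (η.lin m) = F (w ⊗ₜ m) at h1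
    change F ((r • w) ⊗ₜ m) = (LinearMap.rTensor X.carrier _ : _ →ₗ[R] V ⊗[R] X.carrier) (η.lin m)
    refine Eq.trans ?_ (LinearMap.congr_fun (LinearMap.rTensor_smul X.carrier r _) (η.lin m)).symm
    refine Eq.trans ?_ (congrArg (r • ·) h1.symm)
    rw [← smul_tmul', map_smul]
  refine ⟨TensorProduct.lift
    { toFun := fun w => h.desc (RightComodule.insert w M ≫ f), map_add' := add, map_smul' := smul },
    ?_, fun g hg => ?_⟩
  · refine hom_ext (ext' fun w m => ?_)
    have h1 := LinearMap.congr_fun (congrArg Hom.lin (key (TensorProduct.lift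
      { toFun := fun w => h.desc (RightComodule.insert w M ≫ f),
        map_add' := add, map_smul' := smul }) w)) m
    refine h1.trans ?_
    have h2 := LinearMap.congr_fun (congrArg Hom.lin (h.fac (RightComodule.insert w M ≫ f))) m
    refine Eq.trans ?_ h2
    congr 4
  · refine ext' fun w z => ?_
    have : g ∘ₗ TensorProduct.mk R W H w = h.desc (RightComodule.insert w M ≫ f) := h.ext (by
      rw [← key, hg, h.fac])
    exact LinearMap.congr_fun this z

end IsCohom

theorem isCohom_unit (X : RightComodule R C) [X.QuasiFinite] (M : RightComodule R C) :
    ∃ (H : Type u) (_ : AddCommGroup H) (_ : Module R H) (η : M ⟶ tensor H X), IsCohom η := by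
  refine ⟨X.cohom.obj M, inferInstance, inferInstance, X.cohomAdj.unit.app M, fun V _ _ f => ?_⟩
  refine ⟨((X.cohomAdj.homEquiv M (ModuleCat.of R V)).symm f).hom, ?_, fun g hg => ?_⟩
  · have h := (X.cohomAdj.homEquiv M (ModuleCat.of R V)).apply_symm_apply f
    rw [Adjunction.homEquiv_unit] at h
    exact h
  · have : ModuleCat.ofHom g = (X.cohomAdj.homEquiv M (ModuleCat.of R V)).symm f :=
      (Equiv.eq_symm_apply _).2 ((Adjunction.homEquiv_unit ..).trans hg)
    exact congrArg ModuleCat.Hom.hom this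

theorem isCohom_coendUnitHom (X : RightComodule R C) [X.QuasiFinite] :
    IsCohom X.coendUnitHom := fun _ _ _ f =>
  ⟨X.coendLift f, hom_ext (X.coendLift_spec f), fun _ hg => X.coend_ext
    ((congrArg Hom.lin hg).trans (X.coendLift_spec f).symm)⟩

end RightComodule

namespace RightComodule

variable {R : Type u} [CommRing R] {C : Type u} [AddCommGroup C] [Module R C] [Coalgebra R C]

/-! ### Subcomodules and quotient comodules -/

theorem coact_mem_range {M N : RightComodule R C} (f : M ⟶ N) :
    ∀ x ∈ LinearMap.range f.lin,
      N.coact x ∈ LinearMap.range ((LinearMap.range f.lin).subtype.rTensor C) := by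
  rintro _ ⟨x, rfl⟩
  rw [comm_apply]
  refine ⟨f.lin.rangeRestrict.rTensor C (M.coact x), ?_⟩
  rw [← LinearMap.comp_apply, ← LinearMap.rTensor_comp]
  rfl

section Flat

variable [Module.Flat R C]

/-- The inclusion of a subcomodule. -/
def subHom (M : RightComodule R C) (S : Submodule R M.carrier)
    (hS : ∀ x ∈ S, M.coact x ∈ LinearMap.range (S.subtype.rTensor C)) : M.sub S hS ⟶ M where
  lin := S.subtype
  comm := (M.sub_coact S hS).symm

theorem subHom_injective (M : RightComodule R C) (S : Submodule R M.carrier)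
    (hS : ∀ x ∈ S, M.coact x ∈ LinearMap.range (S.subtype.rTensor C)) :
    Function.Injective (M.subHom S hS).lin :=
  S.injective_subtype

/-- A colinear map with image in a subcomodule, as a map to the subcomodule. -/
def subLift {M N : RightComodule R C} (S : Submodule R M.carrier)
    (hS : ∀ x ∈ S, M.coact x ∈ LinearMap.range (S.subtype.rTensor C)) (f : N ⟶ M)
    (hf : ∀ x, f.lin x ∈ S) : N ⟶ M.sub S hS where
  lin := f.lin.codRestrict S hf
  comm := by
    refine LinearMap.ext fun x => Module.Flat.rTensor_preserves_injective_linearMap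
      (M := C) _ S.injective_subtype ?_
    refine (LinearMap.congr_fun (M.sub_coact S hS) (f.lin.codRestrict S hf x)).trans ?_
    refine (comm_apply f x).trans ?_
    change _ = S.subtype.rTensor C ((f.lin.codRestrict S hf).rTensor C (N.coact x))
    rw [← LinearMap.rTensor_comp_apply, LinearMap.subtype_comp_codRestrict]

theorem subLift_subHom {M N : RightComodule R C} (S : Submodule R M.carrier)
    (hS : ∀ x ∈ S, M.coact x ∈ LinearMap.range (S.subtype.rTensor C)) (f : N ⟶ M)
    (hf : ∀ x, f.lin x ∈ S) : subLift S hS f hf ≫ M.subHom S hS = f :=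
  hom_ext rfl

theorem coact_mem_ker {M N : RightComodule R C} (f : M ⟶ N) :
    ∀ x ∈ LinearMap.ker f.lin,
      M.coact x ∈ LinearMap.range ((LinearMap.ker f.lin).subtype.rTensor C) := by
  intro x hx
  refine (Module.Flat.rTensor_exact C (LinearMap.exact_subtype_ker_map f.lin) _).1 ?_
  rw [← comm_apply, LinearMap.mem_ker.1 hx, map_zero]

/-- The kernel is a subcomodule because `C` is flat, so a monomorphism has zero kernel. This turns
`Mono`, which equivalences preserve and reflect, into injectivity of linear maps. -/
theorem injective_of_mono {M N : RightComodule R C} (f : M ⟶ N) [Mono f] :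
    Function.Injective f.lin := by
  rw [← LinearMap.ker_eq_bot, LinearMap.ker_eq_bot']
  intro x hx
  have h : M.subHom _ (coact_mem_ker f) = 0 := by
    rw [← cancel_mono f, zero_comp]
    exact hom_ext (LinearMap.ext fun y => y.2)
  exact LinearMap.congr_fun (congrArg Hom.lin h) ⟨x, hx⟩

/-- A colinear map to an injective comodule extends along `f` if it vanishes on its kernel. -/
theorem exists_extension {M N I : RightComodule R C} [Injective I] (f : M ⟶ N) (g : M ⟶ I)
    (h : ∀ x, f.lin x = 0 → g.lin x = 0) : ∃ k : N ⟶ I, f ≫ k = g := by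
  -- As `f` need not be injective, `g` is first pushed down to the image of `f`, a subcomodule of
  -- `N`, and then extended along the inclusion of that image.
  let p : M ⟶ N.sub _ (coact_mem_range f) := subLift _ _ f fun x => ⟨x, rfl⟩
  have hp : Function.Surjective p.lin := by
    rintro ⟨_, x, rfl⟩
    exact ⟨x, rfl⟩
  have hfp (x) (hx : p.lin x = 0) : g.lin x = 0 := h x (congrArg Subtype.val hx)
  have hker : LinearMap.ker p.lin ≤ LinearMap.ker g.lin := fun x hx => hfp x hx
  let e := p.lin.quotKerEquivOfSurjective hp
  let k : (N.sub _ (coact_mem_range f)).carrier →ₗ[R] I.carrier :=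
    (LinearMap.ker p.lin).liftQ g.lin hker ∘ₗ e.symm.toLinearMap
  have hk (x) : k (p.lin x) = g.lin x := by
    have : e.symm (p.lin x) = Submodule.Quotient.mk x := (LinearEquiv.symm_apply_eq e).2 rfl
    change (LinearMap.ker p.lin).liftQ g.lin hker (e.symm (p.lin x)) = _
    rw [this]
    exact Submodule.liftQ_apply _ _ _
  let k' : N.sub _ (coact_mem_range f) ⟶ I :=
    { lin := k
      comm := by
        refine LinearMap.ext fun y => ?_
        obtain ⟨x, rfl⟩ := hp y
        change I.coact (k (p.lin x)) = k.rTensor C ((N.sub _ _).coact (p.lin x))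
        have : k ∘ₗ p.lin = g.lin := LinearMap.ext hk
        rw [hk, comm_apply, comm_apply, ← LinearMap.rTensor_comp_apply, this] }
  have : Mono (N.subHom _ (coact_mem_range f)) := mono_of_injective _ (subHom_injective _ _ _)
  refine ⟨Injective.factorThru k' (N.subHom _ (coact_mem_range f)), ?_⟩
  have h1 : p ≫ N.subHom _ (coact_mem_range f) = f := subLift_subHom _ _ _ _
  refine (congrArg (· ≫ _) h1.symm).trans ?_
  rw [Category.assoc, Injective.comp_factorThru]
  exact hom_ext (LinearMap.ext hk)

end Flat

/-- The quotient of a comodule by the range of a colinear map. -/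
def coker {M N : RightComodule R C} (f : M ⟶ N) : RightComodule R C where
  carrier := N.carrier ⧸ LinearMap.range f.lin
  coact := (LinearMap.range f.lin).liftQ
    ((LinearMap.range f.lin).mkQ.rTensor C ∘ₗ N.coact) (by
      rintro _ ⟨x, rfl⟩
      have h : (LinearMap.range f.lin).mkQ ∘ₗ f.lin = 0 := LinearMap.range_mkQ_comp f.lin
      rw [LinearMap.mem_ker, LinearMap.comp_apply, comm_apply, ← LinearMap.comp_apply,
        ← LinearMap.rTensor_comp, h, LinearMap.rTensor_zero, LinearMap.zero_apply])
  coassoc := by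
    refine Submodule.linearMap_qext _ (LinearMap.ext fun x => ?_)
    have h := LinearMap.congr_fun N.coassoc x
    simp only [LinearMap.comp_apply, Submodule.mkQ_apply, Submodule.liftQ_apply,
      LinearEquiv.coe_coe] at h ⊢
    set π := (LinearMap.range f.lin).mkQ
    trans π.rTensor (C ⊗[R] C) (TensorProduct.assoc R N.carrier C C
      (N.coact.rTensor C (N.coact x)))
    · generalize N.coact x = y
      induction y with
      | zero => simp
      | add a b ha hb => simp only [map_add, ha, hb]
      | tmul n c =>
        simp only [LinearMap.rTensor_tmul]
        change TensorProduct.assoc R _ C C (π.rTensor C (N.coact n) ⊗ₜ c) = _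
        generalize N.coact n = z
        induction z <;> simp_all [tmul_add, add_tmul]
    · rw [h]
      generalize N.coact x = y
      induction y <;> simp_all [tmul_add, add_tmul]
      rfl
  counit := by
    refine Submodule.linearMap_qext _ (LinearMap.ext fun x => ?_)
    have h := LinearMap.congr_fun N.counit x
    simp only [LinearMap.comp_apply, Submodule.mkQ_apply, Submodule.liftQ_apply] at h ⊢
    set π := (LinearMap.range f.lin).mkQ
    trans π.rTensor R ((Coalgebra.counit (R := R) (A := C)).lTensor N.carrier (N.coact x))
    · generalize N.coact x = y
      induction y <;> simp_all [tmul_add, add_tmul]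
    · rw [h]; rfl

/-- The projection to the cokernel. -/
def cokerHom {M N : RightComodule R C} (f : M ⟶ N) : N ⟶ coker f where
  lin := (LinearMap.range f.lin).mkQ
  comm := LinearMap.ext fun _ => rfl

theorem comp_cokerHom {M N : RightComodule R C} (f : M ⟶ N) : f ≫ cokerHom f = 0 :=
  hom_ext (LinearMap.range_mkQ_comp f.lin)

theorem surjective_of_cokerHom_eq_zero {M N : RightComodule R C} (f : M ⟶ N)
    (h : cokerHom f = 0) : Function.Surjective f.lin := fun y =>
  (Submodule.Quotient.mk_eq_zero _).1 (LinearMap.congr_fun (congrArg Hom.lin h) y)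

/-- Cokernels exist without any flatness, tensor products being right exact. Together with
`epi_of_surjective` this lets an equivalence carry surjectivity across. -/
theorem surjective_of_epi {M N : RightComodule R C} (f : M ⟶ N) [Epi f] :
    Function.Surjective f.lin :=
  surjective_of_cokerHom_eq_zero f (by
    rw [← cancel_epi f, comp_cokerHom, comp_zero])

end RightComodule

/-! ### The left coaction of a bicomodule and the inclusion of `N □ X` in `N ⊗ X` -/

namespace Bicomodule

open RightComodule

variable {R : Type u} [CommRing R] {C : Type u} [AddCommGroup C] [Module R C] [Coalgebra R C]
  {D : Type u} [AddCommGroup D] [Module R D] [Coalgebra R D] (X : Bicomodule R C D)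

/-- The left coaction, as a map of right comodules. -/
def lcoactHom : X.toRight ⟶ tensor C X.toRight where
  lin := X.lcoact
  comm := by
    refine LinearMap.ext fun (x : X.carrier) => ?_
    have h := LinearMap.congr_fun X.compat x
    simp only [LinearMap.comp_apply, LinearEquiv.coe_coe] at h
    exact ((TensorProduct.assoc R C X.carrier D).symm_apply_eq.2 h.symm)

theorem lcoactHom_extend :
    X.lcoactHom ≫ extend C X.lcoactHom = X.lcoactHom ≫ tensorMap Coalgebra.comul X.toRight := by
  refine hom_ext (LinearMap.ext fun (x : X.carrier) => ?_)
  have h := LinearMap.congr_fun X.lcoassoc x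
  simp only [LinearMap.comp_apply, LinearEquiv.coe_coe] at h
  exact ((TensorProduct.assoc R C C X.carrier).symm_apply_eq.2 h.symm)

/-- Coassociativity of the left coaction, tensored with `V`. It is kept in terms of colinear maps so
that it can be composed with universal arrows. -/
theorem extend_lcoactHom_coassoc (V : Type u) [AddCommGroup V] [Module R V] :
    extend V X.lcoactHom ≫ extend (V ⊗[R] C) X.lcoactHom ≫
        tensorMap (TensorProduct.assoc R V C C).toLinearMap X.toRight =
      extend V X.lcoactHom ≫ tensorMap (Coalgebra.comul.lTensor V) X.toRight := by
  have h : tensorMap (TensorProduct.assoc R V C C).symm.toLinearMap X.toRight ≫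
      tensorMap (TensorProduct.assoc R V C C).toLinearMap X.toRight = 𝟙 _ := by
    rw [← tensorMap_comp, ← tensorMap_id]
    congr 1
    exact LinearMap.ext fun x => (TensorProduct.assoc R V C C).apply_symm_apply x
  rw [← extend_comp_tensorMap, ← lcoactHom_extend, extend_comp]
  conv_lhs => rw [extend, Category.assoc]
  rw [← Category.assoc (tensorAssoc V C X.toRight), ← extend_extend, Category.assoc, h,
    Category.comp_id]

/-- The canonical map `V ⊗ C → V` induced by the counit. -/
def _root_.counitRight (R : Type u) [CommRing R] (C : Type u) [AddCommGroup C] [Module R C]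
    [Coalgebra R C] (V : Type u) [AddCommGroup V] [Module R V] : V ⊗[R] C →ₗ[R] V :=
  (TensorProduct.rid R V).toLinearMap ∘ₗ (Coalgebra.counit (R := R) (A := C)).lTensor V

@[simp] theorem _root_.counitRight_tmul (V : Type u) [AddCommGroup V] [Module R V] (v : V) (c : C) :
    counitRight R C V (v ⊗ₜ c) = Coalgebra.counit (R := R) c • v := by
  simp [counitRight]

theorem _root_.RightComodule.counitRight_coact (M : RightComodule R C) (m : M.carrier) :
    counitRight R C M.carrier (M.coact m) = m := by
  have h := LinearMap.congr_fun M.counit m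
  simp only [LinearMap.comp_apply] at h
  simp [counitRight, h]

theorem extend_lcoactHom_counit (V : Type u) [AddCommGroup V] [Module R V] :
    extend V X.lcoactHom ≫ tensorMap (counitRight R C V) X.toRight = 𝟙 _ := by
  refine hom_ext (ext' fun v (x : X.carrier) => ?_)
  have h := LinearMap.congr_fun X.lcounit x
  simp only [LinearMap.comp_apply, TensorProduct.mk_apply] at h
  change (counitRight R C V).rTensor X.carrier
    ((TensorProduct.assoc R V C X.carrier).symm (v ⊗ₜ X.lcoact x)) = v ⊗ₜ x
  trans v ⊗ₜ (TensorProduct.lid R X.carrier)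
    ((Coalgebra.counit (R := R) (A := C)).rTensor X.carrier (X.lcoact x))
  · generalize X.lcoact x = y
    induction y with
    | zero => simp
    | add a b ha hb => simp only [tmul_add, map_add, ha, hb]
    | tmul c x => simp [smul_tmul]
  · rw [h]; simp

/-- Describes the cotensor product as the equalizer of two colinear maps `N ⊗ X → (N ⊗ C) ⊗ X`, so
that `N □ X` can be handled by composing arrows. -/
theorem mem_cotensor_iff (N : RightComodule R C) (z : N.carrier ⊗[R] X.carrier) :
    z ∈ cotensor N X.toLeft ↔
      (tensorMap N.coact X.toRight).lin z = (extend N.carrier X.lcoactHom).lin z := by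
  have h : (tensorMap N.coact X.toRight).lin z = (extend N.carrier X.lcoactHom).lin z ↔
      N.coact.rTensor X.carrier z =
        (TensorProduct.assoc R N.carrier C X.carrier).symm (X.lcoact.lTensor N.carrier z) :=
    Iff.rfl
  rw [h, LinearEquiv.eq_symm_apply, ← sub_eq_zero]
  rfl

section Flat

variable [Module.Flat R D]

/-- The inclusion `N □ X → N ⊗ X`. -/
def incl (N : RightComodule R C) : X.cotensorRight.obj N ⟶ tensor N.carrier X.toRight :=
  subHom _ _ (X.coact_mem_right N)

theorem incl_injective (N : RightComodule R C) : Function.Injective (X.incl N).lin :=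
  subHom_injective _ _ _

instance (N : RightComodule R C) : Mono (X.incl N) :=
  mono_of_injective _ (X.incl_injective N)

theorem incl_condition (N : RightComodule R C) :
    X.incl N ≫ tensorMap N.coact X.toRight = X.incl N ≫ extend N.carrier X.lcoactHom :=
  hom_ext (LinearMap.ext fun z => (X.mem_cotensor_iff N z.1).1 z.2)

theorem map_incl {N N' : RightComodule R C} (f : N ⟶ N') :
    X.cotensorRight.map f ≫ X.incl N' = X.incl N ≫ tensorMap f.lin X.toRight :=
  hom_ext rfl

variable {X}

/-- A colinear map to `N ⊗ X` equalizing the two maps to `N ⊗ C ⊗ X` lifts to `N □ X`. -/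
def inclLift {N : RightComodule R C} {M : RightComodule R D}
    (f : M ⟶ tensor N.carrier X.toRight)
    (hf : f ≫ tensorMap N.coact X.toRight = f ≫ extend N.carrier X.lcoactHom) :
    M ⟶ X.cotensorRight.obj N :=
  subLift _ (X.coact_mem_right N) f fun m =>
    (X.mem_cotensor_iff N (f.lin m)).2 (LinearMap.congr_fun (congrArg Hom.lin hf) m)

theorem inclLift_incl {N : RightComodule R C} {M : RightComodule R D}
    (f : M ⟶ tensor N.carrier X.toRight)
    (hf : f ≫ tensorMap N.coact X.toRight = f ≫ extend N.carrier X.lcoactHom) :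
    inclLift f hf ≫ X.incl N = f :=
  subLift_subHom _ _ _ _

theorem exists_incl_eq_iff {N : RightComodule R C} (z : N.carrier ⊗[R] X.carrier) :
    (∃ y, (X.incl N).lin y = z) ↔ z ∈ cotensor N X.toLeft :=
  ⟨fun ⟨y, hy⟩ => hy ▸ y.2, fun h => ⟨⟨z, h⟩, rfl⟩⟩

/-- If `H` is a right `C`-comodule and `η : M → H ⊗ X` is a universal arrow which equalizes the
two maps to `H ⊗ C ⊗ X`, then a linear map from `H` is colinear as soon as the corresponding map
factors through a cotensor product. -/
theorem colinear_of_isCohom {M : RightComodule R D} {H N : RightComodule R C}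
    {η : M ⟶ tensor H.carrier X.toRight} (hη : IsCohom η)
    (hH : η ≫ tensorMap H.coact X.toRight = η ≫ extend H.carrier X.lcoactHom)
    (g : H.carrier →ₗ[R] N.carrier) (k : M ⟶ X.cotensorRight.obj N)
    (hk : k ≫ X.incl N = η ≫ tensorMap g X.toRight) :
    N.coact ∘ₗ g = g.rTensor C ∘ₗ H.coact := by
  -- Compare after `η`. On one side `η` followed by `g` lands in `N □ X`, where the coaction of `N`
  -- may be traded for that of `X`; on the other side `hH` makes the same trade for `H`.
  refine hη.ext ?_
  rw [tensorMap_comp, tensorMap_comp, ← Category.assoc, ← Category.assoc, hH, Category.assoc, Category.assoc,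
    ← tensorMap_extend g, ← Category.assoc η, ← hk, Category.assoc, X.incl_condition,
    ← Category.assoc, hk, Category.assoc]

end Flat

end Bicomodule

/-! ### Exactness of the cohom functor of an injector -/

namespace RightComodule

variable {R : Type u} [CommRing R] {C : Type u} [AddCommGroup C] [Module R C] [Coalgebra R C]

instance (M N : RightComodule R C) : Sub (M ⟶ N) :=
  ⟨fun f g => ⟨f.lin - g.lin, by
    rw [LinearMap.comp_sub, f.comm, g.comm, LinearMap.rTensor_sub, LinearMap.sub_comp]⟩⟩

theorem sub_lin_apply {M N : RightComodule R C} (f g : M ⟶ N) (m : M.carrier) :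
    (f - g).lin m = f.lin m - g.lin m := rfl

theorem comp_sub {M N P : RightComodule R C} (f : M ⟶ N) (g g' : N ⟶ P) :
    f ≫ (g - g') = f ≫ g - f ≫ g' := rfl

theorem sub_comp {M N P : RightComodule R C} (f f' : M ⟶ N) (g : N ⟶ P) :
    (f - f') ≫ g = f ≫ g - f' ≫ g :=
  hom_ext (LinearMap.comp_sub _ _ _)

theorem tensorMap_sub {V W : Type u} [AddCommGroup V] [Module R V] [AddCommGroup W] [Module R W]
    (f g : V →ₗ[R] W) (M : RightComodule R C) :
    tensorMap (f - g) M = tensorMap f M - tensorMap g M :=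
  hom_ext (LinearMap.rTensor_sub f g)

end RightComodule

theorem exists_injective_moduleCat_embedding (R : Type u) [CommRing R] (Q : Type u) [AddCommGroup Q]
    [Module R Q] : ∃ (V : ModuleCat.{u} R) (j : Q →ₗ[R] V),
      Injective V ∧ Function.Injective j :=
  ⟨Injective.under (ModuleCat.of R Q), (Injective.ι (ModuleCat.of R Q)).hom, inferInstance,
    (ModuleCat.mono_iff_injective _).1 inferInstance⟩

namespace RightComodule

variable {R : Type u} [CommRing R] {C : Type u} [AddCommGroup C] [Module R C] [Coalgebra R C]
  {X : RightComodule R C}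
  {M₁ M₂ M₃ : RightComodule R C} {H₁ H₂ H₃ : Type u} [AddCommGroup H₁] [Module R H₁]
  [AddCommGroup H₂] [Module R H₂] [AddCommGroup H₃] [Module R H₃]
  {η₁ : M₁ ⟶ tensor H₁ X} {η₂ : M₂ ⟶ tensor H₂ X} {η₃ : M₃ ⟶ tensor H₃ X}

/-- The cohom functor of an injector preserves injective maps. -/
theorem IsInjector.injective (hX : X.IsInjector) (h₁ : IsCohom η₁) (h₂ : IsCohom η₂)
    {i : M₁ ⟶ M₂} (hi : Function.Injective i.lin) {a : H₁ →ₗ[R] H₂}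
    (ha : η₁ ≫ tensorMap a X = i ≫ η₂) : Function.Injective a := by
  -- With `H₁` embedded in an injective module `V`, the comodule `V ⊗ X` is injective, so the arrow
  -- `M₁ → V ⊗ X` given by `j` extends to `M₂`. The extension corresponds to a map `H₂ → V` whose
  -- composite with `a` is the injection `j`.
  obtain ⟨V, j, hV, hj⟩ := exists_injective_moduleCat_embedding R H₁
  have : Injective (tensor V X) := hX V hV
  have : Mono i := mono_of_injective i hi
  have hg : h₂.desc (Injective.factorThru (η₁ ≫ tensorMap j X) i) ∘ₗ a = j := h₁.ext (by
    rw [tensorMap_comp, ← Category.assoc, ha, Category.assoc, h₂.fac, Injective.comp_factorThru])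
  refine Function.Injective.of_comp (f := h₂.desc (Injective.factorThru (η₁ ≫ tensorMap j X) i)) ?_
  rw [← LinearMap.coe_comp, hg]
  exact hj

variable [Module.Flat R C]

/-- The cohom functor of an injector is exact. -/
theorem IsInjector.exact (hX : X.IsInjector) (h₁ : IsCohom η₁) (h₂ : IsCohom η₂) (h₃ : IsCohom η₃)
    {i : M₁ ⟶ M₂} {f : M₂ ⟶ M₃} (hif : Function.Exact i.lin f.lin) {a : H₁ →ₗ[R] H₂}
    (ha : η₁ ≫ tensorMap a X = i ≫ η₂) {b : H₂ →ₗ[R] H₃} (hb : η₂ ≫ tensorMap b X = f ≫ η₃) :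
    Function.Exact a b := by
  have hif0 : i ≫ f = 0 := hom_ext (LinearMap.ext fun x => hif.apply_apply_eq_zero x)
  have hba : b ∘ₗ a = 0 := h₁.ext (by
    rw [tensorMap_comp, ← Category.assoc, ha, Category.assoc, hb, ← Category.assoc, hif0,
      zero_comp, tensorMap_zero, comp_zero])
  intro x
  refine ⟨fun hx => ?_, ?_⟩
  -- Test exactness with a map `φ` from `H₂` to an injective module whose kernel is the range of
  -- `a`. Its arrow `M₂ → V ⊗ X` kills the image of `i`, hence the kernel of `f`, and so extends
  -- over `f`. Therefore `φ` factors through `b` and kills `x`.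
  · obtain ⟨V, j, hV, hj⟩ := exists_injective_moduleCat_embedding R (H₂ ⧸ LinearMap.range a)
    let φ : H₂ →ₗ[R] V := j ∘ₗ (LinearMap.range a).mkQ
    have hφ : φ ∘ₗ a = 0 := by
      rw [LinearMap.comp_assoc, LinearMap.range_mkQ_comp, LinearMap.comp_zero]
    have : Injective (tensor V X) := hX V hV
    obtain ⟨ψ, hψ⟩ := exists_extension f (η₂ ≫ tensorMap φ X) (fun y hy => by
      obtain ⟨z, rfl⟩ := (hif y).1 hy
      have h : i ≫ η₂ ≫ tensorMap φ X = 0 := by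
        rw [← Category.assoc, ← ha, Category.assoc, ← tensorMap_comp, hφ, tensorMap_zero,
          comp_zero]
      exact LinearMap.congr_fun (congrArg Hom.lin h) z)
    have hg : h₃.desc ψ ∘ₗ b = φ := h₂.ext (by
      rw [tensorMap_comp, ← Category.assoc, hb, Category.assoc, h₃.fac, hψ])
    have hx' : φ x = 0 := by
      rw [← hg, LinearMap.comp_apply, hx, map_zero]
    exact (Submodule.Quotient.mk_eq_zero _).1 (hj (hx'.trans (map_zero j).symm))
  · rintro ⟨y, rfl⟩
    exact LinearMap.congr_fun hba y

end RightComodule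

/-! ### The functor `- □ X` when the left coaction is universal -/

namespace Bicomodule

open RightComodule

variable {R : Type u} [CommRing R] {C : Type u} [AddCommGroup C] [Module R C] [Coalgebra R C]
  {D : Type u} [AddCommGroup D] [Module R D] [Coalgebra R D]
  {X : Bicomodule R C D}

/-- The `C`-coaction on the cohom of a comodule. -/
theorem exists_coaction {M : RightComodule R D} {H : Type u} [AddCommGroup H] [Module R H]
    {η : M ⟶ tensor H X.toRight} (hη : IsCohom η) :
    ∃ ρ : H →ₗ[R] H ⊗[R] C,
      η ≫ tensorMap ρ X.toRight = η ≫ extend H X.lcoactHom ∧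
      (TensorProduct.assoc R H C C).toLinearMap ∘ₗ ρ.rTensor C ∘ₗ ρ =
        Coalgebra.comul.lTensor H ∘ₗ ρ ∧
      (Coalgebra.counit (R := R) (A := C)).lTensor H ∘ₗ ρ = (TensorProduct.mk R H R).flip 1 := by
  -- The coaction is the map induced on cohoms by `M → H ⊗ X → (H ⊗ C) ⊗ X`. The comodule axioms are
  -- checked after `η`, where they become those of the left coaction of `X`.
  let ρ := hη.desc (η ≫ extend H X.lcoactHom)
  have hρ : η ≫ tensorMap ρ X.toRight = η ≫ extend H X.lcoactHom := hη.fac _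
  refine ⟨ρ, hρ, hη.ext ?_, ?_⟩
  · rw [tensorMap_comp, tensorMap_comp, tensorMap_comp, ← Category.assoc, ← Category.assoc,
      ← Category.assoc, hρ, Category.assoc, Category.assoc, Category.assoc,
      ← extend_lcoactHom_coassoc, ← Category.assoc (extend H _), ← tensorMap_extend,
      ← Category.assoc η, ← Category.assoc η, hρ]
    simp only [Category.assoc]
  · have h : counitRight R C H ∘ₗ ρ = LinearMap.id := hη.ext (by
      rw [tensorMap_comp, ← Category.assoc, hρ, Category.assoc, extend_lcoactHom_counit,
        tensorMap_id])
    refine LinearMap.ext fun x => (TensorProduct.rid R H).injective ?_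
    simpa [counitRight] using LinearMap.congr_fun h x

variable [Module.Flat R D]

/-- For a quasi-finite injector `X` with coendomorphism coalgebra `C`, the cohom of `N □ X`
is `N`. -/
theorem isCohom_incl (hq : X.toRight.QuasiFinite) (hi : X.toRight.IsInjector)
    (hl : IsCohom X.lcoactHom) (N : RightComodule R C) : IsCohom (X.incl N) := by
  obtain ⟨H, _, _, η, hη⟩ := isCohom_unit X.toRight (X.cotensorRight.obj N)
  -- `N □ X` is the equalizer of `p` and `q`. The arrow `q` has two roles: it is also the universal
  -- arrow of `N ⊗ X`, with cohom `N ⊗ C`.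
  let p := tensorMap N.coact X.toRight
  let q := extend N.carrier X.lcoactHom
  have hex : Function.Exact (X.incl N).lin (p - q).lin := fun z => by
    rw [sub_lin_apply, sub_eq_zero]
    exact (X.mem_cotensor_iff N z).symm.trans (exists_incl_eq_iff z).symm
  have hN := hl.extend N.carrier
  have hNC := hl.extend (N.carrier ⊗[R] C)
  -- The map which `p - q` induces on cohoms, `ϱ ⊗ C - N ⊗ Δ`.
  let b : N.carrier ⊗[R] C →ₗ[R] (N.carrier ⊗[R] C) ⊗[R] C := N.coact.rTensor C -
    (TensorProduct.assoc R N.carrier C C).symm.toLinearMap ∘ₗ Coalgebra.comul.lTensor N.carrier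
  have hb : q ≫ tensorMap b X.toRight = (p - q) ≫ extend (N.carrier ⊗[R] C) X.lcoactHom := by
    rw [tensorMap_sub, comp_sub, sub_comp, tensorMap_extend, tensorMap_comp,
      ← Category.assoc, ← extend_lcoactHom_coassoc, Category.assoc, Category.assoc,
      ← tensorMap_comp]
    have : (TensorProduct.assoc R N.carrier C C).symm.toLinearMap ∘ₗ
      (TensorProduct.assoc R N.carrier C C).toLinearMap = LinearMap.id :=
        LinearMap.ext fun x => (TensorProduct.assoc R N.carrier C C).symm_apply_apply x
    rw [this, tensorMap_id, Category.comp_id]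
  let a := hη.desc (X.incl N ≫ q)
  have ha : η ≫ tensorMap a X.toRight = X.incl N ≫ q := hη.fac _
  have hex' : Function.Exact a b := hi.exact hη hN hNC hex ha hb
  have hinj : Function.Injective a := hi.injective hη hN (X.incl_injective N) ha
  let e := hη.desc (X.incl N)
  -- The map `a` induced by the inclusion of `N □ X` is the comparison map `e : H → N` followed by
  -- the coaction of `N`. Bijectivity of `e` is thereby reduced to exactness of `0 → H → N ⊗ C → N ⊗
  -- C ⊗ C`.
  have he : N.coact ∘ₗ e = a := hη.ext (by
    rw [tensorMap_comp, ← Category.assoc, hη.fac, ha, X.incl_condition])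
  refine hη.of_bijective (e := e) ⟨?_, fun n => ?_⟩ (hη.fac _)
  · refine Function.Injective.of_comp (f := N.coact) ?_
    rw [← LinearMap.coe_comp, he]
    exact hinj
  -- Coassociativity puts the coaction of `n` in the kernel of `b`, hence in the image of `a`;
  -- injectivity of the coaction then gives a preimage of `n` itself.
  · have hn : b (N.coact n) = 0 := by
      have h := LinearMap.congr_fun N.coassoc n
      simp only [LinearMap.comp_apply, LinearEquiv.coe_coe] at h
      change N.coact.rTensor C (N.coact n) - (TensorProduct.assoc R N.carrier C C).symm
        (Coalgebra.comul.lTensor N.carrier (N.coact n)) = 0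
      rw [← h, LinearEquiv.symm_apply_apply, sub_self]
    obtain ⟨y, hy⟩ := (hex' _).1 hn
    refine ⟨y, N.coact_injective ?_⟩
    rw [← hy, ← he]
    rfl

/-- The cotensor functor is fully faithful if all inclusions `N □ X → N ⊗ X` are universal. -/
theorem cotensorRight_full (h : ∀ N : RightComodule R C, IsCohom (X.incl N)) :
    X.cotensorRight.Full where
  map_surjective {N N'} f := by
    refine ⟨⟨(h N).desc (f ≫ X.incl N'), ?_⟩, ?_⟩
    · exact colinear_of_isCohom (h N) (X.incl_condition N) _ f ((h N).fac _).symm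
    · rw [← cancel_mono (X.incl N'), map_incl]
      exact (h N).fac _

theorem cotensorRight_faithful (h : ∀ N : RightComodule R C, IsCohom (X.incl N)) :
    X.cotensorRight.Faithful where
  map_injective {N N'} f g hfg := hom_ext ((h N).ext (by
    rw [← map_incl, ← map_incl, hfg]))

/-- The preimage of `M` is its cohom `H` with the induced `C`-coaction, and `w : M → H □ X` is the
corestriction of the universal arrow, so it inherits injectivity. For surjectivity, apply cohom to
the projection onto the cokernel of `w`: the resulting map from `H` vanishes, although the universal
arrow of the cokernel is injective. -/
theorem cotensorRight_essSurj (h : ∀ N : RightComodule R C, IsCohom (X.incl N))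
    (hq : X.toRight.QuasiFinite)
    (hinj : ∀ (M : RightComodule R D) (H : Type u) [AddCommGroup H] [Module R H]
      (η : M ⟶ tensor H X.toRight), IsCohom η → Function.Injective η.lin) :
    X.cotensorRight.EssSurj where
  mem_essImage M := by
    obtain ⟨H, _, _, η, hη⟩ := isCohom_unit X.toRight M
    obtain ⟨ρ, hρ, hco, hcu⟩ := exists_coaction hη
    let N : RightComodule R C := ⟨H, ρ, hco, hcu⟩
    let w : M ⟶ X.cotensorRight.obj N := inclLift (N := N) η hρ
    have hw : w ≫ X.incl N = η := inclLift_incl (N := N) η hρ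
    obtain ⟨Q, _, _, θ, hθ⟩ := isCohom_unit X.toRight (coker w)
    let b : H →ₗ[R] Q := (h N).desc (cokerHom w ≫ θ)
    have hb : X.incl N ≫ tensorMap b X.toRight = cokerHom w ≫ θ := (h N).fac _
    -- The universal arrow `η` of `M` is `w` followed by the inclusion of `H □ X`, so `b` is
    -- determined by what happens after `w`, and there the projection to the cokernel is zero.
    have hb0 : b = 0 := hη.ext (by
      rw [tensorMap_zero, comp_zero]
      refine (congrArg (· ≫ _) hw.symm).trans ?_
      rw [Category.assoc, hb, ← Category.assoc, comp_cokerHom, zero_comp])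
    have hc : cokerHom w = 0 := by
      have : Mono θ := mono_of_injective θ (hinj _ _ _ hθ)
      rw [← cancel_mono θ, zero_comp, ← hb, hb0, tensorMap_zero, comp_zero]
    refine ⟨N, ⟨(isoOfBijective w ⟨?_, surjective_of_cokerHom_eq_zero w hc⟩).symm⟩⟩
    refine Function.Injective.of_comp (f := (X.incl N).lin) ?_
    have h1 := hinj M H η hη
    rw [← hw] at h1
    exact h1

end Bicomodule

/-! ### Left comodules, and cotensor products with cofree comodules -/

namespace LeftComodule

variable {R : Type u} [CommRing R] {C : Type u} [AddCommGroup C] [Module R C] [Coalgebra R C]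

theorem comm_apply {M N : LeftComodule R C} (f : M ⟶ N) (m : M.carrier) :
    N.coact (f.lin m) = f.lin.lTensor C (M.coact m) :=
  LinearMap.congr_fun f.comm m

instance (M N : LeftComodule R C) : Zero (M ⟶ N) :=
  ⟨⟨0, by simp⟩⟩

theorem zero_comp {N P : LeftComodule R C} (M : LeftComodule R C) (f : N ⟶ P) :
    (0 : M ⟶ N) ≫ f = 0 :=
  hom_ext (LinearMap.comp_zero f.lin)

variable (R C) in
/-- The coalgebra as a left comodule over itself. -/
def self : LeftComodule R C where
  carrier := C
  coact := Coalgebra.comul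
  coassoc := Coalgebra.coassoc
  counit := Coalgebra.rTensor_counit_comp_comul

section Flat

variable [Module.Flat R C]

/-- The inclusion of a subcomodule. -/
def subHom (M : LeftComodule R C) (S : Submodule R M.carrier)
    (hS : ∀ x ∈ S, M.coact x ∈ LinearMap.range (S.subtype.lTensor C)) : M.sub S hS ⟶ M where
  lin := S.subtype
  comm := (M.sub_coact S hS).symm

theorem coact_mem_ker {M N : LeftComodule R C} (f : M ⟶ N) :
    ∀ x ∈ LinearMap.ker f.lin,
      M.coact x ∈ LinearMap.range ((LinearMap.ker f.lin).subtype.lTensor C) := by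
  intro x hx
  refine (Module.Flat.lTensor_exact C (LinearMap.exact_subtype_ker_map f.lin) _).1 ?_
  rw [← comm_apply, LinearMap.mem_ker.1 hx, map_zero]

theorem injective_of_mono {M N : LeftComodule R C} (f : M ⟶ N) [Mono f] :
    Function.Injective f.lin := by
  rw [← LinearMap.ker_eq_bot, LinearMap.ker_eq_bot']
  intro x hx
  have h : M.subHom _ (coact_mem_ker f) = 0 := by
    rw [← cancel_mono f, zero_comp]
    exact hom_ext (LinearMap.ext fun y => y.2)
  exact LinearMap.congr_fun (congrArg Hom.lin h) ⟨x, hx⟩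

end Flat

end LeftComodule

section Cofree

variable {R : Type u} [CommRing R] {C : Type u} [AddCommGroup C] [Module R C] [Coalgebra R C]

/-- The canonical map `C ⊗ V → V` induced by the counit. -/
def counitLeft (R : Type u) [CommRing R] (C : Type u) [AddCommGroup C] [Module R C]
    [Coalgebra R C] (V : Type u) [AddCommGroup V] [Module R V] : C ⊗[R] V →ₗ[R] V :=
  (TensorProduct.lid R V).toLinearMap ∘ₗ (Coalgebra.counit (R := R) (A := C)).rTensor V

@[simp] theorem counitLeft_tmul (V : Type u) [AddCommGroup V] [Module R V] (v : V) (c : C) :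
    counitLeft R C V (c ⊗ₜ v) = Coalgebra.counit (R := R) c • v := by
  simp [counitLeft]

theorem LeftComodule.counitLeft_coact (M : LeftComodule R C) (m : M.carrier) :
    counitLeft R C M.carrier (M.coact m) = m := by
  have h := LinearMap.congr_fun M.counit m
  simp only [LinearMap.comp_apply] at h
  simp [counitLeft, h]

theorem counitLeft_lTensor {V W : Type u} [AddCommGroup V] [Module R V] [AddCommGroup W]
    [Module R W] (f : V →ₗ[R] W) (z : C ⊗[R] V) :
    counitLeft R C W (f.lTensor C z) = f (counitLeft R C V z) := by
  induction z <;> simp_all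

variable (M : RightComodule R C) (V : Type u) [AddCommGroup V] [Module R V]

/-- The canonical map `M ⊗ V → M ⊗ (C ⊗ V)`, with image `M □ (C ⊗ V)`. -/
def toCofree : M.carrier ⊗[R] V →ₗ[R] M.carrier ⊗[R] (C ⊗[R] V) :=
  (TensorProduct.assoc R M.carrier C V).toLinearMap ∘ₗ M.coact.rTensor V

theorem toCofree_tmul (m : M.carrier) (v : V) :
    toCofree M V (m ⊗ₜ v) = TensorProduct.assoc R M.carrier C V (M.coact m ⊗ₜ v) := rfl

theorem toCofree_mem (z : M.carrier ⊗[R] V) :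
    toCofree M V z ∈ cotensor M (LeftComodule.tensor (LeftComodule.self R C) V) := by
  suffices key : (TensorProduct.assoc R M.carrier C (C ⊗[R] V)) (M.coact.rTensor (C ⊗[R] V)
      (toCofree M V z)) = ((TensorProduct.assoc R C C V).toLinearMap ∘ₗ
        (Coalgebra.comul (R := R) (A := C)).rTensor V).lTensor M.carrier (toCofree M V z) by
    have h := sub_eq_zero.2 key
    exact h
  induction z with
  | zero => simp
  | add a b ha hb => simp only [map_add, ha, hb]
  | tmul m v =>
    have h := LinearMap.congr_fun M.coassoc m
    simp only [LinearMap.comp_apply, LinearEquiv.coe_coe] at h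
    rw [toCofree_tmul]
    trans (TensorProduct.assoc R C C V).toLinearMap.lTensor M.carrier
      (TensorProduct.assoc R M.carrier (C ⊗[R] C) V
        (Coalgebra.comul.lTensor M.carrier (M.coact m) ⊗ₜ v))
    · rw [← h]
      generalize M.coact m = y
      induction y with
      | zero => simp
      | add a b ha hb => simp only [add_tmul, map_add, ha, hb]
      | tmul m c =>
        simp only [LinearMap.rTensor_tmul, TensorProduct.assoc_tmul]
        generalize M.coact m = z
        induction z <;> simp_all [tmul_add, add_tmul]
    · generalize M.coact m = y
      induction y <;> simp_all [tmul_add, add_tmul]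

theorem counit_toCofree (z : M.carrier ⊗[R] V) :
    (counitLeft R C V).lTensor M.carrier (toCofree M V z) = z := by
  induction z with
  | zero => simp
  | add a b ha hb => simp only [map_add, ha, hb]
  | tmul m v =>
    trans counitRight R C M.carrier (M.coact m) ⊗ₜ v
    · rw [toCofree_tmul]
      generalize M.coact m = y
      induction y with
      | zero => simp
      | add a b ha hb => simp only [add_tmul, map_add, ha, hb]
      | tmul m c => simp [smul_tmul]
    · rw [M.counitRight_coact]

theorem toCofree_injective : Function.Injective (toCofree M V) :=
  Function.LeftInverse.injective (counit_toCofree M V)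

/-- Apply the counit to the last factor `C` in the cotensor condition `(ϱ ⊗ id) y = (M ⊗ Δ ⊗ V) y`:
the right side becomes `y`, the left side an element of the image. Together with `toCofree_mem` and
`counit_toCofree` this gives `M □ (C ⊗ V) ≅ M ⊗ V`. -/
theorem toCofree_counit (y : M.carrier ⊗[R] (C ⊗[R] V))
    (hy : y ∈ cotensor M (LeftComodule.tensor (LeftComodule.self R C) V)) :
    toCofree M V ((counitLeft R C V).lTensor M.carrier y) = y := by
  have h : (TensorProduct.assoc R M.carrier C (C ⊗[R] V)) (M.coact.rTensor (C ⊗[R] V) y) =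
      ((TensorProduct.assoc R C C V).toLinearMap ∘ₗ
      (Coalgebra.comul (R := R) (A := C)).rTensor V).lTensor M.carrier y := by
    refine sub_eq_zero.1 ?_
    exact hy
  have h' := congrArg (((counitLeft R C V).lTensor C).lTensor M.carrier) h
  clear h hy
  refine Eq.trans ?_ (h'.trans ?_)
  · clear h'
    induction y with
    | zero => simp
    | add a b ha hb => simp only [map_add, ha, hb]
    | tmul m z =>
      rw [LinearMap.lTensor_tmul, toCofree_tmul, LinearMap.rTensor_tmul]
      generalize M.coact m = y
      induction y <;> simp_all [tmul_add, add_tmul]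
  · clear h'
    induction y with
    | zero => simp
    | add a b ha hb => simp only [map_add, ha, hb]
    | tmul m z =>
      simp only [LinearMap.lTensor_tmul, LinearMap.comp_apply, LinearEquiv.coe_coe]
      congr 1
      induction z with
      | zero => simp
      | add a b ha hb => simp only [map_add, ha, hb]
      | tmul c v =>
        trans (TensorProduct.rid R C ((Coalgebra.counit (R := R) (A := C)).lTensor C
          (Coalgebra.comul c))) ⊗ₜ v
        · rw [LinearMap.rTensor_tmul]
          generalize Coalgebra.comul (R := R) c = z
          induction z with
          | zero => simp
          | add a b ha hb => simp only [add_tmul, map_add, ha, hb]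
          | tmul a b => simp [smul_tmul]
        · simp

variable {V} in
theorem toCofree_naturality {W : Type u} [AddCommGroup W] [Module R W] (f : V →ₗ[R] W)
    (z : M.carrier ⊗[R] V) :
    (f.lTensor C).lTensor M.carrier (toCofree M V z) = toCofree M W (f.lTensor M.carrier z) := by
  induction z with
  | zero => simp
  | add a b ha hb => simp only [map_add, ha, hb]
  | tmul m v =>
    rw [LinearMap.lTensor_tmul, toCofree_tmul, toCofree_tmul]
    generalize M.coact m = y
    induction y <;> simp_all [tmul_add, add_tmul]

/-- A coflat comodule over a flat coalgebra is flat. -/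
theorem RightComodule.Coflat.flat [Module.Flat R C] {M : RightComodule R C} (hM : M.Coflat) :
    Module.Flat R M.carrier := by
  refine Module.Flat.iff_lTensor_preserves_injective_linearMap.2 fun V W _ _ _ _ f hf => ?_
  -- Coflatness is applied to `C ⊗ V → C ⊗ W → C ⊗ (W / f V)`, which is short exact because `C` is
  -- flat. Under the embeddings `toCofree` the map `M □ (C ⊗ f)` corresponds to `M ⊗ f`.
  have h := (hM (LeftComodule.tensorMap (LeftComodule.self R C) f)
    (LeftComodule.tensorMap (LeftComodule.self R C) (LinearMap.range f).mkQ)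
    (Module.Flat.lTensor_preserves_injective_linearMap (M := C) f hf)
    (lTensor_exact C (LinearMap.exact_map_mkQ_range f) (Submodule.mkQ_surjective _))
    (LinearMap.lTensor_surjective C (Submodule.mkQ_surjective _))).1
  intro x y hxy
  have h' := @h ⟨toCofree M V x, toCofree_mem M V x⟩ ⟨toCofree M V y, toCofree_mem M V y⟩
    (Subtype.ext (by
      change (f.lTensor C).lTensor M.carrier (toCofree M V x) =
        (f.lTensor C).lTensor M.carrier (toCofree M V y)
      rw [toCofree_naturality, toCofree_naturality, hxy]))
  exact toCofree_injective M V (congrArg Subtype.val h')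

end Cofree

/-! ### Injectivity of universal arrows for a faithfully coflat injector -/

namespace Bicomodule

open RightComodule

variable {R : Type u} [CommRing R] {C : Type u} [AddCommGroup C] [Module R C] [Coalgebra R C]
  {D : Type u} [AddCommGroup D] [Module R D] [Coalgebra R D]
  {X : Bicomodule R C D}

theorem lcoact_rTensor_injective (X : Bicomodule R C D) (W : Type u) [AddCommGroup W]
    [Module R W] : Function.Injective (X.lcoact.rTensor W) := by
  refine Function.LeftInverse.injective (g := (counitLeft R C X.carrier).rTensor W) fun z => ?_
  have h : counitLeft R C X.carrier ∘ₗ X.lcoact = LinearMap.id :=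
    LinearMap.ext fun x => X.toLeft.counitLeft_coact x
  rw [← LinearMap.rTensor_comp_apply, h, LinearMap.rTensor_id, LinearMap.id_apply]

theorem _root_.LinearMap.rTensor_rTensor_injective {A B : Type u} [AddCommGroup A] [Module R A]
    [AddCommGroup B] [Module R B] (f : A →ₗ[R] B)
    (hf : ∀ (W : Type u) [AddCommGroup W] [Module R W], Function.Injective (f.lTensor W))
    (V W : Type u) [AddCommGroup V] [Module R V] [AddCommGroup W] [Module R W] :
    Function.Injective ((f.rTensor V).rTensor W) := by
  have h := (f.lTensor_inj_iff_rTensor_inj _).1 (hf (V ⊗[R] W))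
  rw [LinearMap.rTensor_tensor] at h
  intro x y hxy
  have h' := @h (TensorProduct.assoc R A V W x) (TensorProduct.assoc R A V W y) (by simp [hxy])
  simpa using h'

/-- If `(c ⊗ X) l = (B ⊗ u) ρ`, then the same holds after tensoring with `W`. -/
theorem _root_.TensorProduct.rTensor_fac {A B D E X Y : Type u} [AddCommGroup A] [Module R A]
    [AddCommGroup B] [Module R B] [AddCommGroup D] [Module R D] [AddCommGroup E] [Module R E]
    [AddCommGroup X] [Module R X] [AddCommGroup Y] [Module R Y]
    {ρ : A →ₗ[R] B ⊗[R] D} {u : D →ₗ[R] Y ⊗[R] X} {l : A →ₗ[R] E ⊗[R] X} {c : E →ₗ[R] B ⊗[R] Y}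
    (h : ∀ a, c.rTensor X (l a) = (TensorProduct.assoc R B Y X).symm (u.lTensor B (ρ a)))
    (W : Type u) [AddCommGroup W] [Module R W] (z : A ⊗[R] W) :
    (u.rTensor W).lTensor B (TensorProduct.assoc R B D W (ρ.rTensor W z)) =
      TensorProduct.assoc R B (Y ⊗[R] X) W ((TensorProduct.assoc R B Y X).toLinearMap.rTensor W
        ((c.rTensor X).rTensor W (l.rTensor W z))) := by
  induction z with
  | zero => simp
  | add a b ha hb => simp only [map_add, ha, hb]
  | tmul a w =>
    simp only [LinearMap.rTensor_tmul, LinearEquiv.coe_coe, h, LinearEquiv.apply_symm_apply]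
    generalize ρ a = z
    induction z <;> simp_all [tmul_add, add_tmul]

variable {Y : Type u} [AddCommGroup Y] [Module R Y]

/-- If `u : D → Y ⊗ X` is universal, then the map `c : C → X ⊗ Y` which corresponds to
`X → X ⊗ D → X ⊗ Y ⊗ X` is universally injective. -/
theorem lTensor_injective_of_fac (hi : X.toRight.IsInjector) (hl : IsCohom X.lcoactHom)
    {u : RightComodule.self R D ⟶ tensor Y X.toRight} (hu : IsCohom u)
    {c : C →ₗ[R] X.toRight.carrier ⊗[R] Y}
    (hc : X.lcoactHom ≫ tensorMap c X.toRight = X.toRight.coactHom ≫ extend X.toRight.carrier u)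
    (W : Type u) [AddCommGroup W] [Module R W] : Function.Injective (c.lTensor W) := by
  -- `W ⊗ c` is what the cohom functor makes of `W ⊗ X → W ⊗ (X ⊗ D)`, an injective map split by the
  -- counit of `D`.
  refine hi.injective (hl.extend W) ((hu.extend X.toRight.carrier).extend W)
    (i := tensorMapRight W X.toRight.coactHom) ?_ ?_
  · refine Function.LeftInverse.injective (g := (counitRight R D X.carrier).lTensor W) fun z => ?_
    have h : counitRight R D X.carrier ∘ₗ X.rcoact = LinearMap.id :=
      LinearMap.ext fun x => X.toRight.counitRight_coact x
    change (counitRight R D X.carrier).lTensor W (X.rcoact.lTensor W z) = z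
    refine (LinearMap.lTensor_comp_apply W (counitRight R D X.carrier) X.rcoact z).symm.trans ?_
    rw [h]
    exact LinearMap.congr_fun (LinearMap.lTensor_id W X.carrier) z
  · rw [← extend_comp_tensorMap, hc, extend_comp]

/-- The kernel of `u ⊗ W : D ⊗ W → Y ⊗ X ⊗ W`, as a subcomodule of the left comodule `D ⊗ W`. -/
theorem coact_mem_ker_rTensor [Module.Flat R D]
    {u : RightComodule.self R D ⟶ tensor Y X.toRight} (hu : IsCohom u)
    (W : Type u) [AddCommGroup W] [Module R W] (ul : D →ₗ[R] Y ⊗[R] X.carrier) (hul : ul = u.lin) :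
    ∀ x ∈ LinearMap.ker (ul.rTensor W),
      (TensorProduct.assoc R D D W) ((Coalgebra.comul (R := R) (A := D)).rTensor W x) ∈
        LinearMap.range ((LinearMap.ker (ul.rTensor W)).subtype.lTensor D) := by
  intro x hx
  -- `lam : Y → D ⊗ Y` satisfies `(lam ⊗ X) u = (D ⊗ u) Δ`. Thus `D ⊗ u ⊗ W` kills `(Δ ⊗ W) x` as
  -- soon as `u ⊗ W` kills `x`, and flatness of `D` places the result in `D ⊗ K`.
  let lam := hu.desc (V := (RightComodule.self R D).carrier ⊗[R] Y)
    ((RightComodule.self R D).coactHom ≫ extend (RightComodule.self R D).carrier u)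
  have hlam (d : D) : (show Y →ₗ[R] D ⊗[R] Y from lam).rTensor X.carrier (ul d) =
      (TensorProduct.assoc R D Y X.carrier).symm (ul.lTensor D (Coalgebra.comul d)) := by
    subst hul
    exact LinearMap.congr_fun (congrArg Hom.lin (hu.fac
      (V := (RightComodule.self R D).carrier ⊗[R] Y)
      ((RightComodule.self R D).coactHom ≫ extend (RightComodule.self R D).carrier u))) d
  refine (Module.Flat.lTensor_exact D (LinearMap.exact_subtype_ker_map _) _).1 ?_
  refine (TensorProduct.rTensor_fac hlam W x).trans ?_
  rw [LinearMap.mem_ker.1 hx, map_zero, map_zero, map_zero]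

/-- On `X ⊗ W ≅ X □ (D ⊗ W)` the map `X ⊗ u ⊗ W` becomes `(c ⊗ X ⊗ W)` after the left coaction of
`X`. The first of these is injective because `c` is universally injective, the second because it is
split by the counit of `C`. -/
theorem eq_zero_of_mem_cotensor (hi : X.toRight.IsInjector) (hl : IsCohom X.lcoactHom)
    {u : RightComodule.self R D ⟶ tensor Y X.toRight} (hu : IsCohom u)
    (W : Type u) [AddCommGroup W] [Module R W] (ul : D →ₗ[R] Y ⊗[R] X.carrier) (hul : ul = u.lin)
    (z : X.carrier ⊗[R] W) (hz : (ul.rTensor W).lTensor X.carrier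
      ((TensorProduct.assoc R X.carrier D W) (X.rcoact.rTensor W z)) = 0) : z = 0 := by
  let c' := hl.desc (V := X.toRight.carrier ⊗[R] Y)
    (X.toRight.coactHom ≫ extend X.toRight.carrier u)
  let c : C →ₗ[R] X.carrier ⊗[R] Y := c'
  have hc : X.lcoactHom ≫ tensorMap c' X.toRight =
    X.toRight.coactHom ≫ extend X.toRight.carrier u := hl.fac _
  have hcx (x : X.carrier) : c.rTensor X.carrier (X.lcoact x) =
      (TensorProduct.assoc R X.carrier Y X.carrier).symm (ul.lTensor X.carrier (X.rcoact x)) := by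
    subst hul
    exact LinearMap.congr_fun (congrArg Hom.lin hc) x
  have hcinj (V : Type u) [AddCommGroup V] [Module R V] : Function.Injective (c.lTensor V) :=
    lTensor_injective_of_fac hi hl hu hc V
  have h1 := (TensorProduct.rTensor_fac hcx W z).symm.trans hz
  rw [LinearEquiv.map_eq_zero_iff] at h1
  have h2 : Function.Injective
      ((TensorProduct.assoc R X.carrier Y X.carrier).toLinearMap.rTensor W) :=
    (LinearEquiv.rTensor W (TensorProduct.assoc R X.carrier Y X.carrier)).injective
  rw [map_eq_zero_iff _ h2,
    map_eq_zero_iff _ (LinearMap.rTensor_rTensor_injective c hcinj X.carrier W),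
    map_eq_zero_iff _ (X.lcoact_rTensor_injective W)] at h1
  exact h1

/-- For a faithfully coflat quasi-finite injector with coendomorphism coalgebra `C`, the universal
arrow `D → Y ⊗ X` is universally injective. -/
theorem rTensor_injective_of_isCohom_self [Module.Flat R D] (hi : X.toRight.IsInjector)
    (hl : IsCohom X.lcoactHom) (hfc : X.toRight.FaithfullyCoflat)
    {u : RightComodule.self R D ⟶ tensor Y X.toRight} (hu : IsCohom u)
    (W : Type u) [AddCommGroup W] [Module R W] (ul : D →ₗ[R] Y ⊗[R] X.carrier) (hul : ul = u.lin) :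
    Function.Injective (ul.rTensor W) := by
  have : Module.Flat R X.carrier := hfc.1.flat
  -- `K` is a left subcomodule of the cofree comodule `D ⊗ W`. The plan is to prove `X □ K = 0` and
  -- to conclude `K = 0` from faithfulness.
  let K : Submodule R (D ⊗[R] W) := LinearMap.ker (ul.rTensor W)
  let P := LeftComodule.tensor (LeftComodule.self R D) W
  let PK := P.sub K (coact_mem_ker_rTensor hu W ul hul)
  have hz (t : cotensor X.toRight PK) : t = 0 := by
    let t₀ : X.carrier ⊗[R] K := t.1
    let s : X.carrier ⊗[R] (D ⊗[R] W) := K.subtype.lTensor X.carrier t₀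
    have hs : s ∈ cotensor X.toRight P := (cotensorMapRight X.toRight (P.subHom K _) t).2
    -- An element of `X □ (D ⊗ W)` comes from the element of `X ⊗ W` obtained by applying the
    -- counit.
    let s' : X.carrier ⊗[R] W := (counitLeft R D W).lTensor X.carrier s
    have hs' : (TensorProduct.assoc R X.carrier D W) (X.rcoact.rTensor W s') = s :=
      toCofree_counit X.toRight W s hs
    have hfs : (ul.rTensor W).lTensor X.carrier s = 0 := by
      have h0 : (ul.rTensor W) ∘ₗ K.subtype = 0 := LinearMap.ext fun y => y.2
      change (ul.rTensor W).lTensor X.carrier (K.subtype.lTensor X.carrier t₀) = 0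
      rw [← LinearMap.lTensor_comp_apply, h0, LinearMap.lTensor_zero, LinearMap.zero_apply]
    have hs0 : s' = 0 := eq_zero_of_mem_cotensor hi hl hu W ul hul s' (by rw [hs', hfs])
    have ht0 : s = 0 := by
      rw [← hs', hs0, map_zero, map_zero]
    have ht : t₀ = 0 := Module.Flat.lTensor_preserves_injective_linearMap (M := X.carrier)
      K.subtype K.injective_subtype (ht0.trans (map_zero _).symm)
    exact Subtype.ext ht
  -- As `X □ K` has no nonzero element, `X □ -` sends the identity and the zero map of `K` to the
  -- same map.
  have hid : 𝟙 PK = 0 := by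
    have := hfc.2
    refine X.toRight.cotensorFunctor.map_injective (ModuleCat.hom_ext (LinearMap.ext fun t => ?_))
    exact (hz _).trans (hz _).symm
  refine LinearMap.ker_eq_bot.1 (LinearMap.ker_eq_bot'.2 fun x hx => ?_)
  exact congrArg Subtype.val (LinearMap.congr_fun (congrArg LeftComodule.Hom.lin hid) ⟨x, hx⟩)

/-- For a faithfully coflat quasi-finite injector with coendomorphism coalgebra `C`, all universal
arrows are injective. -/
theorem injective_of_isCohom [Module.Flat R D] (hq : X.toRight.QuasiFinite)
    (hi : X.toRight.IsInjector) (hl : IsCohom X.lcoactHom) (hfc : X.toRight.FaithfullyCoflat)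
    {M : RightComodule R D} {H : Type u} [AddCommGroup H] [Module R H]
    {η : M ⟶ tensor H X.toRight} (hη : IsCohom η) : Function.Injective η.lin := by
  obtain ⟨Y, _, _, u, hu⟩ := isCohom_unit X.toRight (RightComodule.self R D)
  have h1 := (LinearMap.lTensor_inj_iff_rTensor_inj M.carrier
    (show D →ₗ[R] Y ⊗[R] X.carrier from u.lin)).2
      (rTensor_injective_of_isCohom_self hi hl hfc hu M.carrier _ rfl)
  -- `M → M ⊗ D → (M ⊗ Y) ⊗ X` is injective, by the counit and the universal injectivity of `u`. It
  -- factors through `η` by universality.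
  have h2 : Function.Injective (M.coactHom ≫ extend M.carrier u).lin := by
    refine Function.Injective.comp (g := (extend M.carrier u).lin) ?_ M.coact_injective
    exact (TensorProduct.assoc R M.carrier Y X.carrier).symm.injective.comp h1
  rw [← hη.fac (M.coactHom ≫ extend M.carrier u)] at h2
  exact Function.Injective.of_comp h2

/-- A bicomodule which is a faithfully coflat quasi-finite injector over `D` with coendomorphism
coalgebra `C` is invertible. -/
theorem invertible_of_isCohom_lcoactHom [Module.Flat R D] (hq : X.toRight.QuasiFinite)
    (hfc : X.toRight.FaithfullyCoflat) (hi : X.toRight.IsInjector) (hl : IsCohom X.lcoactHom) :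
    X.Invertible :=
  have h := isCohom_incl hq hi hl
  { faithful := cotensorRight_faithful h
    full := cotensorRight_full h
    essSurj := cotensorRight_essSurj h hq fun _ _ _ _ _ hη => injective_of_isCohom hq hi hl hfc hη }

end Bicomodule

/-! ### Consequences of invertibility: universal inclusions and flatness -/

namespace RightComodule

variable {R : Type u} [CommRing R] {C : Type u} [AddCommGroup C] [Module R C] [Coalgebra R C]

theorem comp_coactHom {M N : RightComodule R C} {V : Type u} [AddCommGroup V] [Module R V]
    (g : M ⟶ tensor V N) {gl : M.carrier →ₗ[R] V ⊗[R] N.carrier} (hg : gl = g.lin) :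
    g ≫ tensorMapRight V N.coactHom ≫ tensorAssoc V N.carrier (self R C) =
      M.coactHom ≫ tensorMap gl (self R C) := by
  subst hg
  exact hom_ext g.comm

/-- Colinearity of `g`, carried through `η`: a coaction on the target of `g` is moved to its source.
The linear map `gl` is kept apart from `g.lin` so that its codomain is literally a tensor product.
-/
theorem comp_extend_coactHom {M N X : RightComodule R C} {V : Type u} [AddCommGroup V]
    [Module R V] {H : Type u} [AddCommGroup H] [Module R H] (g : M ⟶ tensor V N)
    {gl : M.carrier →ₗ[R] V ⊗[R] N.carrier} (hg : gl = g.lin) (η : self R C ⟶ tensor H X) :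
    g ≫ extend V (N.coactHom ≫ extend N.carrier η) ≫
        tensorMap (TensorProduct.assoc R V N.carrier H).symm.toLinearMap X =
      M.coactHom ≫ extend M.carrier η ≫ tensorMap (gl.rTensor H) X := by
  have h := (congrArg (· ≫ extend (V ⊗[R] N.carrier) η) (comp_coactHom g hg)).trans
    (Category.assoc _ _ _)
  rw [Category.assoc, Category.assoc, ← extend_extend] at h
  rw [extend_comp, Category.assoc, h, tensorMap_extend]

theorem counitRight_rTensor {V W : Type u} [AddCommGroup V] [Module R V] [AddCommGroup W]
    [Module R W] (f : V →ₗ[R] W) : counitRight R C W ∘ₗ f.rTensor C = f ∘ₗ counitRight R C V :=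
  TensorProduct.ext' fun v c => by simp

end RightComodule

namespace Bicomodule

open RightComodule

variable {R : Type u} [CommRing R] {C : Type u} [AddCommGroup C] [Module R C] [Coalgebra R C]
  {D : Type u} [AddCommGroup D] [Module R D] [Coalgebra R D]

/-- `V ⊗ Y` with a universal arrow `V ⊗ M → V ⊗ Y ⊗ X`. -/
theorem extend_condition {X : Bicomodule R C D} {M : RightComodule R D} {Y : RightComodule R C}
    {η : M ⟶ tensor Y.carrier X.toRight}
    (hη : η ≫ tensorMap Y.coact X.toRight = η ≫ extend Y.carrier X.lcoactHom) (V : Type u)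
    [AddCommGroup V] [Module R V] :
    extend V η ≫ tensorMap (tensor V Y).coact X.toRight =
      extend V η ≫ extend (V ⊗[R] Y.carrier) X.lcoactHom := by
  have h : extend V η ≫ tensorMap ((TensorProduct.assoc R V Y.carrier C).symm.toLinearMap ∘ₗ
      Y.coact.lTensor V) X.toRight = extend V η ≫ extend (V ⊗[R] Y.carrier) X.lcoactHom := by
    rw [tensorMap_comp, ← Category.assoc, ← extend_comp_tensorMap, hη, extend_comp, Category.assoc,
      extend_extend]
    conv_rhs => rw [extend, Category.assoc]
  exact h

/-- The map `V ⊗ C → V` induced by the counit, on the cofree comodule `V ⊗ C`. -/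
def cofreeCounit (R : Type u) [CommRing R] (C : Type u) [AddCommGroup C] [Module R C]
    [Coalgebra R C] (V : Type u) [AddCommGroup V] [Module R V] :
    (tensor V (RightComodule.self R C)).carrier →ₗ[R] V :=
  counitRight R C V

theorem cofreeCounit_comp_tensorMap {V W : Type u} [AddCommGroup V] [Module R V]
    [AddCommGroup W] [Module R W] (f : V →ₗ[R] W) :
    cofreeCounit R C W ∘ₗ (tensorMap f (RightComodule.self R C)).lin = f ∘ₗ cofreeCounit R C V :=
  counitRight_rTensor f

/-- The half of the adjunction between cofree comodules and the forgetful functor that is needed: a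
linear map `N → V` is recovered from its colinear extension `N → V ⊗ C`. -/
theorem cofreeCounit_comp_coactHom_tensorMap {V : Type u} [AddCommGroup V] [Module R V]
    {N : RightComodule R C} (g : N.carrier →ₗ[R] V) :
    cofreeCounit R C V ∘ₗ (N.coactHom ≫ tensorMap g (RightComodule.self R C)).lin = g := by
  refine LinearMap.ext fun n => ?_
  refine (LinearMap.congr_fun (counitRight_rTensor g) (N.coact n)).trans ?_
  exact congrArg g (N.counitRight_coact n)

/-- The map `(V ⊗ C) ⊗ C → V ⊗ C` induced by the counit, on the cofree comodule `V ⊗ C`. -/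
def cofreeCounitTensor (R : Type u) [CommRing R] (C : Type u) [AddCommGroup C] [Module R C]
    [Coalgebra R C] (V : Type u) [AddCommGroup V] [Module R V] :
    (tensor V (RightComodule.self R C)).carrier ⊗[R] C →ₗ[R]
      (tensor V (RightComodule.self R C)).carrier :=
  (cofreeCounit R C V).rTensor C

theorem cofreeCounitTensor_comp_coact (V : Type u) [AddCommGroup V] [Module R V] :
    cofreeCounitTensor R C V ∘ₗ (tensor V (RightComodule.self R C)).coact =
      LinearMap.id := by
  have h : (counitRight R C V).rTensor C ∘ₗ
      (TensorProduct.assoc R V C C).symm.toLinearMap ∘ₗ Coalgebra.comul.lTensor V =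
        LinearMap.id := by
    refine TensorProduct.ext' fun v c => ?_
    trans v ⊗ₜ (TensorProduct.lid R C) ((Coalgebra.counit (R := R) (A := C)).rTensor C
      (Coalgebra.comul c))
    · simp only [LinearMap.comp_apply, LinearMap.lTensor_tmul, LinearEquiv.coe_coe]
      generalize Coalgebra.comul (R := R) c = z
      induction z with
      | zero => simp
      | add a b ha hb => simp only [tmul_add, map_add, ha, hb]
      | tmul a b => simp [smul_tmul]
    · simp
  exact h

/-- The map `V ⊗ X → (V ⊗ C) ⊗ X` given by the coaction of `X`, for the cofree comodule `V ⊗ C`. -/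
def toTensorCofree (X : Bicomodule R C D) (V : Type u) [AddCommGroup V] [Module R V] :
    tensor V X.toRight ⟶ tensor (tensor V (RightComodule.self R C)).carrier X.toRight :=
  extend V X.lcoactHom

theorem toTensorCofree_condition (X : Bicomodule R C D) (V : Type u) [AddCommGroup V]
    [Module R V] :
    X.toTensorCofree V ≫ tensorMap (tensor V (RightComodule.self R C)).coact X.toRight =
      X.toTensorCofree V ≫ extend (tensor V (RightComodule.self R C)).carrier X.lcoactHom :=
  extend_condition (Y := RightComodule.self R C) X.lcoactHom_extend.symm V

theorem tensorMap_toTensorCofree (X : Bicomodule R C D) (V : Type u) [AddCommGroup V]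
    [Module R V] :
    tensorMap (cofreeCounit R C V) X.toRight ≫ X.toTensorCofree V =
      extend (tensor V (RightComodule.self R C)).carrier X.lcoactHom ≫
        tensorMap (cofreeCounitTensor R C V) X.toRight :=
  tensorMap_extend (counitRight R C V) X.lcoactHom

theorem toTensorCofree_counit (X : Bicomodule R C D) (V : Type u) [AddCommGroup V]
    [Module R V] : X.toTensorCofree V ≫ tensorMap (cofreeCounit R C V) X.toRight = 𝟙 _ :=
  X.extend_lcoactHom_counit V

/-- Applying the counit to the first factor `C` of the cotensor condition `(Δ ⊗ X) z = (C ⊗ ϱ) z`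
exhibits `z` as a coaction value. Hence `C □ X` is the image of `X`. -/
theorem mem_range_lcoact (X : Bicomodule R C D) (z : C ⊗[R] X.carrier)
    (hz : z ∈ cotensor (RightComodule.self R C) X.toLeft) :
    X.lcoact (counitLeft R C X.carrier z) = z := by
  have h : TensorProduct.assoc R C C X.carrier
      ((Coalgebra.comul (R := R) (A := C)).rTensor X.carrier z) = X.lcoact.lTensor C z := by
    refine sub_eq_zero.1 ?_
    exact hz
  have h1 : counitLeft R C (C ⊗[R] X.carrier) (X.lcoact.lTensor C z) =
      X.lcoact (counitLeft R C X.carrier z) := counitLeft_lTensor _ _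
  rw [← h1, ← h]
  clear h1 h hz
  induction z with
  | zero => simp
  | add a b ha hb => simp only [map_add, ha, hb]
  | tmul c x =>
    trans (TensorProduct.lid R C ((Coalgebra.counit (R := R) (A := C)).rTensor C
      (Coalgebra.comul c))) ⊗ₜ x
    · rw [LinearMap.rTensor_tmul]
      generalize Coalgebra.comul (R := R) c = z
      induction z with
      | zero => simp
      | add a b ha hb => simp only [add_tmul, map_add, ha, hb]
      | tmul a b => simp [smul_tmul']
    · simp

variable [Module.Flat R D]

/-- `(V ⊗ C) □ X ≅ V ⊗ X`. -/
def cofreeIso (X : Bicomodule R C D) (V : Type u) [AddCommGroup V] [Module R V] :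
    X.cotensorRight.obj (tensor V (RightComodule.self R C)) ≅ tensor V X.toRight where
  hom := X.incl (tensor V (RightComodule.self R C)) ≫ tensorMap (cofreeCounit R C V) X.toRight
  inv := inclLift (X.toTensorCofree V) (X.toTensorCofree_condition V)
  hom_inv_id := by
    rw [← cancel_mono (X.incl _), Category.assoc, inclLift_incl, Category.id_comp, Category.assoc,
      tensorMap_toTensorCofree, ← Category.assoc, ← X.incl_condition, Category.assoc,
      ← tensorMap_comp, cofreeCounitTensor_comp_coact, tensorMap_id, Category.comp_id]
  inv_hom_id := by
    rw [← Category.assoc, inclLift_incl, toTensorCofree_counit]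

theorem cofreeIso_hom (X : Bicomodule R C D) (V : Type u) [AddCommGroup V] [Module R V] :
    (X.cofreeIso V).hom = X.incl _ ≫ tensorMap (cofreeCounit R C V) X.toRight := rfl

theorem map_cofreeIso_hom (X : Bicomodule R C D) {V : Type u} [AddCommGroup V] [Module R V]
    {N : RightComodule R C} (φ : N ⟶ tensor V (RightComodule.self R C)) :
    X.cotensorRight.map φ ≫ (X.cofreeIso V).hom =
      X.incl N ≫ tensorMap (cofreeCounit R C V ∘ₗ φ.lin) X.toRight := by
  rw [cofreeIso_hom, ← Category.assoc, map_incl, Category.assoc, ← tensorMap_comp]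

theorem cofreeIso_naturality (X : Bicomodule R C D) {V W : Type u} [AddCommGroup V] [Module R V]
    [AddCommGroup W] [Module R W] (f : V →ₗ[R] W) :
    X.cotensorRight.map (tensorMap f (RightComodule.self R C)) ≫ (X.cofreeIso W).hom =
      (X.cofreeIso V).hom ≫ tensorMap f X.toRight := by
  rw [map_cofreeIso_hom, cofreeIso_hom, Category.assoc, ← tensorMap_comp,
    cofreeCounit_comp_tensorMap]

/-- If `- □ X` is fully faithful, then the inclusions `N □ X → N ⊗ X` are universal. -/
theorem isCohom_incl_of_fullyFaithful (X : Bicomodule R C D) [X.cotensorRight.Full]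
    [X.cotensorRight.Faithful] (N : RightComodule R C) : IsCohom (X.incl N) := by
  intro V _ _ f
  -- Through `V ⊗ X ≅ (V ⊗ C) □ X`, the map `f` becomes a map between values of the functor.
  -- Fullness lifts it to a colinear map `N → V ⊗ C`, and the counit makes this a linear map `N →
  -- V`.
  refine ⟨cofreeCounit R C V ∘ₗ
    (X.cotensorRight.preimage (f ≫ (X.cofreeIso V).inv)).lin, ?_, fun g hg => ?_⟩
  · dsimp only
    rw [← map_cofreeIso_hom, Functor.map_preimage, Category.assoc, Iso.inv_hom_id,
      Category.comp_id]
  · have h : N.coactHom ≫ tensorMap g (RightComodule.self R C) =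
        X.cotensorRight.preimage (f ≫ (X.cofreeIso V).inv) := by
      apply X.cotensorRight.map_injective
      rw [Functor.map_preimage, ← cancel_mono (X.cofreeIso V).hom, map_cofreeIso_hom,
        cofreeCounit_comp_coactHom_tensorMap,
        Category.assoc, Iso.inv_hom_id, Category.comp_id]
      exact hg
    rw [← h, cofreeCounit_comp_coactHom_tensorMap]

/-- For injective `f`, the map `f ⊗ C` is a monomorphism because `C` is flat. The equivalence turns
it into `f ⊗ X`, up to the isomorphisms `(V ⊗ C) □ X ≅ V ⊗ X`, and a monomorphism of `D`-comodules
is injective. -/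
theorem flat_of_invertible [Module.Flat R C] {X : Bicomodule R C D} (hX : X.Invertible) :
    Module.Flat R X.carrier := by
  have : X.cotensorRight.IsEquivalence := hX
  refine Module.Flat.iff_rTensor_preserves_injective_linearMap.2 fun V W _ _ _ _ f hf => ?_
  have h1 : Mono (tensorMap f (RightComodule.self R C)) := mono_of_injective _
    (Module.Flat.rTensor_preserves_injective_linearMap (M := C) f hf)
  have h2 : tensorMap f X.toRight = (X.cofreeIso V).inv ≫
      X.cotensorRight.map (tensorMap f (RightComodule.self R C)) ≫ (X.cofreeIso W).hom := by
    rw [cofreeIso_naturality, Iso.inv_hom_id_assoc]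
  have h3 : Mono (tensorMap f X.toRight) := by
    rw [h2]
    infer_instance
  exact injective_of_mono (tensorMap f X.toRight)

/-- The coaction is the isomorphism `X ≅ C □ X` followed by the inclusion in `C ⊗ X`, so this is the
case `N = C` of the universality of inclusions. -/
theorem isCohom_lcoactHom_of_fullyFaithful (X : Bicomodule R C D) [X.cotensorRight.Full]
    [X.cotensorRight.Faithful] : IsCohom X.lcoactHom := by
  let w : X.toRight ⟶ X.cotensorRight.obj (RightComodule.self R C) :=
    inclLift (N := RightComodule.self R C) X.lcoactHom X.lcoactHom_extend.symm
  have hw : w ≫ X.incl _ = X.lcoactHom := inclLift_incl (N := RightComodule.self R C) _ _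
  have hb : Function.Bijective w.lin := by
    refine ⟨?_, fun y => ⟨counitLeft R C X.carrier y.1,
      Subtype.ext (X.mem_range_lcoact y.1 y.2)⟩⟩
    refine Function.Injective.of_comp (f := (X.incl (RightComodule.self R C)).lin) ?_
    refine Function.LeftInverse.injective (g := counitLeft R C X.carrier) fun x => ?_
    exact X.toLeft.counitLeft_coact x
  rw [← hw]
  exact (X.isCohom_incl_of_fullyFaithful (RightComodule.self R C)).of_iso (isoOfBijective w hb)

/-- A universal arrow `η : M → H ⊗ X` which equalizes the two maps to `H ⊗ C ⊗ X` identifies `M`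
with `H □ X`. -/
theorem bijective_inclLift {X : Bicomodule R C D} (hX : X.Invertible)
    {M : RightComodule R D} {H : RightComodule R C} {η : M ⟶ tensor H.carrier X.toRight}
    (hη : IsCohom η)
    (hH : η ≫ tensorMap H.coact X.toRight = η ≫ extend H.carrier X.lcoactHom) :
    Function.Bijective (inclLift η hH).lin := by
  have : X.cotensorRight.IsEquivalence := hX
  -- Write `M ≅ N □ X` and lift `M → H □ X` to `φ : N → H`. Since `N` and `H` both carry universal
  -- arrows from `M`, and `φ` matches them, `φ` is bijective; hence its image under the functor is
  -- an isomorphism.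
  let i := X.cotensorRight.objObjPreimageIso M
  let φ := X.cotensorRight.preimage (i.hom ≫ inclLift η hH)
  have hφ : X.cotensorRight.map φ = i.hom ≫ inclLift η hH := Functor.map_preimage _ _
  have h1 : Function.Bijective φ.lin :=
    (X.isCohom_incl_of_fullyFaithful _).bijective (hη.of_iso i) (by
      rw [← map_incl, hφ, Category.assoc, inclLift_incl])
  have h2 : IsIso φ := (isoOfBijective φ h1).isIso_hom
  have h3 : inclLift η hH = i.inv ≫ X.cotensorRight.map φ := by
    rw [hφ, Iso.inv_hom_id_assoc]
  have h4 : IsIso (inclLift η hH) := by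
    rw [h3]
    infer_instance
  exact bijective_of_isIso _

/-- Here `Y` is the preimage of `D` under the equivalence and `u` is `D ≅ Y □ X → Y ⊗ X`, an
inclusion known to be universal. This `Y` serves as the inverse of `X`. -/
theorem exists_isCohom_self {X : Bicomodule R C D} (hX : X.Invertible) :
    ∃ (Y : RightComodule R C) (u : RightComodule.self R D ⟶ tensor Y.carrier X.toRight),
      IsCohom u ∧ u ≫ tensorMap Y.coact X.toRight = u ≫ extend Y.carrier X.lcoactHom := by
  have : X.cotensorRight.IsEquivalence := hX
  let i := X.cotensorRight.objObjPreimageIso (RightComodule.self R D)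
  refine ⟨X.cotensorRight.objPreimage (RightComodule.self R D), i.inv ≫ X.incl _,
    (X.isCohom_incl_of_fullyFaithful _).of_iso i.symm, ?_⟩
  rw [Category.assoc, X.incl_condition, Category.assoc]

/-- The isomorphisms `V ⊗ D ≅ (V ⊗ Y) □ X` are natural in `V`. For injective `f`, flatness of `D`
makes `f ⊗ D` a monomorphism, hence also `(f ⊗ Y) □ X`, and the equivalence reflects this to `f ⊗
Y`. -/
theorem flat_of_isCohom_self [Module.Flat R C] {X : Bicomodule R C D} (hX : X.Invertible)
    {Y : RightComodule R C} {u : RightComodule.self R D ⟶ tensor Y.carrier X.toRight}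
    (hu : IsCohom u)
    (huY : u ≫ tensorMap Y.coact X.toRight = u ≫ extend Y.carrier X.lcoactHom) :
    Module.Flat R Y.carrier := by
  have : X.cotensorRight.IsEquivalence := hX
  refine Module.Flat.iff_rTensor_preserves_injective_linearMap.2 fun V W _ _ _ _ f hf => ?_
  let w (V : Type u) [AddCommGroup V] [Module R V] :
      tensor V (RightComodule.self R D) ⟶ X.cotensorRight.obj (tensor V Y) :=
    inclLift (N := tensor V Y) (extend V u) (extend_condition huY V)
  have hw (V : Type u) [AddCommGroup V] [Module R V] : w V ≫ X.incl (tensor V Y) = extend V u :=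
    inclLift_incl (N := tensor V Y) _ _
  have hwi (V : Type u) [AddCommGroup V] [Module R V] : IsIso (w V) :=
    (isoOfBijective (w V) (bijective_inclLift hX (H := tensor V Y) (hu.extend V)
      (extend_condition huY V))).isIso_hom
  have h1 : Mono (tensorMap f (RightComodule.self R D)) := mono_of_injective _
    (Module.Flat.rTensor_preserves_injective_linearMap (M := D) f hf)
  have h2 : w V ≫ X.cotensorRight.map (tensorMap f Y) =
      tensorMap f (RightComodule.self R D) ≫ w W := by
    rw [← cancel_mono (X.incl (tensor W Y)), Category.assoc, Category.assoc, map_incl, hw]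
    exact ((Category.assoc _ _ _).symm.trans
      (congrArg (· ≫ tensorMap (f.rTensor Y.carrier) X.toRight) (hw V))).trans
        (tensorMap_extend f u).symm
  have h3 : X.cotensorRight.map (tensorMap f Y) =
      inv (w V) ≫ tensorMap f (RightComodule.self R D) ≫ w W := by
    rw [← h2, IsIso.inv_hom_id_assoc]
  have h4 : Mono (X.cotensorRight.map (tensorMap f Y)) := by
    rw [h3]
    infer_instance
  have h5 : Mono (tensorMap f Y) := X.cotensorRight.mono_of_mono_map h4
  exact injective_of_mono (tensorMap f Y)

end Bicomodule

/-! ### The inverse comodule `Y` and its structure maps -/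

theorem mem_cotensor {R : Type u} [CommRing R] {C : Type u} [AddCommGroup C] [Module R C]
    [Coalgebra R C] (M : RightComodule R C) (N : LeftComodule R C)
    (z : M.carrier ⊗[R] N.carrier) :
    z ∈ cotensor M N ↔ TensorProduct.assoc R M.carrier C N.carrier
      (M.coact.rTensor N.carrier z) = N.coact.lTensor M.carrier z :=
  sub_eq_zero

namespace TensorProduct

variable {R : Type u} [CommRing R] (V Y X C : Type u) [AddCommGroup V] [Module R V]
  [AddCommGroup Y] [Module R Y] [AddCommGroup X] [Module R X] [AddCommGroup C] [Module R C]

/-- The isomorphism `(V ⊗ Y) ⊗ X ≃ Y ⊗ (X ⊗ V)`. -/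
def rotate : (V ⊗[R] Y) ⊗[R] X ≃ₗ[R] Y ⊗[R] (X ⊗[R] V) :=
  TensorProduct.congr (TensorProduct.comm R V Y) (LinearEquiv.refl R X) ≪≫ₗ
    TensorProduct.assoc R Y V X ≪≫ₗ
      TensorProduct.congr (LinearEquiv.refl R Y) (TensorProduct.comm R V X)

@[simp] theorem rotate_tmul (v : V) (y : Y) (x : X) :
    rotate (R := R) V Y X ((v ⊗ₜ y) ⊗ₜ x) = y ⊗ₜ (x ⊗ₜ v) := rfl

variable {V Y X C}

theorem rotate_assoc_symm (v : V) (z : Y ⊗[R] X) :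
    rotate V Y X ((TensorProduct.assoc R V Y X).symm (v ⊗ₜ z)) =
      TensorProduct.assoc R Y X V (z ⊗ₜ v) := by
  induction z with
  | zero => simp
  | add a b ha hb => simp only [add_tmul, tmul_add, map_add, ha, hb]
  | tmul y x => simp

theorem assoc_rTensor_rotate (ρ : Y →ₗ[R] Y ⊗[R] C) (z : (V ⊗[R] Y) ⊗[R] X) :
    TensorProduct.assoc R Y C (X ⊗[R] V) (ρ.rTensor (X ⊗[R] V) (rotate V Y X z)) =
      (TensorProduct.assoc R C X V).toLinearMap.lTensor Y (rotate V Y (C ⊗[R] X)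
        (TensorProduct.assoc R (V ⊗[R] Y) C X
          (((TensorProduct.assoc R V Y C).symm.toLinearMap ∘ₗ ρ.lTensor V).rTensor X z))) := by
  induction z with
  | zero => simp
  | add a b ha hb => simp only [map_add, ha, hb]
  | tmul z x =>
    induction z with
    | zero => simp
    | add a b ha hb => simp only [add_tmul, map_add, ha, hb]
    | tmul v y =>
      simp only [rotate_tmul, LinearMap.rTensor_tmul, LinearMap.comp_apply,
        LinearMap.lTensor_tmul, LinearEquiv.coe_coe]
      generalize ρ y = q
      induction q with
      | zero => simp
      | add a b ha hb => simp only [add_tmul, tmul_add, map_add, ha, hb]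
      | tmul y c => simp

theorem lTensor_rotate (l : X →ₗ[R] C ⊗[R] X) (z : (V ⊗[R] Y) ⊗[R] X) :
    ((TensorProduct.assoc R C X V).toLinearMap ∘ₗ l.rTensor V).lTensor Y (rotate V Y X z) =
      (TensorProduct.assoc R C X V).toLinearMap.lTensor Y (rotate V Y (C ⊗[R] X)
        (l.lTensor (V ⊗[R] Y) z)) := by
  induction z with
  | zero => simp
  | add a b ha hb => simp only [map_add, ha, hb]
  | tmul z x =>
    induction z with
    | zero => simp
    | add a b ha hb => simp only [add_tmul, map_add, ha, hb]
    | tmul v y => simp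

end TensorProduct

/-- Moves the module `V` from the right comodule to the left one. It translates `V ⊗ D ≅ (V ⊗ Y) □
X`, known from right comodules, into `D ⊗ V ≅ Y □ (X ⊗ V)`, the form required for left comodules. -/
theorem rotate_mem_cotensor_iff {R : Type u} [CommRing R] {C : Type u} [AddCommGroup C]
    [Module R C] [Coalgebra R C] (Y : RightComodule R C) (X : LeftComodule R C) (V : Type u)
    [AddCommGroup V] [Module R V] (z : (V ⊗[R] Y.carrier) ⊗[R] X.carrier) :
    TensorProduct.rotate V Y.carrier X.carrier z ∈ cotensor Y (LeftComodule.tensor X V) ↔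
      z ∈ cotensor (RightComodule.tensor V Y) X := by
  refine (mem_cotensor _ _ _).trans (Iff.trans ?_ (mem_cotensor _ _ _).symm)
  have h1 := TensorProduct.assoc_rTensor_rotate Y.coact z
  have h2 := TensorProduct.lTensor_rotate X.coact z
  have h3 : Function.Injective
      ((TensorProduct.assoc R C X.carrier V).toLinearMap.lTensor Y.carrier) :=
    (LinearEquiv.lTensor Y.carrier (TensorProduct.assoc R C X.carrier V)).injective
  refine Iff.trans (b := (TensorProduct.assoc R C X.carrier V).toLinearMap.lTensor Y.carrier _ =
    (TensorProduct.assoc R C X.carrier V).toLinearMap.lTensor Y.carrier _)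
    ⟨fun h => (h1.symm.trans h).trans h2, fun h => (h1.trans h).trans h2.symm⟩ ?_
  exact h3.eq_iff.trans (TensorProduct.rotate V Y.carrier (C ⊗[R] X.carrier)).injective.eq_iff

theorem RightComodule.IsCohom.exists_fac {R : Type u} [CommRing R] {C : Type u} [AddCommGroup C]
    [Module R C] [Coalgebra R C] {X M : RightComodule R C} {H : Type u} [AddCommGroup H]
    [Module R H] {η : M ⟶ tensor H X} (h : IsCohom η) {V : Type u} [AddCommGroup V] [Module R V]
    (f : M ⟶ tensor V X) : ∃ g : H →ₗ[R] V, η ≫ tensorMap g X = f :=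
  ⟨h.desc f, h.fac f⟩

namespace Bicomodule

open RightComodule

variable {R : Type u} [CommRing R] {C : Type u} [AddCommGroup C] [Module R C] [Coalgebra R C]
  {D : Type u} [AddCommGroup D] [Module R D] [Coalgebra R D]

/-- A right `C`-comodule `Y` with isomorphisms `D ≅ Y □ X`, compatible with tensor products, and
a map `C → X ⊗ Y` satisfying the triangle identities. -/
structure InverseData (X : Bicomodule R C D) where
  Y : RightComodule R C
  u : D →ₗ[R] Y.carrier ⊗[R] X.carrier
  c : C →ₗ[R] X.carrier ⊗[R] Y.carrier
  lam : Y.carrier →ₗ[R] D ⊗[R] Y.carrier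
  rTensor_c : ∀ x, c.rTensor X.carrier (X.lcoact x) =
    (TensorProduct.assoc R X.carrier Y.carrier X.carrier).symm (u.lTensor X.carrier (X.rcoact x))
  rTensor_u : ∀ y, u.rTensor Y.carrier (lam y) =
    (TensorProduct.assoc R Y.carrier X.carrier Y.carrier).symm (c.lTensor Y.carrier (Y.coact y))
  lam_counit : ∀ y, counitLeft R D Y.carrier (lam y) = y
  c_right : ∀ a, c.rTensor C (Coalgebra.comul a) =
    (TensorProduct.assoc R X.carrier Y.carrier C).symm (Y.coact.lTensor X.carrier (c a))
  c_left : ∀ a, X.lcoact.rTensor Y.carrier (c a) =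
    (TensorProduct.assoc R C X.carrier Y.carrier).symm (c.lTensor C (Coalgebra.comul a))
  flat_left : Module.Flat R X.carrier
  flat_right : Module.Flat R Y.carrier
  u_injective : Function.Injective u
  u_range : LinearMap.range u = cotensor Y X.toLeft
  rTensor_injective : ∀ (V : Type u) [AddCommGroup V] [Module R V],
    Function.Injective (u.rTensor V)
  mem_range : ∀ (V : Type u) [AddCommGroup V] [Module R V]
    (z : Y.carrier ⊗[R] (X.carrier ⊗[R] V)),
    z ∈ cotensor Y (LeftComodule.tensor X.toLeft V) ↔
      ∃ t, TensorProduct.assoc R Y.carrier X.carrier V (u.rTensor V t) = z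

section

variable {X : Bicomodule R C D} {Y : RightComodule R C}

/-- The second triangle identity. Maps out of `Y` are compared after the universal `u`: there `huY`
replaces the coaction of `Y` by that of `X`, `hc` introduces `u`, and colinearity of `u` brings both
sides to `D → D ⊗ D → D ⊗ Y ⊗ X` followed by `u` on the first factor. -/
theorem rTensor_comp_lam {u : RightComodule.self R D ⟶ tensor Y.carrier X.toRight} (hu : IsCohom u)
    (huY : u ≫ tensorMap Y.coact X.toRight = u ≫ extend Y.carrier X.lcoactHom)
    {ul : (RightComodule.self R D).carrier →ₗ[R] Y.carrier ⊗[R] X.toRight.carrier}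
    (hul : ul = u.lin) {c : C →ₗ[R] X.toRight.carrier ⊗[R] Y.carrier}
    (hc : X.lcoactHom ≫ tensorMap c X.toRight = X.toRight.coactHom ≫ extend X.toRight.carrier u)
    {lam : Y.carrier →ₗ[R] (RightComodule.self R D).carrier ⊗[R] Y.carrier}
    (hlam : u ≫ tensorMap lam X.toRight = (RightComodule.self R D).coactHom ≫
      extend (RightComodule.self R D).carrier u) :
    (TensorProduct.assoc R Y.carrier X.toRight.carrier Y.carrier).symm.toLinearMap ∘ₗ
      c.lTensor Y.carrier ∘ₗ Y.coact = ul.rTensor Y.carrier ∘ₗ lam := by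
  refine hu.ext ?_
  rw [tensorMap_comp, tensorMap_comp, tensorMap_comp, ← Category.assoc, ← Category.assoc, huY,
    Category.assoc u, ← extend_comp_tensorMap, hc, Category.assoc,
    comp_extend_coactHom u hul u, ← Category.assoc, ← hlam, Category.assoc]

/-- Right colinearity of `c`. Maps out of `C` are compared after the universal coaction of `X`,
where coassociativity and `huY` make the two sides agree. -/
theorem rTensor_comp_comul (hl : IsCohom X.lcoactHom)
    {u : RightComodule.self R D ⟶ tensor Y.carrier X.toRight}
    (huY : u ≫ tensorMap Y.coact X.toRight = u ≫ extend Y.carrier X.lcoactHom)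
    {c : C →ₗ[R] X.toRight.carrier ⊗[R] Y.carrier}
    (hc : X.lcoactHom ≫ tensorMap c X.toRight = X.toRight.coactHom ≫ extend X.toRight.carrier u) :
    c.rTensor C ∘ₗ Coalgebra.comul =
      (TensorProduct.assoc R X.toRight.carrier Y.carrier C).symm.toLinearMap ∘ₗ
        Y.coact.lTensor X.toRight.carrier ∘ₗ c := by
  refine hl.ext ?_
  rw [tensorMap_comp, tensorMap_comp, tensorMap_comp, ← Category.assoc, ← lcoactHom_extend,
    Category.assoc, ← tensorMap_extend, ← Category.assoc, hc, ← Category.assoc, ← Category.assoc,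
    hc]
  simp only [Category.assoc]
  rw [← Category.assoc (extend _ u) (tensorMap (Y.coact.lTensor _) _), ← extend_comp_tensorMap,
    huY, extend_comp]
  simp only [Category.assoc]
  rw [extend_extend]
  conv_lhs => rw [extend, Category.assoc]

/-- Left colinearity of `c`, again tested after the universal coaction: it reduces to
coassociativity of that coaction and to its being a map of right `D`-comodules. -/
theorem rTensor_lcoact_comp (hl : IsCohom X.lcoactHom)
    {u : RightComodule.self R D ⟶ tensor Y.carrier X.toRight}
    {ll : X.toRight.carrier →ₗ[R] C ⊗[R] X.toRight.carrier} (hll : ll = X.lcoactHom.lin)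
    {c : C →ₗ[R] X.toRight.carrier ⊗[R] Y.carrier}
    (hc : X.lcoactHom ≫ tensorMap c X.toRight = X.toRight.coactHom ≫ extend X.toRight.carrier u) :
    ll.rTensor Y.carrier ∘ₗ c =
      (TensorProduct.assoc R C X.toRight.carrier Y.carrier).symm.toLinearMap ∘ₗ
        c.lTensor C ∘ₗ Coalgebra.comul := by
  refine hl.ext ?_
  rw [tensorMap_comp, tensorMap_comp, tensorMap_comp, ← Category.assoc, hc, Category.assoc,
    ← comp_extend_coactHom X.lcoactHom hll u, ← hc, extend_comp_tensorMap]
  have h := congrArg (· ≫ tensorMap (c.lTensor C) X.toRight ≫ tensorMap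
    (TensorProduct.assoc R C X.toRight.carrier Y.carrier).symm.toLinearMap X.toRight)
      X.lcoactHom_extend
  simpa only [Category.assoc] using h

/-- `lam` is the left `D`-coaction of `Y`. Of its comodule axioms only this counit law is used
later. -/
theorem counitLeft_comp_lam {u : RightComodule.self R D ⟶ tensor Y.carrier X.toRight}
    (hu : IsCohom u) {lam : Y.carrier →ₗ[R] (RightComodule.self R D).carrier ⊗[R] Y.carrier}
    (hlam : u ≫ tensorMap lam X.toRight = (RightComodule.self R D).coactHom ≫
      extend (RightComodule.self R D).carrier u)
    {ε : (RightComodule.self R D).carrier ⊗[R] Y.carrier →ₗ[R] Y.carrier}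
    (hε : ε = counitLeft R D Y.carrier) :
    ε ∘ₗ lam = LinearMap.id := by
  refine hu.ext ?_
  rw [tensorMap_comp, ← Category.assoc, hlam, tensorMap_id, Category.comp_id]
  subst hε
  obtain ⟨ul, hul⟩ : ∃ ul : D →ₗ[R] Y.carrier ⊗[R] X.carrier, ul = u.lin := ⟨_, rfl⟩
  have key : (counitLeft R D Y.carrier).rTensor X.carrier ∘ₗ
      (TensorProduct.assoc R D Y.carrier X.carrier).symm.toLinearMap ∘ₗ ul.lTensor D ∘ₗ
        Coalgebra.comul = ul := by
    have h1 : (counitLeft R D Y.carrier).rTensor X.carrier ∘ₗ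
      (TensorProduct.assoc R D Y.carrier X.carrier).symm.toLinearMap =
        counitLeft R D (Y.carrier ⊗[R] X.carrier) :=
      TensorProduct.ext' fun d z => by
        induction z with
        | zero => simp
        | add a b ha hb => simp only [tmul_add, map_add, ha, hb]
        | tmul a b => simp [smul_tmul']
    refine LinearMap.ext fun d => ?_
    refine (LinearMap.congr_fun h1 _).trans ?_
    refine (counitLeft_lTensor ul _).trans (congrArg ul ?_)
    simp [counitLeft]
  subst hul
  exact hom_ext key

end

/-- `c` is induced by `X → X ⊗ D → (X ⊗ Y) ⊗ X` through universality of the coaction of `X`, and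
`lam` by `D → D ⊗ D → (D ⊗ Y) ⊗ X` through universality of `u`. The first triangle identity is the
defining property of `c`. -/
theorem Invertible.nonempty_inverseData [Module.Flat R C] [Module.Flat R D] {X : Bicomodule R C D}
    (hX : X.Invertible) : Nonempty X.InverseData := by
  have : X.cotensorRight.IsEquivalence := hX
  have hl := X.isCohom_lcoactHom_of_fullyFaithful
  obtain ⟨Y, u, hu, huY⟩ := exists_isCohom_self hX
  obtain ⟨c, hc⟩ := hl.exists_fac (X.toRight.coactHom ≫ extend X.toRight.carrier u)
  obtain ⟨lam, hlam⟩ := hu.exists_fac ((RightComodule.self R D).coactHom ≫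
      extend (RightComodule.self R D).carrier u)
  have fY := flat_of_isCohom_self hX hu huY
  have fX := flat_of_invertible hX
  have hb := bijective_inclLift hX hu huY
  have hbV (V : Type u) [AddCommGroup V] [Module R V] :=
    bijective_inclLift hX (H := tensor V Y) (hu.extend V) (extend_condition huY V)
  -- `u ⊗ V` and the universal arrow `V ⊗ D → (V ⊗ Y) ⊗ X` differ only by a permutation of factors,
  -- so injectivity and image of the former can be read off from the latter.
  have key (V : Type u) [AddCommGroup V] [Module R V] (t : D ⊗[R] V) :
    TensorProduct.assoc R Y.carrier X.carrier V
      ((u.lin : D →ₗ[R] Y.carrier ⊗[R] X.carrier).rTensor V t) =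
      TensorProduct.rotate V Y.carrier X.carrier
        ((extend V u).lin (TensorProduct.comm R D V t)) := by
    let ev : V ⊗[R] D →ₗ[R] (V ⊗[R] Y.carrier) ⊗[R] X.carrier := (extend V u).lin
    have h : (TensorProduct.assoc R Y.carrier X.carrier V).toLinearMap ∘ₗ
        (u.lin : D →ₗ[R] Y.carrier ⊗[R] X.carrier).rTensor V =
        (TensorProduct.rotate V Y.carrier X.carrier).toLinearMap ∘ₗ
          ev ∘ₗ
            (TensorProduct.comm R D V).toLinearMap :=
      TensorProduct.ext' fun d v => (TensorProduct.rotate_assoc_symm (R := R) (Y := Y.carrier)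
        (X := X.carrier) v (u.lin d)).symm
    exact LinearMap.congr_fun h t
  have hinj (V : Type u) [AddCommGroup V] [Module R V] : Function.Injective (extend V u).lin := by
    have h := inclLift_incl (N := tensor V Y) (extend V u) (extend_condition huY V)
    rw [← h]
    exact (X.incl_injective _).comp (hbV V).1
  refine ⟨{
    Y := Y
    u := u.lin
    c := c
    lam := lam
    rTensor_c := fun x => LinearMap.congr_fun (congrArg Hom.lin hc) x
    rTensor_u := fun y => (LinearMap.congr_fun
      (rTensor_comp_lam hu huY (ul := u.lin) rfl hc hlam) y).symm
    lam_counit := fun y => LinearMap.congr_fun (counitLeft_comp_lam hu hlam rfl) y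
    c_right := fun a => LinearMap.congr_fun (rTensor_comp_comul hl huY hc) a
    c_left := fun a => LinearMap.congr_fun (rTensor_lcoact_comp hl (ll := X.lcoactHom.lin) rfl hc) a
    flat_left := fX
    flat_right := fY
    u_injective := ?_
    u_range := ?_
    rTensor_injective := ?_
    mem_range := ?_ }⟩
  · have h := inclLift_incl u huY
    rw [← h]
    exact (X.incl_injective _).comp hb.1
  · refine Submodule.ext fun z => ?_
    constructor
    · rintro ⟨d, rfl⟩
      exact ((inclLift u huY).lin d).2
    · intro hz
      obtain ⟨d, hd⟩ := hb.2 ⟨z, hz⟩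
      exact ⟨d, congrArg Subtype.val hd⟩
  · intro V _ _ t t' h
    have h1 := congrArg (TensorProduct.assoc R Y.carrier X.carrier V) h
    exact (TensorProduct.comm R D V).injective (hinj V ((TensorProduct.rotate V Y.carrier
      X.carrier).injective (((key V t).symm.trans h1).trans (key V t'))))
  · intro V _ _ z
    obtain ⟨z, rfl⟩ := (TensorProduct.rotate V Y.carrier X.carrier).surjective z
    refine (rotate_mem_cotensor_iff Y X.toLeft V z).trans ⟨fun hz => ?_, ?_⟩
    · obtain ⟨t, ht⟩ := (hbV V).2 ⟨z, hz⟩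
      obtain ⟨t, rfl⟩ := (TensorProduct.comm R D V).surjective t
      exact ⟨t, (key V t).trans (congrArg (TensorProduct.rotate V Y.carrier X.carrier)
        (congrArg Subtype.val ht))⟩
    · rintro ⟨t, ht⟩
      have h1 := (TensorProduct.rotate V Y.carrier X.carrier).injective ((key V t).symm.trans ht)
      rw [← h1]
      exact ((inclLift (N := tensor V Y) (extend V u) (extend_condition huY V)).lin
        (TensorProduct.comm R D V t)).2

end Bicomodule

/-! ### Universal arrows and lifting for left comodules -/

namespace LeftComodule

variable {R : Type u} [CommRing R] {C : Type u} [AddCommGroup C] [Module R C] [Coalgebra R C]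

theorem mono_of_injective {M N : LeftComodule R C} (f : M ⟶ N)
    (hf : Function.Injective f.lin) : Mono f where
  right_cancellation _ _ hgh := hom_ext <| LinearMap.ext fun x =>
    hf (LinearMap.congr_fun (congrArg Hom.lin hgh) x)

theorem tensorMap_comp {U V W : Type u} [AddCommGroup U] [Module R U] [AddCommGroup V]
    [Module R V] [AddCommGroup W] [Module R W] (M : LeftComodule R C) (f : U →ₗ[R] V)
    (g : V →ₗ[R] W) : tensorMap M (g ∘ₗ f) = tensorMap M f ≫ tensorMap M g :=
  hom_ext (LinearMap.lTensor_comp M.carrier g f)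

/-- The coaction `M → C ⊗ M` as a colinear map. -/
def coactHom (M : LeftComodule R C) : M ⟶ tensor (self R C) M.carrier where
  lin := M.coact
  comm := M.coassoc

/-- `η : M → X ⊗ H` is a universal arrow from `M` to the functor `X ⊗ -`. -/
def IsCohom {X M : LeftComodule R C} {H : Type u} [AddCommGroup H] [Module R H]
    (η : M ⟶ tensor X H) : Prop :=
  ∀ (V : Type u) [AddCommGroup V] [Module R V] (f : M ⟶ tensor X V),
    ∃! g : H →ₗ[R] V, η ≫ tensorMap X g = f

theorem IsCohom.of_bijective {X M : LeftComodule R C} {H : Type u} [AddCommGroup H] [Module R H]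
    {η : M ⟶ tensor X H} (h : IsCohom η) {H' : Type u} [AddCommGroup H'] [Module R H']
    {η' : M ⟶ tensor X H'} {e : H' →ₗ[R] H} (he : Function.Bijective e)
    (hη : η' ≫ tensorMap X e = η) : IsCohom η' := by
  intro V _ _ f
  obtain ⟨g, hg, hu⟩ := h V f
  refine ⟨g ∘ₗ e, ?_, fun g' hg' => ?_⟩
  · dsimp only
    rw [tensorMap_comp, ← Category.assoc, hη, hg]
  · set e' := LinearEquiv.ofBijective e he
    have h1 : g' = (g' ∘ₗ e'.symm.toLinearMap) ∘ₗ e :=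
      LinearMap.ext fun z => congrArg g' (e'.symm_apply_apply z).symm
    have h2 : g' ∘ₗ e'.symm.toLinearMap = g := by
      refine hu _ ?_
      dsimp only
      rw [← hη, Category.assoc, ← tensorMap_comp, ← h1, hg']
    rw [h1, h2]

/-- A comodule with universal arrows from every comodule is quasi-finite. -/
theorem quasiFinite_of_isCohom (X : LeftComodule R C)
    (h : ∀ M : LeftComodule R C, ∃ (H : Type u) (_ : AddCommGroup H) (_ : Module R H)
      (η : M ⟶ tensor X H), IsCohom η) : X.QuasiFinite := by
  have (M : LeftComodule R C) : Limits.HasInitial (StructuredArrow M X.tensorFunctor) := by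
    obtain ⟨H, _, _, η, hη⟩ := h M
    refine (Limits.IsInitial.ofUniqueHom (X := StructuredArrow.mk (T := X.tensorFunctor)
      (Y := ModuleCat.of R H) η) (fun Z => StructuredArrow.homMk
        (ModuleCat.ofHom (hη Z.right Z.hom).choose) (hη Z.right Z.hom).choose_spec.1)
        fun Z m => ?_).hasInitial
    refine StructuredArrow.hom_ext _ _ (ModuleCat.hom_ext ?_)
    exact (hη Z.right Z.hom).choose_spec.2 m.right.hom (StructuredArrow.w m)
  exact isRightAdjointOfStructuredArrowInitials _

/-- Flatness of `X` makes `X ⊗ i` injective, which gives a linear lift. Flatness of `C` keeps it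
injective after `C ⊗ -`, so the lift is colinear because `f` is. -/
theorem exists_lift_tensor [Module.Flat R C] {X P : LeftComodule R C} [Module.Flat R X.carrier]
    {K H : Type u} [AddCommGroup K] [Module R K] [AddCommGroup H] [Module R H] {i : K →ₗ[R] H}
    (hi : Function.Injective i) (f : P ⟶ tensor X H)
    (hf : ∀ p, f.lin p ∈ LinearMap.range (i.lTensor X.carrier)) :
    ∃ g : P ⟶ tensor X K, g ≫ tensorMap X i = f := by
  have hi' := Module.Flat.lTensor_preserves_injective_linearMap (M := X.carrier) i hi
  let e := LinearEquiv.ofInjective (i.lTensor X.carrier) hi'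
  let g : P.carrier →ₗ[R] X.carrier ⊗[R] K := e.symm.toLinearMap ∘ₗ f.lin.codRestrict _ hf
  have hg : (tensorMap X i).lin ∘ₗ g = f.lin := LinearMap.ext fun p =>
    congrArg Subtype.val (e.apply_symm_apply (f.lin.codRestrict _ hf p))
  refine ⟨⟨g, ?_⟩, hom_ext hg⟩
  have hi'' := Module.Flat.lTensor_preserves_injective_linearMap (M := C)
    (tensorMap X i).lin hi'
  refine LinearMap.ext fun p => hi'' ?_
  refine (comm_apply (tensorMap X i) (g p)).symm.trans ?_
  refine (congrArg (tensor X H).coact (LinearMap.congr_fun hg p)).trans ?_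
  refine (comm_apply f p).trans ?_
  refine (congrArg (fun k : P.carrier →ₗ[R] _ => k.lTensor C (P.coact p)) hg).symm.trans ?_
  exact LinearMap.lTensor_comp_apply C (tensorMap X i).lin g (P.coact p)

end LeftComodule

/-! ### The structure maps and their identities, tensored with a further module -/

section TensorCalculus

variable {R : Type u} [CommRing R] {C D X Y P V : Type u} [AddCommGroup C] [Module R C]
  [AddCommGroup D] [Module R D] [AddCommGroup X] [Module R X] [AddCommGroup Y] [Module R Y]
  [AddCommGroup P] [Module R P] [AddCommGroup V] [Module R V]

theorem assoc_rTensor_lTensor (c : C →ₗ[R] X ⊗[R] Y) (f : P →ₗ[R] V) (z : C ⊗[R] P) :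
    (f.lTensor Y).lTensor X (TensorProduct.assoc R X Y P (c.rTensor P z)) =
      TensorProduct.assoc R X Y V (c.rTensor V (f.lTensor C z)) := by
  induction z with
  | zero => simp
  | add a b ha hb => simp only [map_add, ha, hb]
  | tmul a p =>
    simp only [LinearMap.rTensor_tmul, LinearMap.lTensor_tmul]
    generalize c a = y
    induction y <;> simp_all [tmul_add, add_tmul]

theorem lTensor_assoc_rTensor {c : C →ₗ[R] X ⊗[R] Y} {ρ : Y →ₗ[R] Y ⊗[R] C}
    {Δ : C →ₗ[R] C ⊗[R] C}
    (h : ∀ a, c.rTensor C (Δ a) = (TensorProduct.assoc R X Y C).symm (ρ.lTensor X (c a)))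
    (z : C ⊗[R] P) :
    ((TensorProduct.assoc R Y C P).toLinearMap ∘ₗ ρ.rTensor P).lTensor X
        (TensorProduct.assoc R X Y P (c.rTensor P z)) =
      TensorProduct.assoc R X Y (C ⊗[R] P) (c.rTensor (C ⊗[R] P)
        (TensorProduct.assoc R C C P (Δ.rTensor P z))) := by
  induction z with
  | zero => simp
  | add a b ha hb => simp only [map_add, ha, hb]
  | tmul a p =>
    trans (TensorProduct.assoc R Y C P).toLinearMap.lTensor X (TensorProduct.assoc R X (Y ⊗[R] C) P
      (TensorProduct.assoc R X Y C (c.rTensor C (Δ a)) ⊗ₜ p))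
    · rw [h, LinearEquiv.apply_symm_apply]
      simp only [LinearMap.rTensor_tmul]
      generalize c a = y
      induction y with
      | zero => simp
      | add a b ha hb => simp only [add_tmul, map_add, ha, hb]
      | tmul x y => simp
    · rw [LinearMap.rTensor_tmul]
      generalize Δ a = y
      induction y with
      | zero => simp
      | add a b ha hb => simp only [add_tmul, map_add, ha, hb]
      | tmul a b =>
        simp only [LinearMap.rTensor_tmul, TensorProduct.assoc_tmul]
        generalize c a = y
        induction y <;> simp_all [tmul_add, add_tmul]

theorem assoc_rTensor_assoc_rTensor {c : C →ₗ[R] X ⊗[R] Y} {u : D →ₗ[R] Y ⊗[R] X}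
    {l : X →ₗ[R] C ⊗[R] X} {r : X →ₗ[R] X ⊗[R] D}
    (h : ∀ x, c.rTensor X (l x) = (TensorProduct.assoc R X Y X).symm (u.lTensor X (r x)))
    (w : X ⊗[R] V) :
    TensorProduct.assoc R X Y (X ⊗[R] V) (c.rTensor (X ⊗[R] V)
        (TensorProduct.assoc R C X V (l.rTensor V w))) =
      ((TensorProduct.assoc R Y X V).toLinearMap ∘ₗ u.rTensor V).lTensor X
        (TensorProduct.assoc R X D V (r.rTensor V w)) := by
  induction w with
  | zero => simp
  | add a b ha hb => simp only [map_add, ha, hb]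
  | tmul x v =>
    simp only [LinearMap.rTensor_tmul]
    trans (TensorProduct.assoc R Y X V).toLinearMap.lTensor X (TensorProduct.assoc R X (Y ⊗[R] X) V
      (TensorProduct.assoc R X Y X (c.rTensor X (l x)) ⊗ₜ v))
    · generalize l x = y
      induction y with
      | zero => simp
      | add a b ha hb => simp only [add_tmul, map_add, ha, hb]
      | tmul a b =>
        simp only [LinearMap.rTensor_tmul, TensorProduct.assoc_tmul]
        generalize c a = y
        induction y <;> simp_all [tmul_add, add_tmul]
    · rw [h, LinearEquiv.apply_symm_apply]
      generalize r x = y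
      induction y <;> simp_all [tmul_add, add_tmul]

theorem lTensor_assoc_rTensor_assoc {c : C →ₗ[R] X ⊗[R] Y} {u : D →ₗ[R] Y ⊗[R] X}
    {lam : Y →ₗ[R] D ⊗[R] Y} {ρ : Y →ₗ[R] Y ⊗[R] C}
    (h : ∀ y, u.rTensor Y (lam y) = (TensorProduct.assoc R Y X Y).symm (c.lTensor Y (ρ y)))
    (z : Y ⊗[R] P) :
    ((TensorProduct.assoc R X Y P).toLinearMap ∘ₗ c.rTensor P).lTensor Y
        (TensorProduct.assoc R Y C P (ρ.rTensor P z)) =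
      TensorProduct.assoc R Y X (Y ⊗[R] P) (u.rTensor (Y ⊗[R] P)
        (TensorProduct.assoc R D Y P (lam.rTensor P z))) := by
  induction z with
  | zero => simp
  | add a b ha hb => simp only [map_add, ha, hb]
  | tmul y p =>
    simp only [LinearMap.rTensor_tmul]
    trans (TensorProduct.assoc R X Y P).toLinearMap.lTensor Y (TensorProduct.assoc R Y (X ⊗[R] Y) P
      (TensorProduct.assoc R Y X Y (u.rTensor Y (lam y)) ⊗ₜ p))
    · rw [h, LinearEquiv.apply_symm_apply]
      generalize ρ y = y
      induction y <;> simp_all [tmul_add, add_tmul]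
    · generalize lam y = y
      induction y with
      | zero => simp
      | add a b ha hb => simp only [add_tmul, map_add, ha, hb]
      | tmul a b =>
        simp only [LinearMap.rTensor_tmul, TensorProduct.assoc_tmul]
        generalize u a = y
        induction y <;> simp_all [tmul_add, add_tmul]

theorem counitLeft_assoc [Coalgebra R D] {lam : Y →ₗ[R] D ⊗[R] Y}
    (h : ∀ y, counitLeft R D Y (lam y) = y) (z : Y ⊗[R] P) :
    counitLeft R D (Y ⊗[R] P) (TensorProduct.assoc R D Y P (lam.rTensor P z)) = z := by
  induction z with
  | zero => simp
  | add a b ha hb => simp only [map_add, ha, hb]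
  | tmul y p =>
    trans counitLeft R D Y (lam y) ⊗ₜ p
    · rw [LinearMap.rTensor_tmul]
      generalize lam y = y
      induction y with
      | zero => simp
      | add a b ha hb => simp only [add_tmul, map_add, ha, hb]
      | tmul a b => simp [smul_tmul']
    · rw [h]

end TensorCalculus

/-! ### The left cohom functor `Y □ -` -/

namespace Bicomodule

variable {R : Type u} [CommRing R] {C : Type u} [AddCommGroup C] [Module R C] [Coalgebra R C]
  {D : Type u} [AddCommGroup D] [Module R D] [Coalgebra R D] {X : Bicomodule R C D}

namespace InverseData

variable (I : X.InverseData) (P : LeftComodule R C)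

/-- The isomorphism `D ⊗ V → Y □ (X ⊗ V)`, as a map to `Y ⊗ (X ⊗ V)`. -/
def cofreeMap (V : Type u) [AddCommGroup V] [Module R V] :
    D ⊗[R] V →ₗ[R] I.Y.carrier ⊗[R] (X.carrier ⊗[R] V) :=
  (TensorProduct.assoc R I.Y.carrier X.carrier V).toLinearMap ∘ₗ I.u.rTensor V

theorem cofreeMap_injective (V : Type u) [AddCommGroup V] [Module R V] :
    Function.Injective (I.cofreeMap V) :=
  (TensorProduct.assoc R I.Y.carrier X.carrier V).injective.comp (I.rTensor_injective V)

theorem cofreeMap_lTensor {V W : Type u} [AddCommGroup V] [Module R V] [AddCommGroup W]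
    [Module R W] (f : V →ₗ[R] W) (t : D ⊗[R] V) :
    I.cofreeMap W (f.lTensor D t) =
      (f.lTensor X.carrier).lTensor I.Y.carrier (I.cofreeMap V t) := by
  induction t with
  | zero => simp
  | add a b ha hb => simp only [map_add, ha, hb]
  | tmul d v =>
    simp only [cofreeMap, LinearMap.comp_apply, LinearEquiv.coe_coe, LinearMap.rTensor_tmul,
      LinearMap.lTensor_tmul]
    generalize I.u d = y
    induction y <;> simp_all [tmul_add, add_tmul]

/-- `s` is `Y □ f : Y □ P → Y □ (X ⊗ V)` followed by the inverse of `D ⊗ V ≅ Y □ (X ⊗ V)`. Followed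
by the counit of `D`, it becomes the linear map `Y □ P → V` adjoint to `f`. -/
theorem exists_cofreeMap {V : Type u} [AddCommGroup V] [Module R V]
    (f : P ⟶ LeftComodule.tensor X.toLeft V) {fl : P.carrier →ₗ[R] X.carrier ⊗[R] V}
    (hfl : fl = f.lin) : ∃ s : cotensor I.Y P →ₗ[R] D ⊗[R] V, ∀ z, I.cofreeMap V (s z) =
      fl.lTensor I.Y.carrier z.1 := by
  let e := LinearEquiv.ofInjective (I.cofreeMap V) (I.cofreeMap_injective V)
  have h (z : cotensor I.Y P) : fl.lTensor I.Y.carrier z.1 ∈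
      LinearMap.range (I.cofreeMap V) := by
    subst hfl
    exact (I.mem_range V _).1 (cotensorMapRight I.Y f z).2
  refine ⟨e.symm.toLinearMap ∘ₗ ((fl.lTensor I.Y.carrier ∘ₗ (cotensor I.Y P).subtype).codRestrict _ h), fun z => ?_⟩
  exact congrArg Subtype.val (e.apply_symm_apply _)

/-- The map `C → X ⊗ Y` as a colinear map. -/
def cHom : LeftComodule.self R C ⟶ LeftComodule.tensor X.toLeft I.Y.carrier where
  lin := I.c
  comm := LinearMap.ext fun a =>
    (TensorProduct.assoc R C X.carrier I.Y.carrier).eq_symm_apply.1 (I.c_left a)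

/-- The map `P → X ⊗ (Y ⊗ P)`. -/
def preArrow : P ⟶ LeftComodule.tensor X.toLeft (I.Y.carrier ⊗[R] P.carrier) :=
  P.coactHom ≫ LeftComodule.tensorMapLeft I.cHom P.carrier ≫
    LeftComodule.tensorAssoc X.toLeft I.Y.carrier P.carrier

theorem preArrow_lin (p : P.carrier) : (I.preArrow P).lin p =
    TensorProduct.assoc R X.carrier I.Y.carrier P.carrier (I.c.rTensor P.carrier (P.coact p)) := rfl

/-- As `X` is flat, `X ⊗ (Y □ P)` is a kernel inside `X ⊗ Y ⊗ P`. The two maps to `X ⊗ Y ⊗ C ⊗ P`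
agree on the given element by right colinearity of `c` and coassociativity of `P`. -/
theorem preArrow_mem (p : P.carrier) : (I.preArrow P).lin p ∈
    LinearMap.range ((cotensor I.Y P).subtype.lTensor X.carrier) := by
  have := I.flat_left
  refine (Module.Flat.lTensor_exact X.carrier
    (LinearMap.exact_subtype_ker_map (cotensorDiff I.Y P)) _).1 ?_
  rw [preArrow_lin, cotensorDiff, LinearMap.lTensor_sub, LinearMap.sub_apply, sub_eq_zero,
    lTensor_assoc_rTensor I.c_right, assoc_rTensor_lTensor]
  congr 2
  exact LinearMap.congr_fun P.coassoc p

theorem exists_arrow [Module.Flat R C] :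
    ∃ η : P ⟶ LeftComodule.tensor X.toLeft (cotensor I.Y P),
      η ≫ LeftComodule.tensorMap X.toLeft (cotensor I.Y P).subtype = I.preArrow P := by
  have : Module.Flat R X.toLeft.carrier := I.flat_left
  exact LeftComodule.exists_lift_tensor (cotensor I.Y P).injective_subtype _ (I.preArrow_mem P)

variable [Module.Flat R C]

/-- The map `P → X ⊗ (Y □ P)`. -/
def arrow : P ⟶ LeftComodule.tensor X.toLeft (cotensor I.Y P) := (I.exists_arrow P).choose

theorem arrow_subtype :
    I.arrow P ≫ LeftComodule.tensorMap X.toLeft (cotensor I.Y P).subtype = I.preArrow P :=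
  (I.exists_arrow P).choose_spec

theorem lTensor_arrow (p : P.carrier) :
    (cotensor I.Y P).subtype.lTensor X.carrier ((I.arrow P).lin p) =
      TensorProduct.assoc R X.carrier I.Y.carrier P.carrier
        (I.c.rTensor P.carrier (P.coact p)) :=
  LinearMap.congr_fun (congrArg LeftComodule.Hom.lin (I.arrow_subtype P)) p

/-- The existence half of universality. Colinearity of `f` and the first triangle identity show that
`X ⊗ s` takes the arrow at `p` to the image of `f p` in `X □ (D ⊗ V)`, from which the counit returns
`f p`. The comparison takes place after the injective map `X ⊗ (D ⊗ V) → X ⊗ Y ⊗ X ⊗ V`. -/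
theorem lTensor_counit_arrow {V : Type u} [AddCommGroup V] [Module R V]
    {f : P ⟶ LeftComodule.tensor X.toLeft V} {fl : P.carrier →ₗ[R] X.carrier ⊗[R] V}
    (hfl : fl = f.lin) {s : cotensor I.Y P →ₗ[R] D ⊗[R] V}
    (hs : ∀ z, I.cofreeMap V (s z) = fl.lTensor I.Y.carrier z.1) (p : P.carrier) :
    (counitLeft R D V ∘ₗ s).lTensor X.carrier ((I.arrow P).lin p) = f.lin p := by
  have := I.flat_left
  have hinj := Module.Flat.lTensor_preserves_injective_linearMap (M := X.carrier) _
    (I.cofreeMap_injective V)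
  have h1 : I.cofreeMap V ∘ₗ s = fl.lTensor I.Y.carrier ∘ₗ (cotensor I.Y P).subtype :=
    LinearMap.ext hs
  have h2 : TensorProduct.assoc R C X.carrier V (X.lcoact.rTensor V (fl p)) =
      fl.lTensor C (P.coact p) := by
    rw [hfl]
    exact LeftComodule.comm_apply f p
  have h3 : s.lTensor X.carrier ((I.arrow P).lin p) = toCofree X.toRight V (fl p) := by
    refine hinj ?_
    refine (LinearMap.lTensor_comp_apply X.carrier _ _ _).symm.trans ?_
    rw [h1]
    refine (LinearMap.lTensor_comp_apply X.carrier _ _ _).trans ?_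
    refine (congrArg _ (I.lTensor_arrow P p)).trans ?_
    rw [assoc_rTensor_lTensor, ← h2]
    exact assoc_rTensor_assoc_rTensor I.rTensor_c (fl p)
  refine (LinearMap.lTensor_comp_apply X.carrier _ _ _).trans ?_
  refine (congrArg _ h3).trans ?_
  exact (counit_toCofree X.toRight V (fl p)).trans (LinearMap.congr_fun hfl p)

/-- The uniqueness half. Let `S : Y □ P → D ⊗ (Y □ P)` be the map attached to the arrow of `P`
itself. Naturality gives `s = (D ⊗ g) S`, and the second triangle identity shows that `S` is the
restriction of `lam ⊗ P`, so the counit after `S` is the identity; applying the counit to `s` leaves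
`g`. -/
theorem eq_counit_of_arrow {V : Type u} [AddCommGroup V] [Module R V]
    {f : P ⟶ LeftComodule.tensor X.toLeft V} {fl : P.carrier →ₗ[R] X.carrier ⊗[R] V}
    (hfl : fl = f.lin) {s : cotensor I.Y P →ₗ[R] D ⊗[R] V}
    (hs : ∀ z, I.cofreeMap V (s z) = fl.lTensor I.Y.carrier z.1)
    {g : cotensor I.Y P →ₗ[R] V} (hg : I.arrow P ≫ LeftComodule.tensorMap X.toLeft g = f) :
    g = counitLeft R D V ∘ₗ s := by
  have := I.flat_left
  obtain ⟨al, hal⟩ : ∃ al : P.carrier →ₗ[R] X.carrier ⊗[R] cotensor I.Y P, al = (I.arrow P).lin :=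
    ⟨_, rfl⟩
  obtain ⟨S, hS⟩ := I.exists_cofreeMap P (I.arrow P) hal
  have h0 : (cotensor I.Y P).subtype.lTensor X.carrier ∘ₗ al =
      (TensorProduct.assoc R X.carrier I.Y.carrier P.carrier).toLinearMap ∘ₗ
        I.c.rTensor P.carrier ∘ₗ P.coact := by
    rw [hal]
    exact LinearMap.ext (I.lTensor_arrow P)
  have hfl' : fl = g.lTensor X.carrier ∘ₗ al := by
    rw [hfl, hal, ← hg]
    rfl
  rw [hfl'] at hs
  refine LinearMap.ext fun z => ?_
  have h1 : s z = g.lTensor D (S z) := I.cofreeMap_injective V (by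
    rw [hs, cofreeMap_lTensor, hS, LinearMap.lTensor_comp_apply])
  -- The cotensor condition on `z` moves the coaction from `P` to `Y`, where the second triangle
  -- identity applies.
  have h2 : (cotensor I.Y P).subtype.lTensor D (S z) =
      TensorProduct.assoc R D I.Y.carrier P.carrier (I.lam.rTensor P.carrier z.1) := by
    refine I.cofreeMap_injective _ ?_
    rw [cofreeMap_lTensor, hS, ← LinearMap.lTensor_comp_apply, h0]
    refine Eq.trans ?_ (lTensor_assoc_rTensor_assoc I.rTensor_u z.1)
    rw [(mem_cotensor I.Y P z.1).1 z.2, ← LinearMap.lTensor_comp_apply, LinearMap.comp_assoc]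
  have h3 : counitLeft R D (cotensor I.Y P) (S z) = z := by
    refine (cotensor I.Y P).injective_subtype ?_
    rw [← counitLeft_lTensor, h2, counitLeft_assoc I.lam_counit]
    rfl
  rw [LinearMap.comp_apply, h1, counitLeft_lTensor, h3]

theorem isCohom_arrow : LeftComodule.IsCohom (I.arrow P) := by
  intro V _ _ f
  obtain ⟨s, hs⟩ := I.exists_cofreeMap P f rfl
  exact ⟨counitLeft R D V ∘ₗ s,
    LeftComodule.hom_ext (LinearMap.ext fun p => I.lTensor_counit_arrow P rfl hs p),
    fun g hg => I.eq_counit_of_arrow P rfl hs hg⟩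

end InverseData

end Bicomodule

/-! ### From invertibility to the conditions on the left comodule -/

namespace LeftComodule

variable {R : Type u} [CommRing R] {C : Type u} [AddCommGroup C] [Module R C] [Coalgebra R C]

theorem isCohom_coendUnitHom (X : LeftComodule R C) [X.QuasiFinite] :
    IsCohom X.coendUnitHom := fun _ _ _ f =>
  ⟨X.coendLift f, hom_ext (X.coendLift_spec f), fun _ hg => X.coend_ext
    ((congrArg Hom.lin hg).trans (X.coendLift_spec f).symm)⟩

theorem tensorMap_id {V : Type u} [AddCommGroup V] [Module R V] (M : LeftComodule R C) :
    tensorMap M (LinearMap.id : V →ₗ[R] V) = 𝟙 _ :=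
  hom_ext (LinearMap.lTensor_id M.carrier V)

theorem IsCohom.bijective {X M : LeftComodule R C} {H : Type u} [AddCommGroup H] [Module R H]
    {η : M ⟶ tensor X H} (h : IsCohom η) {H' : Type u} [AddCommGroup H'] [Module R H']
    {η' : M ⟶ tensor X H'} (h' : IsCohom η') {e : H →ₗ[R] H'} (hη : η ≫ tensorMap X e = η') :
    Function.Bijective e := by
  obtain ⟨e', he', -⟩ := h' H η
  have h1 : e' ∘ₗ e = LinearMap.id := (h H η).unique
    (by rw [tensorMap_comp, ← Category.assoc, hη, he']) (by rw [tensorMap_id, Category.comp_id])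
  have h2 : e ∘ₗ e' = LinearMap.id := (h' H' η').unique
    (by rw [tensorMap_comp, ← Category.assoc, he', hη]) (by rw [tensorMap_id, Category.comp_id])
  exact Function.bijective_iff_has_inverse.2
    ⟨e', fun x => LinearMap.congr_fun h1 x, fun x => LinearMap.congr_fun h2 x⟩

end LeftComodule

namespace Bicomodule

variable {R : Type u} [CommRing R] {C : Type u} [AddCommGroup C] [Module R C] [Coalgebra R C]
  {D : Type u} [AddCommGroup D] [Module R D] [Coalgebra R D]

/-- The right coaction of a bicomodule as a map of left comodules. -/
def rcoactHom (X : Bicomodule R C D) : X.toLeft ⟶ LeftComodule.tensor X.toLeft D where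
  lin := X.rcoact
  comm := X.compat

/-- The isomorphism `e_D(X) ≅ C` carries the universal arrow `η_X` to the given coaction. Only
bijectivity and compatibility with the coactions matter here; the converse is
`rightCoendIso_of_isCohom`. -/
theorem isCohom_lcoactHom_of_rightCoendIso {X : Bicomodule R C D} [X.toRight.QuasiFinite]
    (h : X.RightCoendIso) : RightComodule.IsCohom X.lcoactHom := by
  obtain ⟨φ, hφ⟩ := h
  exact X.toRight.isCohom_coendUnitHom.of_bijective
    (e := (φ : X.toRight.Coend →ₗ[R] C)) φ.bijective (RightComodule.hom_ext hφ)

/-- Both arrows being universal, the comparison map `φ` is bijective. It respects counit and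
comultiplication because maps out of `e_C(X)` are determined after `η_X`, where these
compatibilities become the axioms of the right coaction. -/
theorem leftCoendIso_of_isCohom {X : Bicomodule R C D} [X.toLeft.QuasiFinite]
    (h : LeftComodule.IsCohom X.rcoactHom) : X.LeftCoendIso := by
  let E := X.toLeft.Coend
  let η : X.carrier →ₗ[R] X.carrier ⊗[R] E := X.toLeft.coendUnit
  let φ : E →ₗ[R] D := X.toLeft.coendLift X.rcoactHom
  have hφ : φ.lTensor X.carrier ∘ₗ η = X.rcoact := X.toLeft.coendLift_spec X.rcoactHom
  have hφ' (x : X.carrier) : X.rcoact x = φ.lTensor X.carrier (η x) :=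
    (LinearMap.congr_fun hφ x).symm
  have hb : Function.Bijective φ := X.toLeft.isCohom_coendUnitHom.bijective h
    (LeftComodule.hom_ext hφ)
  have hε : Coalgebra.counit ∘ₗ φ = CoalgebraStruct.counit (R := R) (A := E) := by
    refine X.toLeft.coend_ext ?_
    refine Eq.trans ?_ X.toLeft.coend_counit.symm
    rw [LinearMap.lTensor_comp, LinearMap.comp_assoc]
    exact (congrArg _ hφ).trans X.rcounit
  have hΔ : TensorProduct.map φ φ ∘ₗ CoalgebraStruct.comul (R := R) (A := E) =
      Coalgebra.comul ∘ₗ φ := by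
    refine X.toLeft.coend_ext (LinearMap.ext fun (x : X.carrier) => ?_)
    have h1 : (CoalgebraStruct.comul (R := R) (A := E)).lTensor X.carrier (η x) =
        TensorProduct.assoc R X.carrier E E (η.rTensor E (η x)) :=
      LinearMap.congr_fun X.toLeft.coend_comul x
    have h2 : TensorProduct.assoc R X.carrier D D (X.rcoact.rTensor D (X.rcoact x)) =
        Coalgebra.comul.lTensor X.carrier (X.rcoact x) := LinearMap.congr_fun X.rcoassoc x
    have h3 : (TensorProduct.map φ φ).lTensor X.carrier
        (TensorProduct.assoc R X.carrier E E (η.rTensor E (η x))) =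
        TensorProduct.assoc R X.carrier D D (X.rcoact.rTensor D (X.rcoact x)) := by
      rw [hφ' x]
      generalize η x = z
      induction z with
      | zero => simp
      | add a b ha hb => simp only [map_add, ha, hb]
      | tmul x e =>
        simp only [LinearMap.rTensor_tmul, LinearMap.lTensor_tmul]
        rw [hφ' x]
        generalize η x = z
        induction z <;> simp_all [tmul_add, add_tmul]
    have h4 : (TensorProduct.map φ φ ∘ₗ CoalgebraStruct.comul (R := R) (A := E)).lTensor
        X.carrier (η x) = (Coalgebra.comul ∘ₗ φ).lTensor X.carrier (η x) := by
      rw [LinearMap.lTensor_comp_apply, LinearMap.lTensor_comp_apply, h1, h3, h2, hφ' x]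
    exact h4
  let ψ : E →ₗc[R] D := { φ with counit_comp := hε, map_comp_comul := hΔ }
  exact ⟨{ ψ with
    invFun := (LinearEquiv.ofBijective φ hb).symm
    left_inv := (LinearEquiv.ofBijective φ hb).left_inv
    right_inv := (LinearEquiv.ofBijective φ hb).right_inv }, hφ⟩

namespace InverseData

variable [Module.Flat R C] {X : Bicomodule R C D}

/-- The universal arrow of `P = X` ends in `X ⊗ (Y □ X)`, and `u` identifies `D` with `Y □ X`. By
the first triangle identity the arrow is then the right coaction. -/
theorem isCohom_rcoactHom (I : X.InverseData) : LeftComodule.IsCohom X.rcoactHom := by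
  have hu (d : D) : I.u d ∈ cotensor I.Y X.toLeft := I.u_range ▸ LinearMap.mem_range_self _ d
  let e : D →ₗ[R] cotensor I.Y X.toLeft := I.u.codRestrict _ hu
  have he : Function.Bijective e := by
    refine ⟨fun a b h => I.u_injective (congrArg Subtype.val h), fun z => ?_⟩
    have hz : z.1 ∈ LinearMap.range I.u := by
      rw [I.u_range]
      exact z.2
    obtain ⟨d, hd⟩ := hz
    exact ⟨d, Subtype.ext hd⟩
  refine (I.isCohom_arrow X.toLeft).of_bijective he (LeftComodule.hom_ext ?_)
  have := I.flat_left
  refine LinearMap.ext fun (x : X.carrier) => Module.Flat.lTensor_preserves_injective_linearMap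
    (M := X.carrier) _ (cotensor I.Y X.toLeft).injective_subtype ?_
  refine Eq.trans ?_ (I.lTensor_arrow X.toLeft x).symm
  refine (LinearMap.lTensor_comp_apply X.carrier (cotensor I.Y X.toLeft).subtype e
    (X.rcoact x)).symm.trans ?_
  exact ((TensorProduct.assoc R X.carrier I.Y.carrier X.carrier).eq_symm_apply.1
    (I.rTensor_c x)).symm

theorem quasiFinite (I : X.InverseData) : X.toLeft.QuasiFinite :=
  X.toLeft.quasiFinite_of_isCohom fun P =>
    ⟨cotensor I.Y P, inferInstance, inferInstance, I.arrow P, I.isCohom_arrow P⟩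

theorem arrow_naturality (I : X.InverseData) {P Q : LeftComodule R C} (f : P ⟶ Q) :
    f ≫ I.arrow Q = I.arrow P ≫ LeftComodule.tensorMap X.toLeft (cotensorMapRight I.Y f) := by
  have : Module.Flat R X.toLeft.carrier := I.flat_left
  have : Mono (LeftComodule.tensorMap X.toLeft (cotensor I.Y Q).subtype) :=
    LeftComodule.mono_of_injective _ (Module.Flat.lTensor_preserves_injective_linearMap
      (M := X.toLeft.carrier) _ (cotensor I.Y Q).injective_subtype)
  have h : (cotensor I.Y Q).subtype ∘ₗ cotensorMapRight I.Y f =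
      f.lin.lTensor I.Y.carrier ∘ₗ (cotensor I.Y P).subtype := rfl
  rw [← cancel_mono (LeftComodule.tensorMap X.toLeft (cotensor I.Y Q).subtype), Category.assoc,
    Category.assoc, ← LeftComodule.tensorMap_comp, h, LeftComodule.tensorMap_comp, arrow_subtype,
    ← Category.assoc, arrow_subtype]
  refine LeftComodule.hom_ext (LinearMap.ext fun p => ?_)
  refine (congrArg (fun z => TensorProduct.assoc R X.carrier I.Y.carrier Q.carrier
    (I.c.rTensor Q.carrier z)) (LeftComodule.comm_apply f p)).trans ?_
  exact (assoc_rTensor_lTensor I.c f.lin (P.coact p)).symm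

/-- `X ⊗ -` is right adjoint to `Y □ -`, which preserves injective maps because `Y` is flat; hence
`X ⊗ -` preserves injective objects. -/
theorem isInjector (I : X.InverseData) : X.toLeft.IsInjector := by
  intro W hW
  refine ⟨fun {P Q} (f : P ⟶ LeftComodule.tensor X.toLeft W) i _ => ?_⟩
  have := I.flat_right
  have hi : Function.Injective (cotensorMapRight I.Y i) := fun a b hab =>
    Subtype.ext (Module.Flat.lTensor_preserves_injective_linearMap (M := I.Y.carrier) i.lin
      (LeftComodule.injective_of_mono i) (congrArg Subtype.val hab))
  obtain ⟨g, hg, -⟩ := I.isCohom_arrow P W f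
  have : Mono (ModuleCat.ofHom (cotensorMapRight I.Y i)) := (ModuleCat.mono_iff_injective _).2 hi
  have hk := Injective.comp_factorThru (ModuleCat.ofHom g : _ ⟶ W)
    (ModuleCat.ofHom (cotensorMapRight I.Y i))
  refine ⟨I.arrow Q ≫ LeftComodule.tensorMap X.toLeft (Injective.factorThru
    (ModuleCat.ofHom g : _ ⟶ W) (ModuleCat.ofHom (cotensorMapRight I.Y i))).hom, ?_⟩
  refine (Category.assoc _ _ _).symm.trans ?_
  rw [I.arrow_naturality]
  refine (Category.assoc _ _ _).trans (Eq.trans ?_ hg)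
  refine (congrArg (I.arrow P ≫ ·) (LeftComodule.tensorMap_comp X.toLeft _ _).symm).trans ?_
  exact congrArg (fun k => I.arrow P ≫ LeftComodule.tensorMap X.toLeft k)
    (congrArg ModuleCat.Hom.hom hk)

end InverseData

/-- Left exactness comes from flatness of `X`. Surjectivity and faithfulness come from the
equivalence, since epimorphisms of comodules are the surjective colinear maps and `- □ X` has the
same linear maps whether its values are taken in comodules or in modules. -/
theorem faithfullyCoflat_toLeft [Module.Flat R C] [Module.Flat R D] {X : Bicomodule R C D}
    (hX : X.Invertible) : X.toLeft.FaithfullyCoflat := by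
  have : X.cotensorRight.IsEquivalence := hX
  have fX : Module.Flat R X.toLeft.carrier := flat_of_invertible hX
  have hinj {M N : RightComodule R C} (f : M ⟶ N) (hf : Function.Injective f.lin) :
      Function.Injective (cotensorMapLeft f X.toLeft) := fun a b hab =>
    Subtype.ext (Module.Flat.rTensor_preserves_injective_linearMap (M := X.toLeft.carrier) f.lin hf
      (congrArg Subtype.val hab))
  refine ⟨fun M₁ M₂ M₃ f g hf hfg hg => ⟨hinj f hf, fun z => ?_, ?_⟩, ⟨fun {M N f g} h => ?_⟩⟩
  · constructor
    · intro hz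
      obtain ⟨w, hw⟩ := (Module.Flat.rTensor_exact X.toLeft.carrier hfg z.1).1 (congrArg Subtype.val hz)
      refine ⟨⟨w, ?_⟩, Subtype.ext hw⟩
      -- The preimage `w` given by exactness of `- ⊗ X` lies in `M₁ □ X`, because `f ⊗ C ⊗ X` is
      -- injective and its value on the defect of `w` is the defect of `z`.
      have hf' : Function.Injective (f.lin.rTensor (C ⊗[R] X.toLeft.carrier)) :=
        Module.Flat.rTensor_preserves_injective_linearMap _ hf
      refine hf' ?_
      rw [map_zero]
      refine (LinearMap.congr_fun (cotensorDiff_rTensor f X.toLeft) w).symm.trans ?_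
      exact (congrArg (cotensorDiff M₂ X.toLeft) hw).trans z.2
    · rintro ⟨w, rfl⟩
      exact Subtype.ext ((Module.Flat.rTensor_exact X.toLeft.carrier hfg _).2 ⟨w.1, rfl⟩)
  · have : Epi g := RightComodule.epi_of_surjective g hg
    exact RightComodule.surjective_of_epi (X.cotensorRight.map g)
  · refine X.cotensorRight.map_injective (RightComodule.hom_ext ?_)
    exact congrArg ModuleCat.Hom.hom h

theorem Invertible.left [Module.Flat R C] [Module.Flat R D] {X : Bicomodule R C D}
    (hX : X.Invertible) : ∃ _ : X.toLeft.QuasiFinite,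
      X.toLeft.FaithfullyCoflat ∧ X.toLeft.IsInjector ∧ X.LeftCoendIso := by
  obtain ⟨I⟩ := hX.nonempty_inverseData
  have := I.quasiFinite
  exact ⟨this, faithfullyCoflat_toLeft hX, I.isInjector, leftCoendIso_of_isCohom I.isCohom_rcoactHom⟩

theorem invertible_of_right [Module.Flat R C] [Module.Flat R D] {X : Bicomodule R C D}
    (h : ∃ _ : X.toRight.QuasiFinite,
      X.toRight.FaithfullyCoflat ∧ X.toRight.IsInjector ∧ X.RightCoendIso) : X.Invertible := by
  obtain ⟨hq, hf, hi, hc⟩ := h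
  exact invertible_of_isCohom_lcoactHom hq hf hi (isCohom_lcoactHom_of_rightCoendIso hc)

end Bicomodule

/-! ### Exchanging left and right comodules along an anti-isomorphism -/

/-- Anti-isomorphisms of coalgebras. -/
structure CoalgAntiEquiv (R : Type u) [CommRing R] (A : Type u) [AddCommGroup A] [Module R A]
    [Coalgebra R A] (A' : Type u) [AddCommGroup A'] [Module R A'] [Coalgebra R A'] where
  equiv : A ≃ₗ[R] A'
  counit_apply : ∀ a, Coalgebra.counit (R := R) (equiv a) = Coalgebra.counit (R := R) a
  comul_apply : ∀ a, Coalgebra.comul (R := R) (equiv a) =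
    TensorProduct.congr equiv equiv (TensorProduct.comm R A A (Coalgebra.comul (R := R) a))

namespace CoalgAntiEquiv

variable {R : Type u} [CommRing R] {A : Type u} [AddCommGroup A] [Module R A] [Coalgebra R A]
  {A' : Type u} [AddCommGroup A'] [Module R A'] [Coalgebra R A'] (σ : CoalgAntiEquiv R A A')

/-- The inverse of an anti-isomorphism. -/
def symm : CoalgAntiEquiv R A' A where
  equiv := σ.equiv.symm
  counit_apply a := by
    obtain ⟨a, rfl⟩ := σ.equiv.surjective a
    rw [LinearEquiv.symm_apply_apply, σ.counit_apply]
  comul_apply a := by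
    obtain ⟨a, rfl⟩ := σ.equiv.surjective a
    rw [LinearEquiv.symm_apply_apply, σ.comul_apply]
    generalize Coalgebra.comul (R := R) a = z
    induction z with
    | zero => simp
    | add a b ha hb => rw [map_add, map_add, map_add, map_add, ← ha, ← hb]
    | tmul a b => simp

@[simp] theorem symm_equiv : σ.symm.equiv = σ.equiv.symm := rfl

/-- The isomorphism `A ⊗ M ≃ M ⊗ A'`. -/
def flipRight (M : Type u) [AddCommGroup M] [Module R M] : A ⊗[R] M ≃ₗ[R] M ⊗[R] A' :=
  TensorProduct.comm R A M ≪≫ₗ TensorProduct.congr (LinearEquiv.refl R M) σ.equiv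

/-- The isomorphism `M ⊗ A ≃ A' ⊗ M`. -/
def flipLeft (M : Type u) [AddCommGroup M] [Module R M] : M ⊗[R] A ≃ₗ[R] A' ⊗[R] M :=
  TensorProduct.comm R M A ≪≫ₗ TensorProduct.congr σ.equiv (LinearEquiv.refl R M)

variable {M N : Type u} [AddCommGroup M] [Module R M] [AddCommGroup N] [Module R N]

@[simp] theorem flipRight_tmul (a : A) (m : M) : σ.flipRight M (a ⊗ₜ m) = m ⊗ₜ σ.equiv a := rfl

@[simp] theorem flipLeft_tmul (m : M) (a : A) : σ.flipLeft M (m ⊗ₜ a) = σ.equiv a ⊗ₜ m := rfl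

theorem flipRight_symm_flipLeft (z : M ⊗[R] A) : σ.symm.flipRight M (σ.flipLeft M z) = z := by
  induction z <;> simp_all

theorem flipLeft_symm_flipRight (z : A ⊗[R] M) : σ.symm.flipLeft M (σ.flipRight M z) = z := by
  induction z <;> simp_all

theorem flipLeft_flipRight_symm (z : A' ⊗[R] M) : σ.flipLeft M (σ.symm.flipRight M z) = z := by
  induction z <;> simp_all

theorem flipRight_lTensor (f : M →ₗ[R] N) (z : A ⊗[R] M) :
    σ.flipRight N (f.lTensor A z) = f.rTensor A' (σ.flipRight M z) := by
  induction z <;> simp_all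

/-- The right comodule over `A'` given by a left comodule over `A`. -/
def rightObj (M : LeftComodule R A) : RightComodule R A' where
  carrier := M.carrier
  coact := (σ.flipRight M.carrier).toLinearMap ∘ₗ M.coact
  coassoc := by
    refine LinearMap.ext fun m => ?_
    have h := LinearMap.congr_fun M.coassoc m
    simp only [LinearMap.comp_apply, LinearEquiv.coe_coe] at h ⊢
    rw [← LinearEquiv.eq_symm_apply] at h
    trans TensorProduct.comm R (A' ⊗[R] A') M.carrier ((TensorProduct.congr (TensorProduct.comm R A A
      ≪≫ₗ TensorProduct.congr σ.equiv σ.equiv) (LinearEquiv.refl R M.carrier))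
        ((Coalgebra.comul (R := R)).rTensor M.carrier (M.coact m)))
    · rw [h]
      generalize M.coact m = z
      induction z with
      | zero => simp
      | add a b ha hb => simp only [map_add, ha, hb]
      | tmul a m =>
        simp only [flipRight_tmul, LinearMap.rTensor_tmul, LinearMap.lTensor_tmul,
          LinearMap.comp_apply, LinearEquiv.coe_coe]
        generalize M.coact m = z
        induction z <;> simp_all [tmul_add, add_tmul]
    · generalize M.coact m = z
      induction z with
      | zero => simp
      | add a b ha hb => simp only [map_add, ha, hb]
      | tmul a m => simp [σ.comul_apply]
  counit := by
    refine LinearMap.ext fun m => ?_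
    have h := LinearMap.congr_fun M.counit m
    simp only [LinearMap.comp_apply, LinearEquiv.coe_coe, LinearMap.flip_apply,
      TensorProduct.mk_apply] at h ⊢
    trans TensorProduct.comm R R M.carrier ((Coalgebra.counit (R := R)).rTensor M.carrier
      (M.coact m))
    · generalize M.coact m = z
      induction z with
      | zero => simp
      | add a b ha hb => simp only [map_add, ha, hb]
      | tmul a m => simp [σ.counit_apply]
    · rw [h, TensorProduct.comm_tmul]

/-- The left comodule over `A'` given by a right comodule over `A`. -/
def leftObj (M : RightComodule R A) : LeftComodule R A' where
  carrier := M.carrier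
  coact := (σ.flipLeft M.carrier).toLinearMap ∘ₗ M.coact
  coassoc := by
    refine LinearMap.ext fun m => ?_
    have h := LinearMap.congr_fun M.coassoc m
    simp only [LinearMap.comp_apply, LinearEquiv.coe_coe] at h ⊢
    trans TensorProduct.assoc R A' A' M.carrier (TensorProduct.comm R M.carrier (A' ⊗[R] A')
      ((TensorProduct.congr (LinearEquiv.refl R M.carrier) (TensorProduct.comm R A A
      ≪≫ₗ TensorProduct.congr σ.equiv σ.equiv))
        ((Coalgebra.comul (R := R)).lTensor M.carrier (M.coact m))))
    · generalize M.coact m = z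
      induction z with
      | zero => simp
      | add a b ha hb => simp only [map_add, ha, hb]
      | tmul a m => simp [σ.comul_apply]
    · rw [← h]
      generalize M.coact m = z
      induction z with
      | zero => simp
      | add a b ha hb => simp only [map_add, ha, hb]
      | tmul m a =>
        simp only [flipLeft_tmul, LinearMap.rTensor_tmul, LinearMap.lTensor_tmul,
          LinearMap.comp_apply, LinearEquiv.coe_coe]
        generalize M.coact m = z
        induction z <;> simp_all [tmul_add, add_tmul]
  counit := by
    refine LinearMap.ext fun m => ?_
    have h := LinearMap.congr_fun M.counit m
    simp only [LinearMap.comp_apply, LinearEquiv.coe_coe, LinearMap.flip_apply,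
      TensorProduct.mk_apply] at h ⊢
    trans TensorProduct.comm R M.carrier R ((Coalgebra.counit (R := R)).lTensor M.carrier
      (M.coact m))
    · generalize M.coact m = z
      induction z with
      | zero => simp
      | add a b ha hb => simp only [map_add, ha, hb]
      | tmul a m => simp [σ.counit_apply]
    · rw [h, TensorProduct.comm_tmul]

/-- Left comodules over `A` as right comodules over `A'`. -/
def rightFunctor : LeftComodule R A ⥤ RightComodule R A' where
  obj M := σ.rightObj M
  map {M N} f :=
    { lin := f.lin
      comm := LinearMap.ext fun m => (congrArg (σ.flipRight N.carrier)
        (LeftComodule.comm_apply f m)).trans (σ.flipRight_lTensor f.lin (M.coact m)) }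

instance : σ.rightFunctor.Faithful where
  map_injective h := LeftComodule.hom_ext (congrArg RightComodule.Hom.lin h)

instance : σ.rightFunctor.Full where
  map_surjective {M N} f := ⟨⟨f.lin, LinearMap.ext fun (m : M.carrier) =>
    (σ.flipRight N.carrier).injective ((RightComodule.comm_apply f m).trans
      (σ.flipRight_lTensor f.lin (M.coact m)).symm)⟩, rfl⟩

theorem rightObj_symm_leftObj (M : RightComodule R A) : σ.symm.rightObj (σ.leftObj M) = M := by
  obtain ⟨c, ρ, h1, h2⟩ := M
  have h : (σ.symm.flipRight c).toLinearMap ∘ₗ (σ.flipLeft c).toLinearMap ∘ₗ ρ = ρ :=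
    LinearMap.ext fun m => σ.flipRight_symm_flipLeft (ρ m)
  have aux : ∀ ρ' h1' h2', ρ' = ρ → RightComodule.mk c ρ' h1' h2' = RightComodule.mk c ρ h1 h2 := by
    rintro _ _ _ rfl
    rfl
  exact aux _ _ _ h

theorem rightObj_leftObj_symm (M : RightComodule R A') : σ.rightObj (σ.symm.leftObj M) = M :=
  σ.symm.rightObj_symm_leftObj M

instance : σ.rightFunctor.EssSurj where
  mem_essImage M := ⟨σ.symm.leftObj M, ⟨eqToIso (σ.rightObj_leftObj_symm M)⟩⟩

instance : σ.rightFunctor.IsEquivalence where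

/-- `M ⊗ W` and `W ⊗ M` correspond to each other. -/
def tensorIso (M : LeftComodule R A) (W : Type u) [AddCommGroup W] [Module R W] :
    σ.rightFunctor.obj (LeftComodule.tensor M W) ≅ RightComodule.tensor W (σ.rightObj M) :=
  RightComodule.isoOfBijective
    { lin := (TensorProduct.comm R M.carrier W).toLinearMap
      comm := by
        have key : ((TensorProduct.assoc R W M.carrier A').symm.toLinearMap ∘ₗ
                ((σ.flipRight M.carrier).toLinearMap ∘ₗ M.coact).lTensor W) ∘ₗ
              (TensorProduct.comm R M.carrier W).toLinearMap =
            (TensorProduct.comm R M.carrier W).toLinearMap.rTensor A' ∘ₗ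
              (σ.flipRight (M.carrier ⊗[R] W)).toLinearMap ∘ₗ
                (TensorProduct.assoc R A M.carrier W).toLinearMap ∘ₗ M.coact.rTensor W := by
          refine TensorProduct.ext' fun m w => ?_
          simp only [LinearMap.comp_apply, LinearEquiv.coe_coe, LinearMap.lTensor_tmul,
            TensorProduct.comm_tmul, LinearMap.rTensor_tmul]
          generalize M.coact m = z
          induction z <;> simp_all [tmul_add, add_tmul]
        exact key }
    (TensorProduct.comm R M.carrier W).bijective

/-- The functors `M ⊗ -` and `- ⊗ M` correspond to each other. -/
def tensorFunctorIso (M : LeftComodule R A) :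
    M.tensorFunctor ⋙ σ.rightFunctor ≅ (σ.rightObj M).tensorFunctor :=
  NatIso.ofComponents (fun W => σ.tensorIso M W) fun {V W} f => by
    have key : (TensorProduct.comm R M.carrier W).toLinearMap ∘ₗ f.hom.lTensor M.carrier =
        f.hom.rTensor M.carrier ∘ₗ (TensorProduct.comm R M.carrier V).toLinearMap :=
      TensorProduct.ext' fun _ _ => rfl
    exact RightComodule.hom_ext key

theorem quasiFinite_rightObj (M : LeftComodule R A) [M.QuasiFinite] :
    (σ.rightObj M).QuasiFinite := by
  have : (M.tensorFunctor ⋙ σ.rightFunctor).IsRightAdjoint := inferInstance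
  exact Functor.isRightAdjoint_of_iso (σ.tensorFunctorIso M)

theorem isInjector_rightObj {M : LeftComodule R A} (h : M.IsInjector) :
    (σ.rightObj M).IsInjector := fun W hW => by
  have := h W hW
  have : Injective (σ.rightFunctor.obj (M.tensorFunctor.obj W)) :=
    Injective.injective_of_adjoint σ.rightFunctor.asEquivalence.symm.toAdjunction _
  exact Injective.of_iso ((σ.tensorFunctorIso M).app W) this

/-- The isomorphism `M ⊗ (A ⊗ N) ≃ N ⊗ (A' ⊗ M)`. -/
def flipTriple (M N : Type u) [AddCommGroup M] [Module R M] [AddCommGroup N] [Module R N] :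
    M ⊗[R] (A ⊗[R] N) ≃ₗ[R] N ⊗[R] (A' ⊗[R] M) :=
  (TensorProduct.assoc R M A N).symm ≪≫ₗ TensorProduct.comm R (M ⊗[R] A) N ≪≫ₗ
    TensorProduct.congr (LinearEquiv.refl R N) (σ.flipLeft M)

/-- The swap `M ⊗ N → N ⊗ M` exchanges the two sides of the cotensor condition. Bare coactions are
used so that the same computation serves `mem_cotensor_right_left` and `mem_cotensor_right_right`.
-/
theorem comm_mem_cotensor_iff {m : M →ₗ[R] M ⊗[R] A} {n : N →ₗ[R] A ⊗[R] N}
    {l : M →ₗ[R] A' ⊗[R] M} {r : N →ₗ[R] N ⊗[R] A'} (hl : ∀ x, l x = σ.flipLeft M (m x))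
    (hr : ∀ x, r x = σ.flipRight N (n x)) (z : M ⊗[R] N) :
    TensorProduct.assoc R N A' M (r.rTensor M (TensorProduct.comm R M N z)) =
        l.lTensor N (TensorProduct.comm R M N z) ↔
      TensorProduct.assoc R M A N (m.rTensor N z) = n.lTensor M z := by
  have h1 : TensorProduct.assoc R N A' M (r.rTensor M (TensorProduct.comm R M N z)) =
      σ.flipTriple M N (n.lTensor M z) := by
    induction z with
    | zero => simp
    | add a b ha hb => simp only [map_add, ha, hb]
    | tmul x y =>
      simp only [TensorProduct.comm_tmul, LinearMap.rTensor_tmul, LinearMap.lTensor_tmul, hr]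
      generalize n y = w
      induction w with
      | zero => simp
      | add a b ha hb => simp only [tmul_add, add_tmul, map_add, ha, hb]
      | tmul a b => simp [flipTriple]
  have h2 : l.lTensor N (TensorProduct.comm R M N z) =
      σ.flipTriple M N (TensorProduct.assoc R M A N (m.rTensor N z)) := by
    clear h1
    induction z with
    | zero => simp
    | add a b ha hb => simp only [map_add, ha, hb]
    | tmul x y =>
      simp only [TensorProduct.comm_tmul, LinearMap.rTensor_tmul, LinearMap.lTensor_tmul, hl]
      simp [flipTriple]
  rw [h1, h2, (σ.flipTriple M N).injective.eq_iff, eq_comm]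

theorem mem_cotensor_right_left (M : RightComodule R A) (N : LeftComodule R A)
    (z : M.carrier ⊗[R] N.carrier) :
    TensorProduct.comm R M.carrier N.carrier z ∈ cotensor (σ.rightObj N) (σ.leftObj M) ↔
      z ∈ cotensor M N :=
  (mem_cotensor (σ.rightObj N) (σ.leftObj M) _).trans ((σ.comm_mem_cotensor_iff (m := M.coact)
    (n := N.coact) (l := (σ.leftObj M).coact) (r := (σ.rightObj N).coact) (fun _ => rfl)
    (fun _ => rfl) z).trans (mem_cotensor M N z).symm)

theorem mem_cotensor_right_right (M : LeftComodule R A') (N : LeftComodule R A)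
    (z : M.carrier ⊗[R] N.carrier) :
    TensorProduct.comm R M.carrier N.carrier z ∈ cotensor (σ.rightObj N) M ↔
      z ∈ cotensor (σ.symm.rightObj M) N :=
  (mem_cotensor (σ.rightObj N) M _).trans ((σ.comm_mem_cotensor_iff
    (m := (σ.symm.rightObj M).coact) (n := N.coact) (l := M.coact) (r := (σ.rightObj N).coact)
    (fun x => (σ.flipLeft_flipRight_symm (M.coact x)).symm) (fun _ => rfl) z).trans
    (mem_cotensor (σ.symm.rightObj M) N z).symm)

/-- The isomorphism between cotensor products given by an anti-isomorphism. -/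
def cotensorEquiv (M : LeftComodule R A') (N : LeftComodule R A) :
    cotensor (σ.symm.rightObj M) N ≃ₗ[R] cotensor (σ.rightObj N) M :=
  (TensorProduct.comm R M.carrier N.carrier).ofSubmodules _ _ (by
    refine Submodule.ext fun z => ?_
    obtain ⟨z, rfl⟩ := (TensorProduct.comm R M.carrier N.carrier).surjective z
    refine Iff.trans ?_ (σ.mem_cotensor_right_right M N z).symm
    refine (Submodule.mem_map_equiv (e := TensorProduct.comm R M.carrier N.carrier) _).trans ?_
    rw [LinearEquiv.symm_apply_apply]
    rfl)

theorem cotensorEquiv_naturality {M M' : LeftComodule R A'} (f : M ⟶ M') (N : LeftComodule R A)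
    (z : cotensor (σ.symm.rightObj M) N) :
    σ.cotensorEquiv M' N (cotensorMapLeft (σ.symm.rightFunctor.map f) N z) =
      cotensorMapRight (σ.rightObj N) f (σ.cotensorEquiv M N z) := by
  have key : (TensorProduct.comm R M'.carrier N.carrier).toLinearMap ∘ₗ f.lin.rTensor N.carrier =
      f.lin.lTensor N.carrier ∘ₗ (TensorProduct.comm R M.carrier N.carrier).toLinearMap :=
    TensorProduct.ext' fun _ _ => rfl
  exact Subtype.ext (LinearMap.congr_fun key z.1)

/-- Test comodules over `A'` are brought back to `A` by the inverse anti-isomorphism. This leaves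
the underlying linear maps unchanged, and the natural isomorphism `cotensorEquiv` transports
exactness and faithfulness. -/
theorem faithfullyCoflat_rightObj {N : LeftComodule R A} (h : N.FaithfullyCoflat) :
    (σ.rightObj N).FaithfullyCoflat := by
  have hn {M M' : LeftComodule R A'} (f : M ⟶ M') : ⇑(cotensorMapRight (σ.rightObj N) f) =
      σ.cotensorEquiv M' N ∘ cotensorMapLeft (σ.symm.rightFunctor.map f) N ∘
        (σ.cotensorEquiv M N).symm := by
    funext z
    obtain ⟨z, rfl⟩ := (σ.cotensorEquiv M N).surjective z
    refine (σ.cotensorEquiv_naturality f N z).symm.trans ?_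
    exact congrArg (fun w => σ.cotensorEquiv M' N (cotensorMapLeft (σ.symm.rightFunctor.map f) N w))
      ((σ.cotensorEquiv M N).symm_apply_apply z).symm
  refine ⟨fun M₁ M₂ M₃ f g hf hfg hg => ?_, ⟨fun {M M' f g} hfg => ?_⟩⟩
  · obtain ⟨h1, h2, h3⟩ := h.1 (σ.symm.rightFunctor.map f) (σ.symm.rightFunctor.map g) hf hfg hg
    refine ⟨?_, ?_, ?_⟩
    · rw [hn]
      exact (σ.cotensorEquiv M₂ N).injective.comp
        (h1.comp (σ.cotensorEquiv M₁ N).symm.injective)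
    · intro z
      obtain ⟨z, rfl⟩ := (σ.cotensorEquiv M₂ N).surjective z
      have hz : cotensorMapRight (σ.rightObj N) g (σ.cotensorEquiv M₂ N z) = 0 ↔
          cotensorMapLeft (σ.symm.rightFunctor.map g) N z = 0 :=
        ⟨fun h0 => (σ.cotensorEquiv M₃ N).injective ((σ.cotensorEquiv_naturality g N z).trans
          (h0.trans (map_zero _).symm)), fun h0 => (σ.cotensorEquiv_naturality g N z).symm.trans
            ((congrArg (σ.cotensorEquiv M₃ N) h0).trans (map_zero _))⟩
      refine hz.trans ((h2 z).trans ?_)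
      constructor
      · rintro ⟨w, rfl⟩
        exact ⟨σ.cotensorEquiv M₁ N w, (σ.cotensorEquiv_naturality f N w).symm⟩
      · rintro ⟨w, hw⟩
        obtain ⟨w, rfl⟩ := (σ.cotensorEquiv M₁ N).surjective w
        exact ⟨w, (σ.cotensorEquiv M₂ N).injective
          ((σ.cotensorEquiv_naturality f N w).trans hw)⟩
    · rw [hn]
      exact (σ.cotensorEquiv M₃ N).surjective.comp
        (h3.comp (σ.cotensorEquiv M₂ N).symm.surjective)
  · have := h.2
    refine σ.symm.rightFunctor.map_injective (N.cotensorFunctor.map_injective ?_)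
    refine ModuleCat.hom_ext (LinearMap.ext fun z => ?_)
    refine (σ.cotensorEquiv M' N).injective ?_
    refine (σ.cotensorEquiv_naturality f N z).trans (Eq.trans ?_
      (σ.cotensorEquiv_naturality g N z).symm)
    exact LinearMap.congr_fun (congrArg ModuleCat.Hom.hom hfg) _

end CoalgAntiEquiv

/-! ### Interchanging the two sides of a bicomodule -/

namespace Bicomodule

variable {R : Type u} [CommRing R] {C : Type u} [AddCommGroup C] [Module R C] [Coalgebra R C]
  {D : Type u} [AddCommGroup D] [Module R D] [Coalgebra R D]
  {C' : Type u} [AddCommGroup C'] [Module R C'] [Coalgebra R C']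
  {D' : Type u} [AddCommGroup D'] [Module R D'] [Coalgebra R D']

/-- A bicomodule with the two sides interchanged. -/
def op (X : Bicomodule R C D) (σ : CoalgAntiEquiv R C C') (τ : CoalgAntiEquiv R D D') :
    Bicomodule R D' C' where
  carrier := X.carrier
  lcoact := (τ.leftObj X.toRight).coact
  lcoassoc := (τ.leftObj X.toRight).coassoc
  lcounit := (τ.leftObj X.toRight).counit
  rcoact := (σ.rightObj X.toLeft).coact
  rcoassoc := (σ.rightObj X.toLeft).coassoc
  rcounit := (σ.rightObj X.toLeft).counit
  compat := by
    have key : (TensorProduct.assoc R D' X.carrier C').toLinearMap ∘ₗ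
        ((τ.flipLeft X.carrier).toLinearMap ∘ₗ X.rcoact).rTensor C' ∘ₗ
          (σ.flipRight X.carrier).toLinearMap ∘ₗ X.lcoact =
        ((σ.flipRight X.carrier).toLinearMap ∘ₗ X.lcoact).lTensor D' ∘ₗ
          (τ.flipLeft X.carrier).toLinearMap ∘ₗ X.rcoact := by
      refine LinearMap.ext fun x => ?_
      have h := LinearMap.congr_fun X.compat x
      simp only [LinearMap.comp_apply, LinearEquiv.coe_coe] at h ⊢
      trans TensorProduct.assoc R D' X.carrier C' ((TensorProduct.congr (τ.flipLeft X.carrier)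
        σ.equiv) (TensorProduct.comm R C (X.carrier ⊗[R] D) (X.rcoact.lTensor C (X.lcoact x))))
      · generalize X.lcoact x = z
        induction z <;> simp_all
      · rw [← h]
        generalize X.rcoact x = z
        induction z with
        | zero => simp
        | add a b ha hb => simp only [map_add, ha, hb]
        | tmul x d =>
          simp only [LinearMap.rTensor_tmul, CoalgAntiEquiv.flipLeft_tmul, LinearMap.lTensor_tmul,
            LinearMap.comp_apply, LinearEquiv.coe_coe]
          generalize X.lcoact x = z
          induction z <;> simp_all [tmul_add, add_tmul]
    exact key

/-- Allowing arbitrary anti-isomorphisms, and going back along their inverses, makes this an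
equality of bicomodules over the original `C` and `D`; iterating the co-opposite would change the
types of the coalgebras. -/
theorem op_op (X : Bicomodule R C D) (σ : CoalgAntiEquiv R C C') (τ : CoalgAntiEquiv R D D') :
    (X.op σ τ).op τ.symm σ.symm = X := by
  obtain ⟨c, l, h1, h2, r, h3, h4, h5⟩ := X
  have aux : ∀ l' r' h1' h2' h3' h4' h5', l' = l → r' = r →
      Bicomodule.mk c l' h1' h2' r' h3' h4' h5' = Bicomodule.mk c l h1 h2 r h3 h4 h5 := by
    rintro _ _ _ _ _ _ _ rfl rfl
    rfl
  exact aux _ _ _ _ _ _ _ (LinearMap.ext fun x => σ.flipLeft_symm_flipRight (l x))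
    (LinearMap.ext fun x => τ.flipRight_symm_flipLeft (r x))

section Cotensor

variable [Module.Flat R C] [Module.Flat R C'] (X : Bicomodule R C D)
  (σ : CoalgAntiEquiv R C C') (τ : CoalgAntiEquiv R D D')

/-- The canonical map `X □ P → P □ X`. -/
def opCotensorHom (P : LeftComodule R D) :
    σ.rightObj (X.cotensorLeft.obj P) ⟶ (X.op σ τ).cotensorRight.obj (τ.rightObj P) :=
  RightComodule.subLift _ ((X.op σ τ).coact_mem_right (τ.rightObj P))
    (σ.rightFunctor.map ((LeftComodule.tensor X.toLeft P.carrier).subHom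
      (cotensor X.toRight P) (X.coact_mem_left P)) ≫ (σ.tensorIso X.toLeft P.carrier).hom)
    fun z => (τ.mem_cotensor_right_left X.toRight P z.1).2 z.2

/-- The canonical isomorphism `X □ P ≅ P □ X`. -/
def opCotensorIso (P : LeftComodule R D) :
    σ.rightObj (X.cotensorLeft.obj P) ≅ (X.op σ τ).cotensorRight.obj (τ.rightObj P) :=
  RightComodule.isoOfBijective (X.opCotensorHom σ τ P) (by
    constructor
    · intro a b h
      exact Subtype.ext ((TensorProduct.comm R X.carrier P.carrier).injective
        (congrArg Subtype.val h))
    · rintro ⟨z, hz⟩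
      obtain ⟨z, rfl⟩ := (TensorProduct.comm R X.carrier P.carrier).surjective z
      exact ⟨⟨z, (τ.mem_cotensor_right_left X.toRight P z).1 hz⟩, rfl⟩)

/-- The functors `X □ -` and `- □ X` correspond to each other. -/
def opCotensorFunctorIso :
    X.cotensorLeft ⋙ σ.rightFunctor ≅ τ.rightFunctor ⋙ (X.op σ τ).cotensorRight :=
  NatIso.ofComponents (fun P => X.opCotensorIso σ τ P) fun {P Q} f => by
    have key : (TensorProduct.comm R X.carrier Q.carrier).toLinearMap ∘ₗ
        f.lin.lTensor X.carrier =
        f.lin.rTensor X.carrier ∘ₗ (TensorProduct.comm R X.carrier P.carrier).toLinearMap :=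
      TensorProduct.ext' fun _ _ => rfl
    exact RightComodule.hom_ext (LinearMap.ext fun z =>
      Subtype.ext (LinearMap.congr_fun key z.1))

/-- The two cotensor functors correspond under the equivalences `σ.rightFunctor` and
`τ.rightFunctor`, so two out of three applies. -/
theorem isEquivalence_cotensorLeft_iff :
    X.cotensorLeft.IsEquivalence ↔ (X.op σ τ).Invertible := by
  constructor
  · intro h
    have := Functor.isEquivalence_of_iso (X.opCotensorFunctorIso σ τ)
    exact Functor.isEquivalence_of_comp_left τ.rightFunctor _
  · intro h
    have : (X.op σ τ).cotensorRight.IsEquivalence := h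
    have := Functor.isEquivalence_of_iso (X.opCotensorFunctorIso σ τ).symm
    exact Functor.isEquivalence_of_comp_right _ σ.rightFunctor

end Cotensor

/-- The coendomorphism condition is transferred as a universal property, which avoids comparing the
coalgebras `e_C(X)` on the two sides. Factorizations correspond by precomposition with the inverse
of `τ`. -/
theorem isCohom_op_lcoactHom {X : Bicomodule R C D} (h : LeftComodule.IsCohom X.rcoactHom)
    (σ : CoalgAntiEquiv R C C') (τ : CoalgAntiEquiv R D D') :
    RightComodule.IsCohom (X.op σ τ).lcoactHom := by
  intro V _ _ f
  have hg (g : D →ₗ[R] V) (z : X.carrier ⊗[R] D) : TensorProduct.comm R X.carrier V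
      (g.lTensor X.carrier z) = (g ∘ₗ τ.equiv.symm.toLinearMap).rTensor X.carrier
        (τ.flipLeft X.carrier z) := by
    induction z <;> simp_all
  -- Fullness of `σ.rightFunctor` turns `f` into a map of left comodules, to which the hypothesis
  -- applies.
  obtain ⟨f', hf'⟩ : ∃ f' : X.toLeft ⟶ LeftComodule.tensor X.toLeft V,
      σ.rightFunctor.map f' = f ≫ (σ.tensorIso X.toLeft V).inv :=
    σ.rightFunctor.map_surjective _
  have hf'' : σ.rightFunctor.map f' ≫ (σ.tensorIso X.toLeft V).hom = f := by
    refine (congrArg (· ≫ (σ.tensorIso X.toLeft V).hom) hf').trans ?_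
    exact (Category.assoc _ _ _).trans ((congrArg (f ≫ ·) (Iso.inv_hom_id _)).trans
      (Category.comp_id f))
  have hf (x : X.carrier) : TensorProduct.comm R X.carrier V (f'.lin x) = f.lin x :=
    LinearMap.congr_fun (congrArg RightComodule.Hom.lin hf'') x
  obtain ⟨g, hg1, hg2⟩ := h V f'
  refine ⟨g ∘ₗ τ.equiv.symm.toLinearMap, RightComodule.hom_ext (LinearMap.ext fun x => ?_),
    fun k hk => ?_⟩
  · refine (hg g (X.rcoact x)).symm.trans (Eq.trans ?_ (hf x))
    exact congrArg _ (LinearMap.congr_fun (congrArg LeftComodule.Hom.lin hg1) x)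
  · have h1 : k ∘ₗ τ.equiv.toLinearMap = g := by
      refine hg2 _ (LeftComodule.hom_ext (LinearMap.ext fun (x : X.carrier) => ?_))
      refine (TensorProduct.comm R X.carrier V).injective ?_
      refine (hg _ (X.rcoact x)).trans (Eq.trans ?_ (hf x).symm)
      have h2 : (k ∘ₗ τ.equiv.toLinearMap) ∘ₗ τ.equiv.symm.toLinearMap = k :=
        LinearMap.ext fun d => congrArg k (τ.equiv.apply_symm_apply d)
      rw [h2]
      exact LinearMap.congr_fun (congrArg RightComodule.Hom.lin hk) x
    rw [← h1]
    exact LinearMap.ext fun d => (congrArg k (τ.equiv.apply_symm_apply d)).symm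

/-- The comparison map between two universal arrows is bijective, and uniqueness of factorizations
through `η_X` forces it to respect counit and comultiplication. -/
theorem rightCoendIso_of_isCohom {X : Bicomodule R C D} [X.toRight.QuasiFinite]
    (h : RightComodule.IsCohom X.lcoactHom) : X.RightCoendIso := by
  let E := X.toRight.Coend
  let η : X.carrier →ₗ[R] E ⊗[R] X.carrier := X.toRight.coendUnit
  let φ : E →ₗ[R] C := X.toRight.coendLift X.lcoactHom
  have hφ : φ.rTensor X.carrier ∘ₗ η = X.lcoact := X.toRight.coendLift_spec X.lcoactHom
  have hφ' (x : X.carrier) : X.lcoact x = φ.rTensor X.carrier (η x) :=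
    (LinearMap.congr_fun hφ x).symm
  have hb : Function.Bijective φ := X.toRight.isCohom_coendUnitHom.bijective h
    (RightComodule.hom_ext hφ)
  have hε : Coalgebra.counit ∘ₗ φ = CoalgebraStruct.counit (R := R) (A := E) := by
    refine X.toRight.coend_ext ?_
    refine Eq.trans ?_ X.toRight.coend_counit.symm
    rw [LinearMap.rTensor_comp, LinearMap.comp_assoc]
    exact (congrArg _ hφ).trans X.lcounit
  have hΔ : TensorProduct.map φ φ ∘ₗ CoalgebraStruct.comul (R := R) (A := E) =
      Coalgebra.comul ∘ₗ φ := by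
    refine X.toRight.coend_ext (LinearMap.ext fun (x : X.carrier) => ?_)
    have h1 : (CoalgebraStruct.comul (R := R) (A := E)).rTensor X.carrier (η x) =
        (TensorProduct.assoc R E E X.carrier).symm (η.lTensor E (η x)) :=
      LinearMap.congr_fun X.toRight.coend_comul x
    have h2 : Coalgebra.comul.rTensor X.carrier (X.lcoact x) =
        (TensorProduct.assoc R C C X.carrier).symm (X.lcoact.lTensor C (X.lcoact x)) :=
      (LinearEquiv.eq_symm_apply _).2 (LinearMap.congr_fun X.lcoassoc x)
    have h3 : (TensorProduct.map φ φ).rTensor X.carrier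
        ((TensorProduct.assoc R E E X.carrier).symm (η.lTensor E (η x))) =
        (TensorProduct.assoc R C C X.carrier).symm (X.lcoact.lTensor C (X.lcoact x)) := by
      rw [hφ' x]
      generalize η x = z
      induction z with
      | zero => simp
      | add a b ha hb => simp only [map_add, ha, hb]
      | tmul e x =>
        simp only [LinearMap.rTensor_tmul, LinearMap.lTensor_tmul]
        rw [hφ' x]
        generalize η x = z
        induction z <;> simp_all [tmul_add, add_tmul]
    have h4 : (TensorProduct.map φ φ ∘ₗ CoalgebraStruct.comul (R := R) (A := E)).rTensor
        X.carrier (η x) = (Coalgebra.comul ∘ₗ φ).rTensor X.carrier (η x) := by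
      rw [LinearMap.rTensor_comp_apply, LinearMap.rTensor_comp_apply, h1, h3, ← h2, hφ' x]
    exact h4
  let ψ : E →ₗc[R] C := { φ with counit_comp := hε, map_comp_comul := hΔ }
  exact ⟨{ ψ with
    invFun := (LinearEquiv.ofBijective φ hb).symm
    left_inv := (LinearEquiv.ofBijective φ hb).left_inv
    right_inv := (LinearEquiv.ofBijective φ hb).right_inv }, hφ⟩

theorem isCohom_rcoactHom_of_leftCoendIso {X : Bicomodule R C D} [X.toLeft.QuasiFinite]
    (h : X.LeftCoendIso) : LeftComodule.IsCohom X.rcoactHom := by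
  obtain ⟨φ, hφ⟩ := h
  have hs : (φ.toLinearEquiv.symm.toLinearMap ∘ₗ (φ : X.toLeft.Coend →ₗ[R] D)) = LinearMap.id :=
    LinearMap.ext fun e => φ.toLinearEquiv.symm_apply_apply e
  refine X.toLeft.isCohom_coendUnitHom.of_bijective (e := φ.toLinearEquiv.symm.toLinearMap)
    φ.toLinearEquiv.symm.bijective (LeftComodule.hom_ext ?_)
  obtain ⟨η, hη⟩ : ∃ η : X.carrier →ₗ[R] X.carrier ⊗[R] X.toLeft.Coend,
      η = X.toLeft.coendUnit := ⟨_, rfl⟩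
  have h1 : (φ : X.toLeft.Coend →ₗ[R] D).lTensor X.carrier ∘ₗ η = X.rcoact := hη ▸ hφ
  have h2 : φ.toLinearEquiv.symm.toLinearMap.lTensor X.carrier ∘ₗ X.rcoact = η := by
    rw [← h1, ← LinearMap.comp_assoc, ← LinearMap.lTensor_comp, hs, LinearMap.lTensor_id]
    rfl
  exact h2.trans hη

/-- The conditions on the left comodule `X` yield those on the right comodule `X.op`. -/
theorem right_op_of_left {X : Bicomodule R C D} (σ : CoalgAntiEquiv R C C')
    (τ : CoalgAntiEquiv R D D') (h : ∃ _ : X.toLeft.QuasiFinite,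
      X.toLeft.FaithfullyCoflat ∧ X.toLeft.IsInjector ∧ X.LeftCoendIso) :
    ∃ _ : (X.op σ τ).toRight.QuasiFinite, (X.op σ τ).toRight.FaithfullyCoflat ∧
      (X.op σ τ).toRight.IsInjector ∧ (X.op σ τ).RightCoendIso := by
  obtain ⟨hq, hf, hi, hc⟩ := h
  have hq' : (X.op σ τ).toRight.QuasiFinite := σ.quasiFinite_rightObj X.toLeft
  have h1 := isCohom_op_lcoactHom (isCohom_rcoactHom_of_leftCoendIso hc) σ τ
  have h2 := rightCoendIso_of_isCohom h1
  have h3 := σ.faithfullyCoflat_rightObj hf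
  have h4 := σ.isInjector_rightObj hi
  exact ⟨hq', h3, h4, h2⟩

end Bicomodule

/-! ### The co-opposite coalgebra and the main theorem -/

/-- The co-opposite coalgebra. -/
def Coopposite (C : Type u) : Type u := C

namespace Coopposite

variable (R : Type u) [CommRing R] (C : Type u) [AddCommGroup C] [Module R C]

instance : AddCommGroup (Coopposite C) := inferInstanceAs (AddCommGroup C)

instance : Module R (Coopposite C) := inferInstanceAs (Module R C)

instance [Module.Flat R C] : Module.Flat R (Coopposite C) := inferInstanceAs (Module.Flat R C)

variable [Coalgebra R C]

/-- The coalgebra structure with reversed comultiplication. -/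
abbrev coalgebra : Coalgebra R C where
  comul := (TensorProduct.comm R C C).toLinearMap ∘ₗ Coalgebra.comul
  counit := Coalgebra.counit
  coassoc := by
    refine LinearMap.ext fun c => ?_
    have h := LinearMap.congr_fun (Coalgebra.coassoc (R := R) (A := C)) c
    simp only [LinearMap.comp_apply, LinearEquiv.coe_coe] at h ⊢
    rw [← LinearEquiv.eq_symm_apply] at h
    trans TensorProduct.comm R (C ⊗[R] C) C (TensorProduct.congr (TensorProduct.comm R C C)
      (LinearEquiv.refl R C) (Coalgebra.comul.rTensor C (Coalgebra.comul (R := R) c)))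
    · rw [h]
      generalize Coalgebra.comul (R := R) c = z
      induction z with
      | zero => simp
      | add a b ha hb => simp only [map_add, ha, hb]
      | tmul a b =>
        simp only [TensorProduct.comm_tmul, LinearMap.rTensor_tmul, LinearMap.lTensor_tmul,
          LinearMap.comp_apply, LinearEquiv.coe_coe]
        generalize Coalgebra.comul (R := R) b = z
        induction z <;> simp_all [tmul_add, add_tmul]
    · generalize Coalgebra.comul (R := R) c = z
      induction z with
      | zero => simp
      | add a b ha hb => simp only [map_add, ha, hb]
      | tmul a b => simp
  rTensor_counit_comp_comul := by
    refine LinearMap.ext fun c => ?_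
    have h := LinearMap.congr_fun (Coalgebra.lTensor_counit_comp_comul (R := R) (A := C)) c
    simp only [LinearMap.comp_apply, LinearEquiv.coe_coe] at h ⊢
    trans TensorProduct.comm R C R (Coalgebra.counit.lTensor C (Coalgebra.comul (R := R) c))
    · generalize Coalgebra.comul (R := R) c = z
      induction z <;> simp_all
    · rw [h]; simp
  lTensor_counit_comp_comul := by
    refine LinearMap.ext fun c => ?_
    have h := LinearMap.congr_fun (Coalgebra.rTensor_counit_comp_comul (R := R) (A := C)) c
    simp only [LinearMap.comp_apply, LinearEquiv.coe_coe] at h ⊢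
    trans TensorProduct.comm R R C (Coalgebra.counit.rTensor C (Coalgebra.comul (R := R) c))
    · generalize Coalgebra.comul (R := R) c = z
      induction z <;> simp_all
    · rw [h]; simp

instance : Coalgebra R (Coopposite C) := coalgebra R C

/-- The identity as an anti-isomorphism from a coalgebra to its co-opposite. -/
def antiEquiv : CoalgAntiEquiv R C (Coopposite C) where
  equiv := LinearEquiv.refl R C
  counit_apply _ := rfl
  comul_apply c := by
    have h : TensorProduct.congr (LinearEquiv.refl R C) (LinearEquiv.refl R C) =
        LinearEquiv.refl R (C ⊗[R] C) := TensorProduct.congr_refl_refl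
    exact (LinearEquiv.congr_fun h (TensorProduct.comm R C C (Coalgebra.comul (R := R) c))).symm

end Coopposite

theorem mainTheorem5 (R : Type u) [CommRing R]
    (C : Type u) [AddCommGroup C] [Module R C] [Coalgebra R C] [Module.Flat R C]
    (D : Type u) [AddCommGroup D] [Module R D] [Coalgebra R D] [Module.Flat R D]
    (X : Bicomodule R C D) :
    List.TFAE [
      X.Invertible,
      X.cotensorLeft.IsEquivalence,
      ∃ _ : X.toRight.QuasiFinite,
        X.toRight.FaithfullyCoflat ∧ X.toRight.IsInjector ∧ X.RightCoendIso,
      ∃ _ : X.toLeft.QuasiFinite,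
        X.toLeft.FaithfullyCoflat ∧ X.toLeft.IsInjector ∧ X.LeftCoendIso] ∧
    (X.Invertible → MoritaTakeuchiEquivalent R C D) := by
  let σ := Coopposite.antiEquiv R C
  let τ := Coopposite.antiEquiv R D
  have tfae : List.TFAE [
      X.Invertible,
      X.cotensorLeft.IsEquivalence,
      ∃ _ : X.toRight.QuasiFinite,
        X.toRight.FaithfullyCoflat ∧ X.toRight.IsInjector ∧ X.RightCoendIso,
      ∃ _ : X.toLeft.QuasiFinite,
        X.toLeft.FaithfullyCoflat ∧ X.toLeft.IsInjector ∧ X.LeftCoendIso] := by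
    tfae_have 1 → 4 := fun h => h.left
    -- Condition 4 for `X` is condition 3 for the opposite bicomodule, which is therefore
    -- invertible; this is condition 2 for `X`.
    tfae_have 4 → 2 := fun h => (X.isEquivalence_cotensorLeft_iff σ τ).2
      (Bicomodule.invertible_of_right (Bicomodule.right_op_of_left σ τ h))
    -- By condition 2 the opposite bicomodule is invertible, so it satisfies condition 4 by the
    -- implication 1 → 4. Taking opposites once more turns this into condition 3 for `X`.
    tfae_have 2 → 3 := fun h => by
      have h1 := Bicomodule.right_op_of_left τ.symm σ.symm
        ((X.isEquivalence_cotensorLeft_iff σ τ).1 h).left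
      rwa [X.op_op σ τ] at h1
    tfae_have 3 → 1 := Bicomodule.invertible_of_right
    tfae_finish
  refine ⟨tfae, fun h => ⟨?_, ?_⟩⟩
  · have : X.cotensorRight.IsEquivalence := h
    exact ⟨X.cotensorRight.asEquivalence⟩
  · have : X.cotensorLeft.IsEquivalence := (tfae.out 0 1).1 h
    -- `X □ -` goes from left `D`-comodules to left `C`-comodules, hence the inverse.
    exact ⟨X.cotensorLeft.asEquivalence.symm⟩
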